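/- **Theorem (Weighted distances in the erased configuration model).** For every $n$ let $\boldsymbol d=(d_1,\dots,d_n)$ be a deterministic sequence of nonnegative integers (depending on $n$), let $\mathcal H_n=\sum_{v\in[n]}d_v$, let $F_n(x)=\frac1n\#\{v\in[n]:d_v\le x\}$ be the empirical degree distribution function, let $D_n$ have distribution function $F_n$, and let $\mathbb P(B_n=k)=\frac{k+1}{\mathcal H_n}\#\{v\in[n]:d_v=k+1\}$. Assume: 1. there are $\tau\in(2,3)$, $\gamma\in(0,1)$, $C>0$, $\alpha>1/2$ such that for all sufficiently large $n$ one has $\min_{v\in[n]}d_v\ge 2$ and, for all $x\in[1,n^\alpha)$, $$\frac{1}{x^{\tau-1}}e^{-C(\log x)^\gamma}\le 1-F_n(x)\le \frac1{x^{\tau-1}}e^{C(\log x)^\gamma};$$ 2. there are probability distributions $D,B$ on $\mathbb N$ and $\kappa>0$ such that for all sufficiently large $n$ the total variation distances satisfy $\max\{d_{TV}(D_n,D),d_{TV}(B_n,B)\}\le n^{-\kappa}$. Attach $d_v$ half-edges to every vertex $v\in[n]$ (plus one additional half-edge to vertex $n$ if $\mathcal H_n$ is odd), match all half-edges uniformly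 at random, and give the resulting edges i.i.d. nonnegative real weights with law $L$, independent of the matching. Then remove all self-loops and, for every two vertices joined by several edges, keep one of these edges, chosen uniformly at random independently of the weights, and delete the others. The result is the weighted erased configuration model. Let $u,v$ be independent uniform vertices in $[n]$, independent of everything else. Let $d_L^e(u,v)$ be the minimum, over all paths from $u$ to $v$ in the erased graph, of the sum of the weights along the path ($0$ if $u=v$, and $\infty$ if $u$ and $v$ are not connected), and let $d_H^e(u,v)$ be the number of edges of a path attaining this minimum (the smallest such number if there are several such paths; $\infty$ if $u$ and $v$ are not connected). Let $F_L$ be the distribution function of $L$, let $F_L^{(-1)}(x)=\inf\{y\in\mathbb R:F_L(y)\ge x\}$, and suppose that $$\sum_{k=1}^\infty F_L^{(-1)}\big(e^{-e^k}\big)=\infty .$$ Put $$a_n=2\sum_{i=1}^{\left\lfloor \frac{\log\log n}{|\log(\tau-2)|}\right\rfloor}F_L^{(-1)}\Big(e^{-\left(\frac1{\tau-2}\right)^i}\Big).$$ Then $d_L^e(u,v)/a_n\to 1$ in probability as $n\to\infty$. Moreover, for every $\varepsilon>0$, $$\lim_{n\to\infty}\mathbb P\Big(d_H^e(u,v)\Big/\frac{2\log\log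 n}{|\log(\tau-2)|}\ \ge\ 1-\varepsilon\Big)=1,$$ and, with probability tending to $1$ as $n\to\infty$, there is a path from $u$ to $v$ in the erased graph with total weight at most $(1+\varepsilon)a_n$ and with at most $(1+\varepsilon)\frac{2\log\log n}{|\log(\tau-2)|}$ edges. -/

import Mathlib

open MeasureTheory ProbabilityTheory Filter Topology

noncomputable section

namespace ErasedCM

/-! ### Degree sequences and the assumptions on them -/

/-- Total degree `H_n`. -/
def totalDegree {n : ℕ} (d : Fin n → ℕ) : ℕ := ∑ v, d v

/-- The degrees actually used for pairing: if the total degree is odd, the last vertex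
receives one additional half-edge. -/
def pairedDegree {n : ℕ} (d : Fin n → ℕ) (v : Fin n) : ℕ :=
  d v + if Odd (totalDegree d) ∧ (v : ℕ) + 1 = n then 1 else 0

/-- Probability mass `P(D_n = k)`, with `D_n` the degree of a uniform vertex. -/
def degreeMass {n : ℕ} (d : Fin n → ℕ) (k : ℕ) : ℝ :=
  ((Finset.univ.filter fun v => d v = k).card : ℝ) / n

/-- Empirical distribution function `F_n(x) = P(D_n ≤ x)`. -/
def empiricalCDF {n : ℕ} (d : Fin n → ℕ) (x : ℝ) : ℝ :=
  ((Finset.univ.filter fun v => (d v : ℝ) ≤ x).card : ℝ) / n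

/-- Probability mass `P(B_n = k)` of the size-biased degree minus one. -/
def sizeBiasedMass {n : ℕ} (d : Fin n → ℕ) (k : ℕ) : ℝ :=
  ((k : ℝ) + 1) / totalDegree d * ((Finset.univ.filter fun v => d v = k + 1).card : ℝ)

/-- Power-law tail with exponent `τ` for a sequence of degree sequences, and minimal degree at
least two. The constants do not depend on `n`. The bounds are required from `x = 1` on, where
`(log x) ^ γ` is a real power of a nonnegative number. -/
def PowerLawTail (d : (n : ℕ) → Fin n → ℕ) (τ : ℝ) : Prop :=
  2 < τ ∧ τ < 3 ∧
  ∃ γ C α : ℝ, 0 < γ ∧ γ < 1 ∧ 0 < C ∧ 1 / 2 < α ∧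
    ∀ᶠ n : ℕ in atTop,
      (∀ v, 2 ≤ d n v) ∧
      ∀ x : ℝ, 1 ≤ x → x < (n : ℝ) ^ α →
        1 / x ^ (τ - 1) * Real.exp (-C * (Real.log x) ^ γ) ≤ 1 - empiricalCDF (d n) x ∧
        1 - empiricalCDF (d n) x ≤ 1 / x ^ (τ - 1) * Real.exp (C * (Real.log x) ^ γ)

/-- Total variation distance of two mass functions on `ℕ`. -/
def tvDist (p q : ℕ → ℝ) : ℝ := (1 / 2) * ∑' k, |p k - q k|

/-- Existence of limiting laws `D` of `D_n` and `B` of `B_n`, with polynomial rate in total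
variation. -/
def HasLimitingDistributions (d : (n : ℕ) → Fin n → ℕ) : Prop :=
  ∃ D B : PMF ℕ, ∃ κ : ℝ, 0 < κ ∧
    ∀ᶠ n : ℕ in atTop,
      max (tvDist (degreeMass (d n)) fun k => (D k).toReal)
          (tvDist (sizeBiasedMass (d n)) fun k => (B k).toReal) ≤ (n : ℝ) ^ (-κ)

/-! ### The edge-weight distribution -/

/-- Generalised inverse `inf {y ∈ ℝ : F y ≥ x}`. -/
def generalizedInverse (F : ℝ → ℝ) (x : ℝ) : ℝ := sInf {y : ℝ | x ≤ F y}

/-- The divergence condition `∑_{k ≥ 1} F_L^{(-1)}(exp (-exp k)) = ∞`. -/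
def NonExplosive (ν : Measure ℝ) : Prop :=
  Tendsto (fun N : ℕ => ∑ k ∈ Finset.Icc 1 N,
    generalizedInverse (cdf ν) (Real.exp (-Real.exp k))) atTop atTop

/-- `log log n / |log (τ - 2)|`. -/
def depth (τ : ℝ) (n : ℕ) : ℝ := Real.log (Real.log n) / |Real.log (τ - 2)|

/-- `2 ∑_{i=1}^{⌊log log n / |log (τ - 2)|⌋} F_L^{(-1)}(exp (-(1 / (τ - 2)) ^ i))`. -/
def typicalDist (ν : Measure ℝ) (τ : ℝ) (n : ℕ) : ℝ :=
  2 * ∑ i ∈ Finset.Icc 1 ⌊depth τ n⌋₊,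
    generalizedInverse (cdf ν) (Real.exp (-(1 / (τ - 2)) ^ i))

/-! ### Distances in weighted graphs -/

section Distances

variable {V : Type*} (G : SimpleGraph V) (w : Sym2 V → ℝ)

/-- Total weight of the edges of a walk. -/
def walkWeight {G : SimpleGraph V} {x y : V} (p : G.Walk x y) : ℝ := (p.edges.map w).sum

/-- Weighted distance: the minimum of the weights of all paths, `∞` if there is none. -/
def weightedDist (x y : V) : EReal := ⨅ p : G.Path x y, (walkWeight w p.1 : EReal)

/-- Hopcount: the number of edges of an optimal path (the smallest such number, if there are
several optimal paths; `∞` if `x` and `y` are not connected). -/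
def hopcount (x y : V) : ℕ∞ :=
  ⨅ (p : G.Path x y) (_ : (walkWeight w p.1 : EReal) = weightedDist G w x y), (p.1.length : ℕ∞)

end Distances

/-! ### The configuration model and its erasure -/

/-- Half-edges: `pairedDegree d v` of them are attached to every vertex `v`. -/
abbrev HalfEdge {n : ℕ} (d : Fin n → ℕ) : Type := Σ v : Fin n, Fin (pairedDegree d v)

/-- Perfect matchings of the half-edges, as involutions without fixed points. -/
def Pairing {n : ℕ} (d : Fin n → ℕ) : Type :=
  {σ : HalfEdge d → HalfEdge d // Function.Involutive σ ∧ ∀ h, σ h ≠ h}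

instance {n : ℕ} (d : Fin n → ℕ) : MeasurableSpace (Pairing d) := ⊤

/-- Potential edges: unordered pairs of half-edges. -/
abbrev PotentialEdge {n : ℕ} (d : Fin n → ℕ) : Type := Sym2 (HalfEdge d)

/-- The two end-vertices of an edge. -/
def ends {n : ℕ} {d : Fin n → ℕ} (e : PotentialEdge d) : Sym2 (Fin n) := e.map Sigma.fst

/-- The edges of the configuration model, the pairs `{h, σ h}`. -/
def cmEdges {n : ℕ} {d : Fin n → ℕ} (σ : Pairing d) : Finset (PotentialEdge d) :=
  Finset.univ.image fun h => s(h, σ.1 h)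

/-- The edges of the configuration model with a given pair of end-vertices. -/
def cmEdgesBetween {n : ℕ} {d : Fin n → ℕ} (σ : Pairing d) (p : Sym2 (Fin n)) :
    Finset (PotentialEdge d) :=
  (cmEdges σ).filter fun e => ends e = p

/-- A selection picks an element of every nonempty set of potential edges. Under the uniform law
on selections, the elements picked from different sets are independent and uniform. -/
def Selection {n : ℕ} (d : Fin n → ℕ) : Type :=
  (S : {S : Finset (PotentialEdge d) // S.Nonempty}) → {e : PotentialEdge d // e ∈ S.1}

instance {n : ℕ} (d : Fin n → ℕ) : MeasurableSpace (Selection d) := ⊤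

/-- Sample space of the weighted erased configuration model with two marked vertices: a pairing
of the half-edges, a selection among parallel edges, a weight for every potential edge, and the
vertices `u` and `v`. -/
abbrev Sample {n : ℕ} (d : Fin n → ℕ) : Type :=
  Pairing d × Selection d × (PotentialEdge d → ℝ) × (Fin n × Fin n)

/-- The pairing is uniform, the selection is uniform, the weights are i.i.d. with law `ν`, and
`u` and `v` are uniform vertices, all independent. -/
def law {n : ℕ} (d : Fin n → ℕ) (ν : Measure ℝ) [IsProbabilityMeasure ν] : Measure (Sample d) :=
  (uniformOn (Set.univ : Set (Pairing d))).prod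
    ((uniformOn (Set.univ : Set (Selection d))).prod
      ((Measure.pi fun _ : PotentialEdge d => ν).prod
        (uniformOn (Set.univ : Set (Fin n × Fin n)))))

namespace Sample

variable {n : ℕ} {d : Fin n → ℕ} (ω : Sample d)

/-- The marked vertex `u`. -/
def u : Fin n := ω.2.2.2.1

/-- The marked vertex `v`. -/
def v : Fin n := ω.2.2.2.2

/-- The erased configuration model as a simple graph: self-loops are removed, and parallel edges
are merged into one. -/
def graph : SimpleGraph (Fin n) where
  Adj x y := x ≠ y ∧ (cmEdgesBetween ω.1 s(x, y)).Nonempty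
  symm := ⟨fun x y h => ⟨h.1.symm, by rw [Sym2.eq_swap]; exact h.2⟩⟩
  loopless := ⟨fun _ h => h.1 rfl⟩

open Classical in
/-- Weights in the erased model: the edge that is kept between `x` and `y` is the one selected
among all edges between them, and it keeps its weight. -/
def weight (p : Sym2 (Fin n)) : ℝ :=
  if h : (cmEdgesBetween ω.1 p).Nonempty then ω.2.2.1 (ω.2.1 ⟨cmEdgesBetween ω.1 p, h⟩).1 else 0

/-- `d_L^e(u, v)`. -/
def dL : EReal := weightedDist ω.graph ω.weight ω.u ω.v

/-- `d_H^e(u, v)`. -/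
def dH : ℕ∞ := hopcount ω.graph ω.weight ω.u ω.v

end Sample

end ErasedCM

end

noncomputable section

namespace ErasedCM

/-! ### Uniform pairings conditioned on some of their pairs -/

section Pairings

/-! Both bounds rest on doubly exponential growth of degrees. The vertices of degree above `x` carry
a proportion of about `x ^ (-(τ - 2))` of the half-edges, so a vertex with `y` half-edges has
neighbours of degree up to about `y ^ (1 / (τ - 2))`. Along thresholds `exp (G * ρ ^ k)` with `ρ`
near `1 / (τ - 2)`, of order `exp (O(ρ ^ k))` edges compete at step `k`, and the cheapest of them
costs a quantile of the weight law at a level `exp (-c * ρ ^ k)`. Degrees that are a power of `n`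
are reached after about `log log n / |log (τ - 2)|` steps from either end, which gives the factor
two in the typical distance.

With `tailQuantile`, the quantile at `exp (-exp t)`, these sums become Riemann sums of an antitone
function with mesh `log ρ`, and the constants `c` become shifts of the argument. Both the costs and
the typical distance are compared with the primitive of this function at `log log n`
(`typicalDist_le`, `le_typicalDist`). Since the primitive tends to infinity, shifts and boundedly
many extra edges of bounded weight are negligible, and a change of `ρ` by a small power only costs a
factor near one (`mul_primitive_le`).

Lower bound: take `ρ` slightly above `1 / (τ - 2)`. A truncated first moment over paths
(`condAvg_pathEvent_le`, `sum_highDegree_le`) shows that from most vertices no degree above `exp (G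
* ρ ^ k)` is met within distance `k`. Then the balls are small, so two of them rarely meet
(`card_close_pairs_le`), and all edges leaving them cost at least a quantile (`pi_cheapExit_le`).
The deterministic estimate `two_mul_sum_le_walkWeight` turns this into a bound for every walk, and
the same disjointness bounds the number of edges.

Upper bound: take `ρ` slightly below `1 / (τ - 2)`. From each end, boundedly many steps of bounded
cost find a vertex of degree at least `exp G` (`condAvg_preStage_compl_le`); a chain of greedy
stages with cheap edges then climbs through the thresholds (`condAvg_step_compl_le`,
`condAvg_stageEvent_compl_le`) up to degree `n ^ β` with `β > 1 / 2`. All vertices of such a degree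
are adjacent to one fixed hub of that degree (`condAvg_not_adj_le`), where the two paths are joined.

The pairing is handled through averages over cylinders: given the revealed pairs, the next partner
is uniform (`condAvg_reveal`). The weights are integrated out for a fixed pairing, and independence
survives the exploration because the events ignore the weights at vertices already used
(`AvoidingEvent`, `EdgeLaw.step_compl_le`). `law_le_of_average` returns to the law of the model. -/

open Classical in
instance {n : ℕ} (d : Fin n → ℕ) : Fintype (Pairing d) :=
  inferInstanceAs (Fintype {σ : HalfEdge d → HalfEdge d // Function.Involutive σ ∧ ∀ h, σ h ≠ h})

variable {n : ℕ} {d : Fin n → ℕ}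

theorem Pairing.apply_apply (σ : Pairing d) (h : HalfEdge d) : σ.1 (σ.1 h) = h := σ.2.1 h

theorem Pairing.apply_ne (σ : Pairing d) (h : HalfEdge d) : σ.1 h ≠ h := σ.2.2 h

theorem Pairing.apply_eq_comm (σ : Pairing d) {a b : HalfEdge d} : σ.1 a = b ↔ σ.1 b = a :=
  ⟨fun h => by rw [← h, σ.apply_apply], fun h => by rw [← h, σ.apply_apply]⟩

/-- The pairings that agree with `τ` on `Θ`. -/
def cyl (τ : Pairing d) (Θ : Finset (HalfEdge d)) : Finset (Pairing d) :=
  Finset.univ.filter fun σ => ∀ h ∈ Θ, σ.1 h = τ.1 h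

theorem mem_cyl {τ σ : Pairing d} {Θ : Finset (HalfEdge d)} :
    σ ∈ cyl τ Θ ↔ ∀ h ∈ Θ, σ.1 h = τ.1 h := by simp [cyl]

theorem self_mem_cyl (τ : Pairing d) (Θ : Finset (HalfEdge d)) : τ ∈ cyl τ Θ := by simp [mem_cyl]

theorem cyl_empty (τ : Pairing d) : cyl τ ∅ = Finset.univ := by
  ext; simp [mem_cyl]

/-- A set of half-edges that is a union of pairs. -/
def Closed (τ : Pairing d) (Θ : Finset (HalfEdge d)) : Prop := ∀ h ∈ Θ, τ.1 h ∈ Θ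

theorem closed_empty (τ : Pairing d) : Closed τ ∅ := by simp [Closed]

theorem Closed.apply_notMem {τ : Pairing d} {Θ : Finset (HalfEdge d)} (hc : Closed τ Θ)
    {h : HalfEdge d} (hh : h ∉ Θ) : τ.1 h ∉ Θ := fun hm =>
  hh (by simpa [τ.apply_apply] using hc _ hm)

theorem Closed.of_mem_cyl {τ σ : Pairing d} {Θ : Finset (HalfEdge d)} (hc : Closed τ Θ)
    (hσ : σ ∈ cyl τ Θ) : Closed σ Θ := fun h hh => by
  rw [mem_cyl.1 hσ h hh]; exact hc h hh

theorem Closed.insert_pair {τ : Pairing d} {Θ : Finset (HalfEdge d)} (hc : Closed τ Θ)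
    {a b : HalfEdge d} (hab : τ.1 a = b) : Closed τ (insert a (insert b Θ)) := by
  intro h hh
  simp only [Finset.mem_insert] at hh ⊢
  rcases hh with rfl | rfl | hh
  · exact Or.inr (Or.inl hab)
  · exact Or.inl (τ.apply_eq_comm.1 hab)
  · exact Or.inr (Or.inr (hc h hh))

theorem cyl_insert_pair {τ σ : Pairing d} {Θ : Finset (HalfEdge d)} {a b : HalfEdge d}
    (hσ : σ ∈ cyl τ Θ) (hab : σ.1 a = b) :
    cyl σ (insert a (insert b Θ)) = (cyl τ Θ).filter fun σ' => σ'.1 a = b := by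
  ext σ'
  simp only [mem_cyl, Finset.mem_filter, Finset.mem_insert, forall_eq_or_imp]
  rw [mem_cyl] at hσ
  constructor
  · rintro ⟨h1, _, h3⟩
    exact ⟨fun h hh => (h3 h hh).trans (hσ h hh), h1.trans hab⟩
  · rintro ⟨h1, h2⟩
    refine ⟨h2.trans hab.symm, ?_, fun h hh => (h1 h hh).trans (hσ h hh).symm⟩
    rw [σ.apply_eq_comm.1 hab, σ'.apply_eq_comm.1 h2]

/-- Relabelling of the half-edges. -/
def Pairing.conj (e : Equiv.Perm (HalfEdge d)) (σ : Pairing d) : Pairing d :=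
  ⟨fun h => e (σ.1 (e.symm h)), fun h => by simp [σ.apply_apply], fun h hh => by
    apply σ.apply_ne (e.symm h)
    rw [Equiv.eq_symm_apply]; exact hh⟩

/-- Relabelling by the transposition of `b` and `b'` is injective on pairings. It fixes `h` and all
of `Θ`, hence preserves the cylinder, and turns the partner `b` of `h` into `b'`. Applied in both
directions it gives uniformity of the partner. -/
theorem card_filter_le {τ : Pairing d} {Θ : Finset (HalfEdge d)} (hc : Closed τ Θ)
    {h b b' : HalfEdge d} (hb : b ∉ Θ) (hb' : b' ∉ Θ) (hbh : b ≠ h) (hbh' : b' ≠ h) :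
    ((cyl τ Θ).filter fun σ => σ.1 h = b).card ≤ ((cyl τ Θ).filter fun σ => σ.1 h = b').card := by
  classical
  have hfix : ∀ x ∈ Θ, Equiv.swap b b' x = x := fun x hx =>
    Equiv.swap_apply_of_ne_of_ne (fun e => hb (e ▸ hx)) (fun e => hb' (e ▸ hx))
  have hfixh : Equiv.swap b b' h = h := Equiv.swap_apply_of_ne_of_ne hbh.symm hbh'.symm
  refine Finset.card_le_card_of_injOn (Pairing.conj (Equiv.swap b b')) ?_ ?_
  · intro σ hσ
    simp only [Finset.coe_filter, Set.mem_ofPred_eq, mem_cyl] at hσ ⊢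
    refine ⟨fun x hx => ?_, ?_⟩
    · simp only [Pairing.conj, Equiv.symm_swap]
      rw [hfix x hx, hσ.1 x hx, hfix _ (hc x hx)]
    · simp only [Pairing.conj, Equiv.symm_swap]
      rw [hfixh, hσ.2, Equiv.swap_apply_left]
  · intro σ _ σ' _ heq
    apply Subtype.ext
    funext x
    have := congrFun (congrArg Subtype.val heq) (Equiv.swap b b' x)
    simpa [Pairing.conj] using this

/-- The half-edges that may be paired with `h`, given the pairs in `Θ`. -/
def partners (Θ : Finset (HalfEdge d)) (h : HalfEdge d) : Finset (HalfEdge d) :=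
  (Finset.univ \ Θ).erase h

theorem mem_partners {Θ : Finset (HalfEdge d)} {h b : HalfEdge d} :
    b ∈ partners Θ h ↔ b ≠ h ∧ b ∉ Θ := by simp [partners]

theorem card_partners {Θ : Finset (HalfEdge d)} {h : HalfEdge d} (hh : h ∉ Θ) :
    (partners Θ h).card + Θ.card + 1 = Fintype.card (HalfEdge d) := by
  have h1 : (Finset.univ \ Θ).card + Θ.card = Fintype.card (HalfEdge d) := by
    rw [Finset.card_sdiff_add_card_eq_card (Finset.subset_univ _), Finset.card_univ]
  have h2 : h ∈ Finset.univ \ Θ := by simp [hh]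
  have h3 := Finset.card_erase_add_one h2
  unfold partners
  omega

theorem card_cyl_eq {τ : Pairing d} {Θ : Finset (HalfEdge d)} (hc : Closed τ Θ)
    {h b : HalfEdge d} (hh : h ∉ Θ) (hb : b ∈ partners Θ h) :
    (cyl τ Θ).card = (partners Θ h).card * ((cyl τ Θ).filter fun σ => σ.1 h = b).card := by
  classical
  rw [Finset.card_eq_sum_card_fiberwise (f := fun σ : Pairing d => σ.1 h) (t := partners Θ h)]
  · rw [← smul_eq_mul, ← Finset.sum_const]
    refine Finset.sum_congr rfl fun b' hb' => ?_
    rw [mem_partners] at hb hb'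
    exact le_antisymm (card_filter_le hc hb'.2 hb.2 hb'.1 hb.1)
      (card_filter_le hc hb.2 hb'.2 hb.1 hb'.1)
  · intro σ hσ
    simp only [Finset.mem_coe, mem_partners]
    exact ⟨σ.apply_ne h, (hc.of_mem_cyl hσ).apply_notMem hh⟩

/-- Conditional expectation, given that the pairing agrees with `τ` on `Θ`. -/
def condAvg (τ : Pairing d) (Θ : Finset (HalfEdge d)) (φ : Pairing d → ℝ) : ℝ :=
  (∑ σ ∈ cyl τ Θ, φ σ) / (cyl τ Θ).card

theorem card_cyl_pos (τ : Pairing d) (Θ : Finset (HalfEdge d)) : (0 : ℝ) < (cyl τ Θ).card := by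
  exact_mod_cast Finset.card_pos.2 ⟨τ, self_mem_cyl τ Θ⟩

theorem condAvg_le_iff {τ : Pairing d} {Θ : Finset (HalfEdge d)} {φ : Pairing d → ℝ} {c : ℝ} :
    condAvg τ Θ φ ≤ c ↔ ∑ σ ∈ cyl τ Θ, φ σ ≤ c * (cyl τ Θ).card := by
  rw [condAvg, div_le_iff₀ (card_cyl_pos τ Θ)]

theorem condAvg_mono {τ : Pairing d} {Θ : Finset (HalfEdge d)} {φ ψ : Pairing d → ℝ}
    (h : ∀ σ ∈ cyl τ Θ, φ σ ≤ ψ σ) : condAvg τ Θ φ ≤ condAvg τ Θ ψ := by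
  unfold condAvg
  gcongr with σ hσ
  exact h σ hσ

theorem condAvg_const (τ : Pairing d) (Θ : Finset (HalfEdge d)) (c : ℝ) :
    condAvg τ Θ (fun _ => c) = c := by
  rw [condAvg, Finset.sum_const, nsmul_eq_mul, mul_div_cancel_left₀ _ (card_cyl_pos τ Θ).ne']

theorem condAvg_add (τ : Pairing d) (Θ : Finset (HalfEdge d)) (φ ψ : Pairing d → ℝ) :
    condAvg τ Θ (fun σ => φ σ + ψ σ) = condAvg τ Θ φ + condAvg τ Θ ψ := by
  simp only [condAvg, Finset.sum_add_distrib, add_div]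

theorem condAvg_mul (τ : Pairing d) (Θ : Finset (HalfEdge d)) (c : ℝ) (φ : Pairing d → ℝ) :
    condAvg τ Θ (fun σ => c * φ σ) = c * condAvg τ Θ φ := by
  simp only [condAvg, ← Finset.mul_sum, mul_div_assoc]

theorem condAvg_sum {ι : Type*} (τ : Pairing d) (Θ : Finset (HalfEdge d)) (s : Finset ι)
    (φ : ι → Pairing d → ℝ) :
    condAvg τ Θ (fun σ => ∑ i ∈ s, φ i σ) = ∑ i ∈ s, condAvg τ Θ (φ i) := by
  simp only [condAvg]
  rw [Finset.sum_comm, Finset.sum_div]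

theorem condAvg_le_const {τ : Pairing d} {Θ : Finset (HalfEdge d)} {φ : Pairing d → ℝ} {c : ℝ}
    (h : ∀ σ ∈ cyl τ Θ, φ σ ≤ c) : condAvg τ Θ φ ≤ c :=
  (condAvg_mono h).trans_eq (condAvg_const τ Θ c)

/-- Revealing the partner of the half-edge `h`: given the pairs in `Θ`, it is uniform among the
other half-edges. -/
theorem condAvg_reveal {τ : Pairing d} {Θ : Finset (HalfEdge d)} (hc : Closed τ Θ)
    {h : HalfEdge d} (hh : h ∉ Θ) {φ : Pairing d → ℝ} {g : HalfEdge d → ℝ}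
    (hg : ∀ b ∈ partners Θ h, ∀ σ ∈ cyl τ Θ, σ.1 h = b → Closed σ (insert h (insert b Θ)) →
      condAvg σ (insert h (insert b Θ)) φ ≤ g b) :
    condAvg τ Θ φ ≤ (∑ b ∈ partners Θ h, g b) / (partners Θ h).card := by
  classical
  have hmem : ∀ σ ∈ cyl τ Θ, σ.1 h ∈ partners Θ h := fun σ hσ =>
    mem_partners.2 ⟨σ.apply_ne h, (hc.of_mem_cyl hσ).apply_notMem hh⟩
  have hN : (0 : ℝ) < (partners Θ h).card := by
    exact_mod_cast Finset.card_pos.2 ⟨_, hmem τ (self_mem_cyl τ Θ)⟩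
  rw [condAvg_le_iff, ← Finset.sum_fiberwise_of_maps_to hmem, Finset.sum_div, Finset.sum_mul]
  refine Finset.sum_le_sum fun b hb => ?_
  have hcard : ((cyl τ Θ).card : ℝ) =
      (partners Θ h).card * ((cyl τ Θ).filter fun σ => σ.1 h = b).card := by
    exact_mod_cast card_cyl_eq hc hh hb
  rw [hcard, div_mul_eq_mul_div, ← mul_assoc, mul_comm (g b), mul_assoc,
    mul_div_cancel_left₀ _ hN.ne']
  rcases ((cyl τ Θ).filter fun σ => σ.1 h = b).eq_empty_or_nonempty with he | ⟨σ, hσ⟩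
  · simp [he]
  · rw [Finset.mem_filter] at hσ
    have := hg b hb σ hσ.1 hσ.2 ((hc.of_mem_cyl hσ.1).insert_pair hσ.2)
    rwa [condAvg_le_iff, cyl_insert_pair hσ.1 hσ.2] at this

end Pairings

/-! ### The graph of a pairing -/

section PairingGraph

variable {n : ℕ} {d : Fin n → ℕ}

theorem cmEdgesBetween_nonempty_iff (σ : Pairing d) (p : Sym2 (Fin n)) :
    (cmEdgesBetween σ p).Nonempty ↔ ∃ h : HalfEdge d, s(h.1, (σ.1 h).1) = p := by
  constructor
  · rintro ⟨e, he⟩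
    simp only [cmEdgesBetween, cmEdges, Finset.mem_filter, Finset.mem_image] at he
    obtain ⟨⟨h, -, rfl⟩, h2⟩ := he
    exact ⟨h, by simpa [ends] using h2⟩
  · rintro ⟨h, hh⟩
    refine ⟨s(h, σ.1 h), ?_⟩
    simp only [cmEdgesBetween, cmEdges, Finset.mem_filter, Finset.mem_image]
    exact ⟨⟨h, Finset.mem_univ _, rfl⟩, by simpa [ends] using hh⟩

/-- The erased graph of a pairing. -/
def erasedGraph (σ : Pairing d) : SimpleGraph (Fin n) where
  Adj x y := x ≠ y ∧ (cmEdgesBetween σ s(x, y)).Nonempty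
  symm := ⟨fun x y h => ⟨h.1.symm, by rw [Sym2.eq_swap]; exact h.2⟩⟩
  loopless := ⟨fun _ h => h.1 rfl⟩

theorem erasedGraph_adj_iff (σ : Pairing d) (x y : Fin n) :
    (erasedGraph σ).Adj x y ↔ x ≠ y ∧ ∃ h : HalfEdge d, h.1 = x ∧ (σ.1 h).1 = y := by
  change (x ≠ y ∧ (cmEdgesBetween σ s(x, y)).Nonempty) ↔ _
  rw [cmEdgesBetween_nonempty_iff]
  refine and_congr_right fun hne => ⟨?_, ?_⟩
  · rintro ⟨h, hh⟩
    rcases Sym2.eq_iff.1 hh with hh | hh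
    · exact ⟨h, hh⟩
    · exact ⟨σ.1 h, hh.2, by rw [σ.apply_apply]; exact hh.1⟩
  · rintro ⟨h, rfl, rfl⟩
    exact ⟨h, rfl⟩

theorem erasedGraph_adj_of_apply {σ : Pairing d} {a b : HalfEdge d} (h : σ.1 a = b)
    (hne : a.1 ≠ b.1) : (erasedGraph σ).Adj a.1 b.1 :=
  (erasedGraph_adj_iff σ _ _).2 ⟨hne, a, rfl, by rw [h]⟩

/-- The half-edges at the vertex `x`. -/
def halfEdgesAt (d : Fin n → ℕ) (x : Fin n) : Finset (HalfEdge d) :=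
  Finset.univ.filter fun h => h.1 = x

theorem mem_halfEdgesAt {x : Fin n} {h : HalfEdge d} : h ∈ halfEdgesAt d x ↔ h.1 = x := by
  simp [halfEdgesAt]

theorem card_halfEdgesAt (x : Fin n) : (halfEdgesAt d x).card = pairedDegree d x := by
  have : halfEdgesAt d x = Finset.univ.map
      ⟨fun i : Fin (pairedDegree d x) => (⟨x, i⟩ : HalfEdge d), fun i j h => by simpa using h⟩ := by
    ext ⟨y, i⟩
    simp only [mem_halfEdgesAt, Finset.mem_map, Finset.mem_univ, true_and]
    constructor
    · rintro rfl; exact ⟨i, rfl⟩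
    · rintro ⟨j, hj⟩; exact (congrArg Sigma.fst hj).symm
  rw [this, Finset.card_map, Finset.card_univ, Fintype.card_fin]

theorem card_halfEdges_mem (s : Finset (Fin n)) :
    (Finset.univ.filter fun h : HalfEdge d => h.1 ∈ s).card = ∑ x ∈ s, pairedDegree d x := by
  classical
  rw [Finset.card_eq_sum_card_fiberwise (f := fun h : HalfEdge d => h.1) (t := s)]
  · refine Finset.sum_congr rfl fun x hx => ?_
    rw [← card_halfEdgesAt, halfEdgesAt, Finset.filter_filter]
    congr 1
    ext h
    simp only [Finset.mem_filter, Finset.mem_univ, true_and]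
    exact ⟨fun h => h.2, fun h => ⟨h ▸ hx, h⟩⟩
  · intro h hh
    simpa using hh

theorem card_halfEdge : Fintype.card (HalfEdge d) = ∑ x, pairedDegree d x := by
  simp [HalfEdge]

theorem card_neighbors_le (σ : Pairing d) (x : Fin n) (s : Finset (Fin n))
    (hs : ∀ y ∈ s, (erasedGraph σ).Adj x y) : s.card ≤ pairedDegree d x := by
  classical
  rw [← card_halfEdgesAt]
  calc s.card ≤ ((halfEdgesAt d x).image fun h => (σ.1 h).1).card := by
        refine Finset.card_le_card fun y hy => ?_
        obtain ⟨-, h, h1, h2⟩ := (erasedGraph_adj_iff σ x y).1 (hs y hy)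
        exact Finset.mem_image.2 ⟨h, mem_halfEdgesAt.2 h1, h2⟩
    _ ≤ _ := Finset.card_image_le

end PairingGraph

/-! ### Exploration of cheap paths -/

section Exploration

/-- The law `Q` of a family of edge weights restricts to independent weights with law `ν` on the
edges of `G`; the other weights are nonpositive or have smaller tails than `ν`. -/
structure EdgeLaw {V : Type*} (G : SimpleGraph V) (ν : Measure ℝ) (Q : Measure (Sym2 V → ℝ)) :
    Prop where
  prob : IsProbabilityMeasure Q
  indep : ∀ p ∈ G.edgeSet, ∀ E : Set (Sym2 V → ℝ), MeasurableSet E →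
    (∀ W r, (∀ q, q ≠ p → W q = r q) → (W ∈ E ↔ r ∈ E)) → ∀ c : ℝ,
      Q.real (E ∩ {W | W p ≤ c}) = Q.real E * ν.real (Set.Iic c)
  tail : ∀ p, ∀ c : ℝ, 0 ≤ c → Q.real {W | c < W p} ≤ ν.real (Set.Ioi c)

variable {V : Type*} [DecidableEq V]

/-- One step of an exploration from `x` that avoids `A` and uses an edge of weight at most `c`. -/
def Step (G : SimpleGraph V) (c : ℝ) (P : V → Finset V → Set (Sym2 V → ℝ)) (x : V)
    (A : Finset V) : Set (Sym2 V → ℝ) :=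
  {W | ∃ z, z ∉ insert x A ∧ G.Adj x z ∧ W s(x, z) ≤ c ∧ W ∈ P z (insert x A)}

/-- A family of events that get smaller when more vertices are forbidden, and that do not depend
on the weights of edges at forbidden vertices other than the hub `hub`. -/
structure AvoidingEvent (hub : V) (P : V → Finset V → Set (Sym2 V → ℝ)) : Prop where
  anti : ∀ x A A', A ⊆ A' → P x A' ⊆ P x A
  meas : ∀ x A, MeasurableSet (P x A)
  avoid : ∀ x A a b, x ∉ A → a ∈ A → a ≠ hub → ∀ W W' : Sym2 V → ℝ,
    (∀ q, q ≠ s(a, b) → W q = W' q) → (W ∈ P x A ↔ W' ∈ P x A)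

/-- The only new weight is that of the edge from `x` to `z`, and neither end lies in `A`; so a step
cannot look at an edge with an end in `A`. Adding `x` to the forbidden set carries this through the
recursion. -/
theorem AvoidingEvent.step [Countable V] {hub : V} {P : V → Finset V → Set (Sym2 V → ℝ)}
    (hP : AvoidingEvent hub P) (G : SimpleGraph V) (c : ℝ) : AvoidingEvent hub (Step G c P) where
  anti := by
    rintro x A A' hA W ⟨z, hz, hadj, hw, hWP⟩
    exact ⟨z, fun h => hz (Finset.insert_subset_insert x hA h), hadj, hw,
      hP.anti _ _ _ (Finset.insert_subset_insert x hA) hWP⟩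
  meas := by
    intro x A
    have : Step G c P x A = ⋃ z, {W | (z ∉ insert x A ∧ G.Adj x z)} ∩
        ({W | W s(x, z) ≤ c} ∩ P z (insert x A)) := by
      ext W
      simp only [Step, Set.mem_iUnion, Set.mem_inter_iff, Set.mem_ofPred_eq, and_assoc]
    rw [this]
    refine MeasurableSet.iUnion fun z => (MeasurableSet.const _).inter
      (MeasurableSet.inter ?_ (hP.meas _ _))
    exact measurableSet_le (measurable_pi_apply _) measurable_const
  avoid := by
    intro x A a b hx ha hah W W' hWW
    simp only [Step, Set.mem_ofPred_eq]
    refine exists_congr fun z => and_congr_right fun hz => and_congr_right fun hadj => ?_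
    have hne : s(x, z) ≠ s(a, b) := by
      intro h
      rcases Sym2.eq_iff.1 h with h | h
      · exact hx (h.1 ▸ ha)
      · exact hz (Finset.mem_insert_of_mem (h.2 ▸ ha))
    rw [hWW _ hne, hP.avoid z (insert x A) a b hz (Finset.mem_insert_of_mem ha) hah W W' hWW]

/-- If the edge from `x` to `z` is cheap, failure forces failure from `z` with `x` forbidden; if it
is expensive, failure forces failure from `x` with `z` forbidden. Both failure events ignore the
weight of that edge, so each factorises. This is where avoidance pays: no conditioning on weights is
carried along. -/
theorem EdgeLaw.step_compl_le [Countable V] {hub : V} {P : V → Finset V → Set (Sym2 V → ℝ)}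
    {G : SimpleGraph V} {ν : Measure ℝ} [IsProbabilityMeasure ν] {Q : Measure (Sym2 V → ℝ)}
    (hQ : EdgeLaw G ν Q)
    (hP : AvoidingEvent hub P) {x z : V} {A : Finset V} (hx : x ∉ A) (hh : hub ∈ A)
    (hz : z ∉ insert x A) (hadj : G.Adj x z) (c : ℝ) :
    Q.real (Step G c P x A)ᶜ ≤ (1 - ν.real (Set.Iic c)) * Q.real (Step G c P x (insert z A))ᶜ +
      ν.real (Set.Iic c) * Q.real (P z (insert x A))ᶜ := by
  have := hQ.prob
  have hzh : z ≠ hub := fun h => hz (Finset.mem_insert_of_mem (h ▸ hh))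
  have hxh : x ≠ hub := fun h => hx (h ▸ hh)
  have hzx : z ≠ x := fun h => hz (h ▸ Finset.mem_insert_self _ _)
  have hxz : x ∉ insert z A := by simp [hx, hzx.symm]
  have hS := hP.step G c
  set F₁ := (Step G c P x (insert z A))ᶜ with hF₁
  set F₂ := (P z (insert x A))ᶜ with hF₂
  have hm₁ : MeasurableSet F₁ := (hS.meas _ _).compl
  have hm₂ : MeasurableSet F₂ := (hP.meas _ _).compl
  have hmc : MeasurableSet {W : Sym2 V → ℝ | W s(x, z) ≤ c} :=
    measurableSet_le (measurable_pi_apply _) measurable_const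
  have h₁ : Q.real (F₁ ∩ {W | W s(x, z) ≤ c}) = Q.real F₁ * ν.real (Set.Iic c) := by
    refine hQ.indep s(x, z) hadj F₁ hm₁ (fun W W' hWW => not_congr ?_) c
    rw [Sym2.eq_swap] at hWW
    exact hS.avoid x (insert z A) z x hxz (Finset.mem_insert_self _ _) hzh W W' hWW
  have h₂ : Q.real (F₂ ∩ {W | W s(x, z) ≤ c}) = Q.real F₂ * ν.real (Set.Iic c) := by
    refine hQ.indep s(x, z) hadj F₂ hm₂ (fun W W' hWW => not_congr ?_) c
    exact hP.avoid z (insert x A) x z hz (Finset.mem_insert_self _ _) hxh W W' hWW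
  have h₃ : Q.real (F₁ \ {W | W s(x, z) ≤ c}) = Q.real F₁ - Q.real F₁ * ν.real (Set.Iic c) := by
    have := measureReal_inter_add_sdiff (μ := Q) (s := F₁) hmc
    linarith
  calc Q.real (Step G c P x A)ᶜ
      ≤ Q.real ((F₁ \ {W | W s(x, z) ≤ c}) ∪ (F₂ ∩ {W | W s(x, z) ≤ c})) := by
        refine measureReal_mono fun W hW => ?_
        by_cases hc : W s(x, z) ≤ c
        · exact Or.inr ⟨fun h => hW ⟨z, hz, hadj, hc, h⟩, hc⟩
        · exact Or.inl ⟨fun h => hW (hS.anti _ _ _ (Finset.subset_insert z A) h), hc⟩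
    _ ≤ _ := measureReal_union_le _ _
    _ = _ := by rw [h₂, h₃]; ring

variable {n : ℕ} {d : Fin n → ℕ}

/-- No half-edge at a vertex of `s` is revealed and `h` is not at one of them, so all half-edges of
`s` are possible partners. The partner therefore lies in `s` with probability at least `p`, and each
such hit saves `Δ`. -/
theorem sum_ite_partners_le {Θ : Finset (HalfEdge d)} {h : HalfEdge d} {s : Finset (Fin n)}
    (hs : ∀ z ∈ s, z ≠ h.1 ∧ ∀ b ∈ Θ, b.1 ≠ z) (hh : h ∉ Θ) {p G Δ : ℝ} (hΔ : 0 ≤ Δ) (hp0 : 0 ≤ p)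
    (hp : p * Fintype.card (HalfEdge d) ≤ ∑ z ∈ s, (pairedDegree d z : ℝ))
    (hN : 0 < (partners Θ h).card) :
    (∑ b ∈ partners Θ h, (if b.1 ∈ s then G - Δ else G)) / (partners Θ h).card ≤ G - p * Δ := by
  classical
  have hN' : (0 : ℝ) < (partners Θ h).card := by exact_mod_cast hN
  have h1 : ∀ b : HalfEdge d, (if b.1 ∈ s then G - Δ else G) = G - if b.1 ∈ s then Δ else 0 := by
    intro b; split_ifs <;> simp
  simp_rw [h1]
  rw [Finset.sum_sub_distrib, Finset.sum_const, nsmul_eq_mul, ← Finset.sum_filter, Finset.sum_const,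
    nsmul_eq_mul, div_le_iff₀ hN', sub_mul, mul_comm G]
  have h2 : ((partners Θ h).filter fun b => b.1 ∈ s) =
      Finset.univ.filter fun b : HalfEdge d => b.1 ∈ s := by
    ext b
    simp only [Finset.mem_filter, mem_partners, Finset.mem_univ, true_and, and_iff_right_iff_imp]
    intro hb
    exact ⟨fun e => (hs _ hb).1 (by rw [e]), fun e => (hs _ hb).2 b e rfl⟩
  rw [h2, card_halfEdges_mem]
  have h3 : p * (partners Θ h).card ≤ ∑ z ∈ s, (pairedDegree d z : ℝ) := by
    refine le_trans ?_ hp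
    have := card_partners hh
    gcongr
    omega
  push_cast
  nlinarith

/-- State of an exploration: the pairs of `Θ` are known, all of them are at `x` or at forbidden
vertices. -/
structure State (hub : Fin n) (τ : Pairing d) (Θ : Finset (HalfEdge d)) (x : Fin n)
    (A : Finset (Fin n)) : Prop where
  closed : Closed τ Θ
  sub : ∀ h ∈ Θ, h.1 ∈ insert x A
  notMem : x ∉ A
  hub_mem : hub ∈ A

theorem State.move {hub : Fin n} {τ σ : Pairing d} {Θ : Finset (HalfEdge d)} {x : Fin n}
    {A : Finset (Fin n)} (hs : State hub τ Θ x A) {h b : HalfEdge d} (hx : h.1 = x)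
    (hb : b.1 ∉ insert x A) (hc : Closed σ (insert h (insert b Θ))) :
    State hub σ (insert h (insert b Θ)) b.1 (insert x A) where
  closed := hc
  sub := by
    intro k hk
    simp only [Finset.mem_insert] at hk
    rcases hk with rfl | rfl | hk
    · simp [hx]
    · simp
    · exact Finset.mem_insert_of_mem (hs.sub k hk)
  notMem := hb
  hub_mem := Finset.mem_insert_of_mem hs.hub_mem

/-- After an unsuccessful reveal the vertex of the partner becomes forbidden, so that all known
pairs stay at `x` or at forbidden vertices. Erasing `x` covers a self-loop at `x`. -/
theorem State.stay {hub : Fin n} {τ σ : Pairing d} {Θ : Finset (HalfEdge d)} {x : Fin n}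
    {A : Finset (Fin n)} (hs : State hub τ Θ x A) {h b : HalfEdge d} (hx : h.1 = x)
    (hc : Closed σ (insert h (insert b Θ))) :
    State hub σ (insert h (insert b Θ)) x ((insert b.1 A).erase x) where
  closed := hc
  sub := by
    intro k hk
    simp only [Finset.mem_insert] at hk
    simp only [Finset.mem_insert, Finset.mem_erase]
    rcases hk with rfl | rfl | hk
    · exact Or.inl hx
    · by_cases h : k.1 = x
      · exact Or.inl h
      · exact Or.inr ⟨h, Or.inl rfl⟩
    · rcases Finset.mem_insert.1 (hs.sub k hk) with h | h
      · exact Or.inl h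
      · exact Or.inr ⟨fun e => hs.notMem (e ▸ h), Or.inr h⟩
  notMem := by simp
  hub_mem := by
    have : hub ≠ x := fun e => hs.notMem (e ▸ hs.hub_mem)
    simp [this, hs.hub_mem]

/-- A self-loop uses up two half-edges of the same vertex; hence the factor two in the counts of
free half-edges. -/
theorem card_sdiff_insert_two (s Θ : Finset (HalfEdge d)) (a b : HalfEdge d) :
    (s \ Θ).card ≤ (s \ insert a (insert b Θ)).card + 2 := by
  have : s \ Θ ⊆ (s \ insert a (insert b Θ)) ∪ {a, b} := by
    intro k hk
    simp only [Finset.mem_union, Finset.mem_sdiff, Finset.mem_insert, Finset.mem_singleton] at hk ⊢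
    tauto
  exact (Finset.card_le_card this).trans ((Finset.card_union_le _ _).trans
    (Nat.add_le_add_left Finset.card_le_two _))

variable {ν : Measure ℝ} [IsProbabilityMeasure ν] {Q : Pairing d → Measure (Sym2 (Fin n) → ℝ)}

/-- Failure probability of one stage of the exploration: at most `j` half-edges of `x` are
revealed, and at most `r` vertices of the target set `T` are tried. -/
theorem condAvg_step_compl_le (hQ : ∀ σ, EdgeLaw (erasedGraph σ) ν (Q σ)) {hub : Fin n}
    {P : Pairing d → Fin n → Finset (Fin n) → Set (Sym2 (Fin n) → ℝ)}
    (hP : ∀ σ, AvoidingEvent hub (P σ)) {T : Finset (Fin n)} {c q p θ : ℝ} {R : ℕ}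
    (hq0 : 0 ≤ q) (hq : q ≤ ν.real (Set.Iic c)) (hp0 : 0 ≤ p) (hp1 : p ≤ 1) (hθ : 0 ≤ θ)
    (hp : ∀ A : Finset (Fin n), (A ∩ T).card ≤ R →
      p * Fintype.card (HalfEdge d) ≤ ∑ z ∈ T \ A, (pairedDegree d z : ℝ))
    (hnext : ∀ τ Θ z A, State hub τ Θ z A → z ∈ T → (halfEdgesAt d z ∩ Θ).card ≤ 1 →
      (insert z A ∩ T).card ≤ R → condAvg τ Θ (fun σ => (Q σ).real (P σ z A)ᶜ) ≤ θ) (j : ℕ) :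
    ∀ r τ Θ x A, State hub τ Θ x A → 2 * j ≤ (halfEdgesAt d x \ Θ).card →
      (insert x A ∩ T).card + r ≤ R →
      condAvg τ Θ (fun σ => (Q σ).real (Step (erasedGraph σ) c (P σ) x A)ᶜ) ≤
        (1 - p * q) ^ j + (1 - q) ^ r + θ := by
  have hν1 : ν.real (Set.Iic c) ≤ 1 := measureReal_le_one
  have hq1 : 0 ≤ 1 - q := by linarith
  have hpq1 : 0 ≤ 1 - p * q := by nlinarith
  have htriv : ∀ τ Θ x A,
      condAvg τ Θ (fun σ => (Q σ).real (Step (erasedGraph σ) c (P σ) x A)ᶜ) ≤ 1 := by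
    intro τ Θ x A
    refine condAvg_le_const fun σ _ => ?_
    have := (hQ σ).prob
    exact measureReal_le_one
  induction j with
  | zero =>
    intro r τ Θ x A _ _ _
    have := htriv τ Θ x A
    have := pow_nonneg hq1 r
    simp only [pow_zero]
    linarith
  | succ j ih =>
    intro r τ Θ x A hs hfree hR
    -- When no tries are left, the summand `(1 - q) ^ 0 = 1` makes the bound trivial.
    obtain _ | r := r
    · have := htriv τ Θ x A
      have := pow_nonneg hpq1 (j + 1)
      simp only [pow_zero]
      linarith
    obtain ⟨h, hh⟩ : (halfEdgesAt d x \ Θ).Nonempty := by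
      rw [← Finset.card_pos]; omega
    rw [Finset.mem_sdiff, mem_halfEdgesAt] at hh
    obtain ⟨hhx, hhΘ⟩ := hh
    -- `G` is the bound left after a reveal that misses `T`. A hit improves it by `Δ`, because the
    -- edge is then cheap with probability at least `q`. Averaging gives `G - p * Δ`, and this is
    -- exactly the bound with exponent `j + 1`.
    set G : ℝ := (1 - p * q) ^ j + (1 - q) ^ (r + 1) + θ with hG
    set Δ : ℝ := q * (1 - p * q) ^ j with hΔ
    have hreveal := condAvg_reveal hs.closed hhΘ
      (φ := fun σ => (Q σ).real (Step (erasedGraph σ) c (P σ) x A)ᶜ)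
      (g := fun b => if b.1 ∈ T \ insert x A then G - Δ else G) ?_
    · refine hreveal.trans ?_
      have hN : 0 < (partners Θ h).card := by
        refine Finset.card_pos.2 ⟨τ.1 h, mem_partners.2 ⟨τ.apply_ne h, ?_⟩⟩
        exact hs.closed.apply_notMem hhΘ
      have := sum_ite_partners_le (Θ := Θ) (h := h) (s := T \ insert x A) (p := p) (G := G) (Δ := Δ)
        (fun z hz => by
          rw [Finset.mem_sdiff] at hz
          refine ⟨fun e => hz.2 (by rw [e, hhx]; exact Finset.mem_insert_self _ _), fun b hb e => ?_⟩
          exact hz.2 (e ▸ hs.sub b hb)) hhΘ (by positivity) hp0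
        (hp _ (by omega)) hN
      refine this.trans (le_of_eq ?_)
      rw [hG, hΔ, pow_succ (1 - p * q) j]
      ring
    · intro b hb σ hσ hσb hcl
      have hfree' : 2 * j ≤ (halfEdgesAt d x \ insert h (insert b Θ)).card := by
        have := card_sdiff_insert_two (halfEdgesAt d x) Θ h b
        omega
      have hstay := hs.stay hhx hcl
      have herase : ∀ z, z ≠ x → (insert z A).erase x = insert z A := fun z hz =>
        Finset.erase_eq_of_notMem (by simp [hz.symm, hs.notMem])
      split_ifs with hbT
      · rw [Finset.mem_sdiff] at hbT
        have hbx : b.1 ≠ x := fun e => hbT.2 (e ▸ Finset.mem_insert_self _ _)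
        rw [herase _ hbx] at hstay
        have hins : insert x (insert b.1 A) ∩ T = insert b.1 (insert x A ∩ T) := by
          rw [Finset.insert_comm, Finset.insert_inter_of_mem hbT.1]
        have hcard : (insert x (insert b.1 A) ∩ T).card ≤ (insert x A ∩ T).card + 1 := by
          rw [hins]; exact Finset.card_insert_le _ _
        have h1 := ih r σ _ x (insert b.1 A) hstay hfree' (by omega)
        -- The new vertex has not been touched before, so `b` is its only revealed half-edge.
        have h2 := hnext σ _ b.1 (insert x A) (hs.move hhx hbT.2 hcl) hbT.1 (by
          refine Finset.card_le_one.2 fun k hk k' hk' => ?_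
          have key : ∀ k ∈ halfEdgesAt d b.1 ∩ insert h (insert b Θ), k = b := by
            intro k hk
            rw [Finset.mem_inter, mem_halfEdgesAt, Finset.mem_insert, Finset.mem_insert] at hk
            rcases hk with ⟨hk1, rfl | rfl | hk2⟩
            · exact absurd (hk1.symm.trans hhx) hbx
            · rfl
            · exact absurd (hk1 ▸ hs.sub k hk2) hbT.2
          rw [key k hk, key k' hk']) (by rw [Finset.insert_comm]; omega)
        set qq := ν.real (Set.Iic c)
        calc condAvg σ (insert h (insert b Θ))
              (fun σ => (Q σ).real (Step (erasedGraph σ) c (P σ) x A)ᶜ)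
            ≤ condAvg σ (insert h (insert b Θ)) (fun σ =>
                (1 - qq) * (Q σ).real (Step (erasedGraph σ) c (P σ) x (insert b.1 A))ᶜ +
                qq * (Q σ).real (P σ b.1 (insert x A))ᶜ) := by
              refine condAvg_mono fun σ' hσ' => ?_
              refine (hQ σ').step_compl_le (hP σ') hs.notMem hs.hub_mem hbT.2 ?_ c
              have : σ'.1 h = b := (mem_cyl.1 hσ' h (Finset.mem_insert_self _ _)).trans hσb
              have := erasedGraph_adj_of_apply this (by rw [hhx]; exact hbx.symm)
              rwa [hhx] at this
          _ = (1 - qq) * _ + qq * _ := by rw [condAvg_add, condAvg_mul, condAvg_mul]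
          _ ≤ (1 - qq) * ((1 - p * q) ^ j + (1 - q) ^ r + θ) + qq * θ := by
              gcongr
          _ = (1 - qq) * ((1 - p * q) ^ j + (1 - q) ^ r) + θ := by ring
          _ ≤ (1 - q) * ((1 - p * q) ^ j + (1 - q) ^ r) + θ := by gcongr
          _ = G - Δ := by rw [hG, hΔ, pow_succ (1 - q) r]; ring
      -- A miss adds to the forbidden set no vertex of `T` that was not yet counted, so the number
      -- of tries `r` is kept. Forbidding one more vertex only shrinks the event, which is harmless
      -- for an upper bound on failure.
      · have hins : insert x ((insert b.1 A).erase x) ∩ T = insert x A ∩ T := by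
          ext k
          simp only [Finset.mem_sdiff, not_and_not_right] at hbT
          simp only [Finset.mem_inter, Finset.mem_insert, Finset.mem_erase]
          constructor
          · rintro ⟨rfl | ⟨_, rfl | hk⟩, hkT⟩
            · exact ⟨Or.inl rfl, hkT⟩
            · exact ⟨Finset.mem_insert.1 (hbT hkT), hkT⟩
            · exact ⟨Or.inr hk, hkT⟩
          · rintro ⟨rfl | hk, hkT⟩
            · exact ⟨Or.inl rfl, hkT⟩
            · exact ⟨Or.inr ⟨fun e => hs.notMem (e ▸ hk), Or.inr hk⟩, hkT⟩
        refine le_trans (condAvg_mono fun σ' _ => ?_)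
          (ih (r + 1) σ _ x _ hstay hfree' (by rw [hins]; omega))
        have := (hQ σ').prob
        refine measureReal_mono (Set.compl_subset_compl.2 (((hP σ').step _ c).anti _ _ _ ?_))
        intro k hk
        exact Finset.mem_erase.2 ⟨fun e => hs.notMem (e ▸ hk), Finset.mem_insert_of_mem hk⟩

end Exploration

/-! ### Stages of the exploration -/

section Stages

/-- `m` exploration steps with costs `c i, c (i + 1), …`, ending in `S` at a vertex whose potential
edge to the hub costs at most `M`. -/
def stageEvent {V : Type*} [DecidableEq V] (G : SimpleGraph V) (hub : V) (S : Set V) (M : ℝ)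
    (c : ℕ → ℝ) : ℕ → ℕ → V → Finset V → Set (Sym2 V → ℝ)
  | 0, _ => fun x _ => {W | x ∈ S ∧ W s(x, hub) ≤ M}
  | m + 1, i => Step G (c i) (stageEvent G hub S M c m (i + 1))

/-- At most `t` steps of cost at most `M`, followed by the event `P`. -/
def preStage {V : Type*} [DecidableEq V] (G : SimpleGraph V) (M : ℝ)
    (P : V → Finset V → Set (Sym2 V → ℝ)) : ℕ → V → Finset V → Set (Sym2 V → ℝ)
  | 0 => P
  | t + 1 => fun x A => P x A ∪ Step G M (preStage G M P t) x A

section WalkWeight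

variable {V : Type*}

theorem walkWeight_cons {G : SimpleGraph V} (W : Sym2 V → ℝ) {x y z : V} (h : G.Adj x y)
    (p : G.Walk y z) : walkWeight W (SimpleGraph.Walk.cons h p) = W s(x, y) + walkWeight W p := by
  simp [walkWeight]

theorem walkWeight_append {G : SimpleGraph V} (W : Sym2 V → ℝ) {x y z : V} (p : G.Walk x y)
    (q : G.Walk y z) : walkWeight W (p.append q) = walkWeight W p + walkWeight W q := by
  simp [walkWeight]

theorem walkWeight_reverse {G : SimpleGraph V} (W : Sym2 V → ℝ) {x y : V} (p : G.Walk x y) :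
    walkWeight W p.reverse = walkWeight W p := by
  simp [walkWeight]

end WalkWeight

/-! ### Avoidance properties of the stages, and walks extracted from them -/

section Deterministic

variable {V : Type*} [DecidableEq V]

theorem stageEvent_avoiding [Countable V] (G : SimpleGraph V) (hub : V) (S : Set V) (M : ℝ)
    (c : ℕ → ℝ) (m : ℕ) : ∀ i, AvoidingEvent hub (stageEvent G hub S M c m i) := by
  induction m with
  | zero =>
    intro i
    refine ⟨fun x A A' _ => subset_rfl, fun x A => ?_, ?_⟩
    · exact (MeasurableSet.const (x ∈ S)).inter
        (measurableSet_le (measurable_pi_apply _) measurable_const)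
    · intro x A a b hx ha hah W W' hWW
      simp only [stageEvent, Set.mem_ofPred_eq]
      rw [hWW]
      intro h
      rcases Sym2.eq_iff.1 h with h | h
      · exact hx (h.1 ▸ ha)
      · exact hah h.2.symm
  | succ m ih => exact fun i => (ih (i + 1)).step G (c i)

theorem preStage_avoiding [Countable V] (G : SimpleGraph V) (hub : V) (M : ℝ)
    {P : V → Finset V → Set (Sym2 V → ℝ)} (hP : AvoidingEvent hub P) (t : ℕ) :
    AvoidingEvent hub (preStage G M P t) := by
  induction t with
  | zero => exact hP
  | succ t ih =>
    have hS := ih.step G M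
    refine ⟨fun x A A' h => ?_, fun x A => ?_, ?_⟩
    · exact Set.union_subset_union (hP.anti x A A' h) (hS.anti x A A' h)
    · exact (hP.meas x A).union (hS.meas x A)
    · intro x A a b hx ha hah W W' hWW
      exact or_congr (hP.avoid x A a b hx ha hah W W' hWW) (hS.avoid x A a b hx ha hah W W' hWW)

theorem subset_preStage (G : SimpleGraph V) (M : ℝ) (P : V → Finset V → Set (Sym2 V → ℝ)) (t : ℕ)
    (x : V) (A : Finset V) : P x A ⊆ preStage G M P t x A := by
  cases t with
  | zero => exact subset_rfl
  | succ t => exact Set.subset_union_left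

/-- Removing cycles leaves a sublist of the edges, and the deleted weights are nonnegative. -/
theorem walkWeight_bypass_le {G : SimpleGraph V} {W : Sym2 V → ℝ} (hW : ∀ p, 0 ≤ W p) {x y : V}
    (p : G.Walk x y) : walkWeight W p.bypass ≤ walkWeight W p := by
  have hsub : p.bypass.edges.Sublist p.edges := by
    induction p with
    | nil => simp [SimpleGraph.Walk.bypass]
    | cons h p ih =>
      simp only [SimpleGraph.Walk.bypass]
      split_ifs with hs
      · refine List.Sublist.trans ?_ (List.Sublist.cons _ ih)
        have := congrArg SimpleGraph.Walk.edges (SimpleGraph.Walk.take_spec p.bypass hs)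
        rw [SimpleGraph.Walk.edges_append] at this
        rw [← this]
        exact List.sublist_append_right _ _
      · simpa using ih
  exact (hsub.map W).sum_le_sum fun a ha => by
    obtain ⟨e, -, rfl⟩ := List.mem_map.1 ha
    exact hW e

theorem exists_walk_of_stageEvent {G : SimpleGraph V} {hub : V} {S : Set V} {M : ℝ} {c : ℕ → ℝ}
    (hS : ∀ a ∈ S, a ≠ hub → G.Adj a hub) {W : Sym2 V → ℝ} (m : ℕ) :
    ∀ i x A, x ≠ hub → hub ∈ A → W ∈ stageEvent G hub S M c m i x A →
      ∃ p : G.Walk x hub, p.length = m + 1 ∧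
        walkWeight W p ≤ ∑ k ∈ Finset.Ico i (i + m), c k + M := by
  induction m with
  | zero =>
    rintro i x A hx hA ⟨hxS, hw⟩
    refine ⟨SimpleGraph.Walk.cons (hS x hxS hx) SimpleGraph.Walk.nil, by simp, ?_⟩
    simpa [walkWeight] using hw
  | succ m ih =>
    rintro i x A hx hA ⟨z, hz, hadj, hw, hW⟩
    have hzh : z ≠ hub := fun h => hz (Finset.mem_insert_of_mem (h ▸ hA))
    obtain ⟨p, hp1, hp2⟩ := ih (i + 1) z _ hzh (Finset.mem_insert_of_mem hA) hW
    refine ⟨SimpleGraph.Walk.cons hadj p, by simp [hp1], ?_⟩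
    rw [walkWeight_cons, Finset.sum_eq_sum_Ico_succ_bot (by omega),
      show i + (m + 1) = i + 1 + m by ring]
    linarith

theorem exists_walk_of_preStage {G : SimpleGraph V} {hub : V} {M : ℝ} (hM : 0 ≤ M)
    {P : V → Finset V → Set (Sym2 V → ℝ)} {W : Sym2 V → ℝ} {N : ℕ} {B : ℝ}
    (hP : ∀ x A, x ≠ hub → hub ∈ A → W ∈ P x A →
      ∃ p : G.Walk x hub, p.length ≤ N ∧ walkWeight W p ≤ B) (t : ℕ) :
    ∀ x A, x ≠ hub → hub ∈ A → W ∈ preStage G M P t x A →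
      ∃ p : G.Walk x hub, p.length ≤ t + N ∧ walkWeight W p ≤ t * M + B := by
  induction t with
  | zero =>
    intro x A hx hA hW
    simpa using hP x A hx hA hW
  | succ t ih =>
    rintro x A hx hA (hW | ⟨z, hz, hadj, hw, hW⟩)
    · obtain ⟨p, hp1, hp2⟩ := hP x A hx hA hW
      refine ⟨p, by omega, hp2.trans ?_⟩
      have : (0 : ℝ) ≤ ((t + 1 : ℕ) : ℝ) * M := by positivity
      linarith
    · have hzh : z ≠ hub := fun h => hz (Finset.mem_insert_of_mem (h ▸ hA))
      obtain ⟨p, hp1, hp2⟩ := ih z _ hzh (Finset.mem_insert_of_mem hA) hW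
      refine ⟨SimpleGraph.Walk.cons hadj p, by rw [SimpleGraph.Walk.length_cons]; omega, ?_⟩
      rw [walkWeight_cons]
      push_cast
      linarith

end Deterministic

variable {n : ℕ} {d : Fin n → ℕ} {ν : Measure ℝ} {Q : Pairing d → Measure (Sym2 (Fin n) → ℝ)}

theorem card_sdiff_ge_of_inter_le {x : Fin n} {Θ : Finset (HalfEdge d)} {k j : ℕ}
    (h1 : (halfEdgesAt d x ∩ Θ).card ≤ k) (h2 : j + k ≤ pairedDegree d x) :
    j ≤ (halfEdgesAt d x \ Θ).card := by
  have h3 := Finset.card_inter_add_card_sdiff (halfEdgesAt d x) Θ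
  rw [card_halfEdgesAt] at h3
  omega

/-- Failure probability of a chain of stages with growing degree thresholds `Y`. -/
theorem condAvg_stageEvent_compl_le [IsProbabilityMeasure ν] (hQ : ∀ σ, EdgeLaw (erasedGraph σ) ν (Q σ)) {hub : Fin n}
    {M : ℝ} (hM : 0 ≤ M) {N : ℕ} {Y c q p : ℕ → ℝ} {j r : ℕ → ℕ} {R : ℕ}
    (hY : ∀ i < N, Y i ≤ Y (i + 1))
    (hj : ∀ i < N, (2 * j i + 1 : ℝ) ≤ Y i)
    (hq0 : ∀ i < N, 0 ≤ q i) (hq : ∀ i < N, q i ≤ ν.real (Set.Iic (c i)))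
    (hp0 : ∀ i < N, 0 ≤ p i) (hp1 : ∀ i < N, p i ≤ 1)
    (hp : ∀ i < N, ∀ A : Finset (Fin n),
      (A ∩ Finset.univ.filter fun z => Y (i + 1) ≤ pairedDegree d z).card ≤ R →
      p i * Fintype.card (HalfEdge d) ≤
        ∑ z ∈ (Finset.univ.filter fun z => Y (i + 1) ≤ pairedDegree d z) \ A,
          (pairedDegree d z : ℝ))
    (hR : 2 + ∑ k ∈ Finset.range N, r k ≤ R) (m : ℕ) :
    ∀ i, i + m = N → ∀ τ Θ x A, State hub τ Θ x A → Y i ≤ pairedDegree d x →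
      (halfEdgesAt d x ∩ Θ).card ≤ 1 →
      (insert x A ∩ Finset.univ.filter fun z => Y i ≤ pairedDegree d z).card ≤
        2 + ∑ k ∈ Finset.range i, r k →
      condAvg τ Θ (fun σ => (Q σ).real
        (stageEvent (erasedGraph σ) hub {z | Y N ≤ pairedDegree d z} M c m i x A)ᶜ) ≤
        ∑ k ∈ Finset.Ico i N, ((1 - p k * q k) ^ j k + (1 - q k) ^ r k) +
          ν.real (Set.Ioi M) := by
  induction m with
  | zero =>
    intro i hi τ Θ x A hs hx _ _
    obtain rfl : i = N := by omega
    simp only [Finset.Ico_self, Finset.sum_empty, zero_add]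
    -- The last event concerns only the weight towards the hub, not adjacency to it; the tail bound
    -- holds for every pair of vertices, and adjacency is dealt with separately in
    -- `law_no_cheap_path_le`.
    refine condAvg_le_const fun σ _ => ?_
    have := (hQ σ).prob
    refine (measureReal_mono fun W hW => ?_).trans ((hQ σ).tail s(x, hub) M hM)
    simp only [stageEvent, Set.mem_compl_iff, Set.mem_ofPred_eq, not_and, not_le] at hW ⊢
    exact hW hx
  | succ m ih =>
    intro i hi τ Θ x A hs hx hfree hcard
    have hiN : i < N := by omega
    set T : Finset (Fin n) := Finset.univ.filter fun z => Y (i + 1) ≤ pairedDegree d z with hT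
    rw [Finset.sum_eq_sum_Ico_succ_bot hiN, add_assoc]
    have hsumle : ∑ k ∈ Finset.range (i + 1), r k ≤ ∑ k ∈ Finset.range N, r k :=
      Finset.sum_le_sum_of_subset (Finset.range_subset_range.2 hiN)
    have hθ : 0 ≤ ∑ k ∈ Finset.Ico (i + 1) N, ((1 - p k * q k) ^ j k + (1 - q k) ^ r k) +
        ν.real (Set.Ioi M) := by
      refine add_nonneg (Finset.sum_nonneg fun k hk => ?_) measureReal_nonneg
      rw [Finset.mem_Ico] at hk
      have h1 : q k ≤ 1 := (hq k hk.2).trans measureReal_le_one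
      have h2 := hp1 k hk.2
      have h3 := hp0 k hk.2
      have h4 := hq0 k hk.2
      have h5 : 0 ≤ 1 - p k * q k := by nlinarith
      have h6 : 0 ≤ 1 - q k := by linarith
      positivity
    have hsubT : T ⊆ Finset.univ.filter fun z => Y i ≤ pairedDegree d z := by
      intro z hz
      simp only [hT, Finset.mem_filter, Finset.mem_univ, true_and] at hz ⊢
      exact (hY i hiN).trans hz
    -- The budget counts the starting vertex and the hub, together with the vertices tried in the
    -- stages up to the present one. Only tries inside the target sets are counted, and the target
    -- sets decrease, so earlier counts remain valid.
    refine condAvg_step_compl_le hQ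
      (fun σ => stageEvent_avoiding (erasedGraph σ) hub _ M c m (i + 1))
      (T := T) (R := 2 + ∑ k ∈ Finset.range (i + 1), r k) (hq0 i hiN) (hq i hiN) (hp0 i hiN)
      (hp1 i hiN) hθ (fun A hA => hp i hiN A (hA.trans (by omega))) ?_ (j i) (r i) τ Θ x A hs
      ?_ ?_
    · intro τ' Θ' z A' hs' hz hfree' hcard'
      refine ih (i + 1) (by omega) τ' Θ' z A' hs' ?_ hfree' hcard'
      simpa [hT] using hz
    · refine card_sdiff_ge_of_inter_le hfree ?_
      have := (hj i hiN).trans hx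
      exact_mod_cast this
    · rw [Finset.sum_range_succ, ← add_assoc]
      refine Nat.add_le_add_right (le_trans (Finset.card_le_card ?_) hcard) _
      exact Finset.inter_subset_inter_left hsubT

/-- Failure probability of the search for a vertex of degree at least `y`. -/
theorem condAvg_preStage_compl_le (hQ : ∀ σ, EdgeLaw (erasedGraph σ) ν (Q σ)) {hub : Fin n}
    (hdeg : ∀ x, 2 ≤ pairedDegree d x) {M : ℝ} (hM : 0 ≤ M)
    {P : Pairing d → Fin n → Finset (Fin n) → Set (Sym2 (Fin n) → ℝ)} {y θ p κ : ℝ} {t₀ : ℕ}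
    (hp0 : 0 ≤ p) (hp1 : p ≤ 1) (hκ : 0 ≤ κ) (hθ : 0 ≤ θ) (hy : 0 ≤ y)
    (hP : ∀ τ Θ x A, State hub τ Θ x A → y ≤ pairedDegree d x →
      (halfEdgesAt d x ∩ Θ).card ≤ 1 →
      (insert x A ∩ Finset.univ.filter fun z => y ≤ pairedDegree d z).card ≤ 2 →
      condAvg τ Θ (fun σ => (Q σ).real (P σ x A)ᶜ) ≤ θ)
    (hp : p * Fintype.card (HalfEdge d) ≤
      ∑ z ∈ (Finset.univ.filter fun z => y ≤ pairedDegree d z).erase hub, (pairedDegree d z : ℝ))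
    (hκ' : pairedDegree d hub + (t₀ + 1) * y ≤
      κ * (Fintype.card (HalfEdge d) - 1 - (pairedDegree d hub + (t₀ + 1) * y))) (t : ℕ) :
    ∀ τ Θ x A, State hub τ Θ x A → (halfEdgesAt d x ∩ Θ).card ≤ 1 →
      (∀ z ∈ A.erase hub, (pairedDegree d z : ℝ) < y) → (A.erase hub).card + t ≤ t₀ →
      condAvg τ Θ (fun σ => (Q σ).real (preStage (erasedGraph σ) M (P σ) t x A)ᶜ) ≤
        (1 - p) ^ t + t * (ν.real (Set.Ioi M) + κ) + θ := by
  have hν0 : 0 ≤ ν.real (Set.Ioi M) := measureReal_nonneg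
  have h1p : 0 ≤ 1 - p := by linarith
  have hhigh : ∀ t τ Θ x A, State hub τ Θ x A → (halfEdgesAt d x ∩ Θ).card ≤ 1 →
      (∀ z ∈ A.erase hub, (pairedDegree d z : ℝ) < y) → y ≤ pairedDegree d x →
      condAvg τ Θ (fun σ => (Q σ).real (preStage (erasedGraph σ) M (P σ) t x A)ᶜ) ≤ θ := by
    intro t τ Θ x A hs hfree hA hx
    refine le_trans (condAvg_mono fun σ _ => ?_) (hP τ Θ x A hs hx hfree ?_)
    · have := (hQ σ).prob
      exact measureReal_mono (Set.compl_subset_compl.2 (subset_preStage _ _ _ _ _ _))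
    · refine (Finset.card_le_card (t := {x, hub}) fun z hz => ?_).trans Finset.card_le_two
      simp only [Finset.mem_inter, Finset.mem_insert, Finset.mem_filter, Finset.mem_univ,
        true_and, Finset.mem_singleton] at hz ⊢
      rcases hz with ⟨rfl | hzA, hzy⟩
      · exact Or.inl rfl
      · by_contra hcon
        push Not at hcon
        exact (hA z (Finset.mem_erase.2 ⟨hcon.2, hzA⟩)).not_ge hzy
  induction t with
  | zero =>
    intro τ Θ x A hs _ _ _
    refine le_trans (condAvg_le_const (c := 1) fun σ _ => ?_) (by simp [hθ])
    have := (hQ σ).prob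
    exact measureReal_le_one
  | succ t ih =>
    intro τ Θ x A hs hfree hA hcard
    rcases le_or_gt y (pairedDegree d x) with hx | hx
    · refine (hhigh (t + 1) τ Θ x A hs hfree hA hx).trans ?_
      have : 0 ≤ (1 - p) ^ (t + 1) := pow_nonneg h1p _
      have : 0 ≤ ((t + 1 : ℕ) : ℝ) * (ν.real (Set.Ioi M) + κ) := by positivity
      linarith
    have hxh : x ≠ hub := fun e => hs.notMem (e ▸ hs.hub_mem)
    -- Minimal degree two enters here: at most one half-edge was used to arrive at `x`, so another
    -- one is free.
    obtain ⟨h, hh⟩ : (halfEdgesAt d x \ Θ).Nonempty := by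
      rw [← Finset.card_pos]
      exact card_sdiff_ge_of_inter_le (j := 1) hfree (hdeg x)
    rw [Finset.mem_sdiff, mem_halfEdgesAt] at hh
    obtain ⟨hhx, hhΘ⟩ := hh
    -- One reveal either falls back on a used vertex (probability at most `κ`), or pays the tail of
    -- one edge weight and reaches a fresh vertex. `G` is the bound for a fresh vertex outside `V₀`;
    -- one inside `V₀` saves `(1 - p) ^ t`. The average `κ + G - p * (1 - p) ^ t` is the bound for
    -- `t + 1`.
    set V₀ : Finset (Fin n) := Finset.univ.filter fun z => y ≤ pairedDegree d z with hV₀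
    set G : ℝ := (1 - p) ^ t + (t * (ν.real (Set.Ioi M) + κ) + ν.real (Set.Ioi M)) + θ with hG
    have hA' : ∀ z ∈ (insert x A).erase hub, (pairedDegree d z : ℝ) < y := by
      intro z hz
      rw [Finset.mem_erase, Finset.mem_insert] at hz
      rcases hz with ⟨hzh, rfl | hzA⟩
      · exact hx
      · exact hA z (Finset.mem_erase.2 ⟨hzh, hzA⟩)
    have hcardA' : ((insert x A).erase hub).card ≤ (A.erase hub).card + 1 := by
      rw [Finset.erase_insert_of_ne hxh]; exact Finset.card_insert_le _ _
    have hV₀A : V₀ \ insert x A = V₀.erase hub := by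
      ext z
      simp only [Finset.mem_sdiff, Finset.mem_erase, hV₀, Finset.mem_filter, Finset.mem_univ,
        true_and]
      constructor
      · rintro ⟨h1, h2⟩
        exact ⟨fun e => h2 (Finset.mem_insert_of_mem (e ▸ hs.hub_mem)), h1⟩
      · rintro ⟨h1, h2⟩
        exact ⟨h2, fun h3 => (hA' z (Finset.mem_erase.2 ⟨h1, h3⟩)).not_ge h2⟩
    have hsumA : (∑ z ∈ insert x A, (pairedDegree d z : ℝ)) ≤
        pairedDegree d hub + (t₀ + 1) * y := by
      rw [← Finset.add_sum_erase _ _ (Finset.mem_insert_of_mem hs.hub_mem)]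
      gcongr
      calc _ ≤ ((insert x A).erase hub).card • y :=
            Finset.sum_le_card_nsmul _ _ _ fun z hz => (hA' z hz).le
        _ ≤ _ := by
          rw [nsmul_eq_mul]
          gcongr
          have : ((insert x A).erase hub).card ≤ t₀ + 1 := by omega
          exact_mod_cast this
    have hN : 0 < (partners Θ h).card :=
      Finset.card_pos.2 ⟨τ.1 h, mem_partners.2 ⟨τ.apply_ne h, hs.closed.apply_notMem hhΘ⟩⟩
    have hreveal := condAvg_reveal hs.closed hhΘ
      (φ := fun σ => (Q σ).real (preStage (erasedGraph σ) M (P σ) (t + 1) x A)ᶜ)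
      (g := fun b => (if b.1 ∈ insert x A then 1 else 0) +
        if b.1 ∈ V₀ \ insert x A then G - (1 - p) ^ t else G) ?_
    · refine hreveal.trans ?_
      rw [Finset.sum_add_distrib, add_div]
      have h1 := sum_ite_partners_le (Θ := Θ) (h := h) (s := V₀ \ insert x A) (p := p) (G := G)
        (Δ := (1 - p) ^ t)
        (fun z hz => by
          rw [Finset.mem_sdiff] at hz
          refine ⟨fun e => hz.2 (by rw [e, hhx]; exact Finset.mem_insert_self _ _), fun b hb e => ?_⟩
          exact hz.2 (e ▸ hs.sub b hb)) hhΘ (pow_nonneg h1p _) hp0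
        (by rw [hV₀A]; exact hp) hN
      have h2 : (∑ b ∈ partners Θ h, if b.1 ∈ insert x A then (1 : ℝ) else 0) /
          (partners Θ h).card ≤ κ := by
        have hN' : (0 : ℝ) < (partners Θ h).card := by exact_mod_cast hN
        rw [div_le_iff₀ hN', ← Finset.sum_filter, Finset.sum_const, nsmul_eq_mul, mul_one]
        have e1 : (((partners Θ h).filter fun b => b.1 ∈ insert x A).card : ℝ) ≤
            ∑ z ∈ insert x A, (pairedDegree d z : ℝ) := by
          rw [← Nat.cast_sum, ← card_halfEdges_mem]
          exact_mod_cast Finset.card_le_card (Finset.filter_subset_filter _ (Finset.subset_univ _))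
        have e2 : (Θ.card : ℝ) ≤ ∑ z ∈ insert x A, (pairedDegree d z : ℝ) := by
          rw [← Nat.cast_sum, ← card_halfEdges_mem]
          -- All revealed half-edges sit at used vertices, so the same degree sum also controls how
          -- much the set of possible partners has shrunk.
          exact_mod_cast Finset.card_le_card fun k hk => by
            simpa using hs.sub k hk
        have e3 : ((partners Θ h).card : ℝ) + Θ.card + 1 = Fintype.card (HalfEdge d) := by
          exact_mod_cast card_partners hhΘ
        calc _ ≤ _ := e1.trans (hsumA.trans hκ')
          _ ≤ _ := by gcongr; linarith
      refine (add_le_add h2 h1).trans (le_of_eq ?_)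
      rw [hG, pow_succ]
      push_cast
      ring
    · intro b hb σ hσ hσb hcl
      by_cases hbA : b.1 ∈ insert x A
      · simp only [hbA, if_true, Finset.mem_sdiff, not_true_eq_false, and_false, if_false]
        refine (condAvg_le_const (c := 1) fun σ' _ => ?_).trans ?_
        · have := (hQ σ').prob
          exact measureReal_le_one
        · have : 0 ≤ (1 - p) ^ t := pow_nonneg h1p _
          have : 0 ≤ (t : ℝ) * (ν.real (Set.Ioi M) + κ) := by positivity
          rw [hG]; linarith
      have hs' := hs.move hhx hbA hcl
      have hbx : b.1 ≠ x := fun e => hbA (e ▸ Finset.mem_insert_self _ _)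
      have hfree' : (halfEdgesAt d b.1 ∩ insert h (insert b Θ)).card ≤ 1 := by
        refine Finset.card_le_one.2 fun k hk k' hk' => ?_
        have key : ∀ k ∈ halfEdgesAt d b.1 ∩ insert h (insert b Θ), k = b := by
          intro k hk
          rw [Finset.mem_inter, mem_halfEdgesAt, Finset.mem_insert, Finset.mem_insert] at hk
          rcases hk with ⟨hk1, rfl | rfl | hk2⟩
          · exact absurd (hk1.symm.trans hhx) hbx
          · rfl
          · exact absurd (hk1 ▸ hs.sub k hk2) hbA
        rw [key k hk, key k' hk']
      have hstep : condAvg σ (insert h (insert b Θ))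
          (fun σ => (Q σ).real (preStage (erasedGraph σ) M (P σ) (t + 1) x A)ᶜ) ≤
          ν.real (Set.Ioi M) + condAvg σ (insert h (insert b Θ))
            (fun σ => (Q σ).real (preStage (erasedGraph σ) M (P σ) t b.1 (insert x A))ᶜ) := by
        rw [← condAvg_const σ (insert h (insert b Θ)) (ν.real (Set.Ioi M)), ← condAvg_add]
        refine condAvg_mono fun σ' hσ' => ?_
        have := (hQ σ').prob
        have hadj : (erasedGraph σ').Adj x b.1 := by
          have h1 : σ'.1 h = b := (mem_cyl.1 hσ' h (Finset.mem_insert_self _ _)).trans hσb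
          have h2 := erasedGraph_adj_of_apply h1 (by rw [hhx]; exact hbx.symm)
          rwa [hhx] at h2
        refine (measureReal_mono (s₂ := {W | M < W s(x, b.1)} ∪
          (preStage (erasedGraph σ') M (P σ') t b.1 (insert x A))ᶜ) fun W hW => ?_).trans
          ((measureReal_union_le _ _).trans (add_le_add_left ((hQ σ').tail _ M hM) _))
        by_contra hcon
        simp only [Set.mem_union, Set.mem_ofPred_eq, Set.mem_compl_iff, not_or, not_lt,
          not_not] at hcon
        exact hW (Or.inr ⟨b.1, hbA, hadj, hcon.1, hcon.2⟩)
      refine hstep.trans ?_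
      simp only [hbA, if_false, zero_add]
      split_ifs with hbV
      · rw [Finset.mem_sdiff] at hbV
        have := hhigh t σ _ b.1 (insert x A) hs' hfree' hA' (by simpa [hV₀] using hbV.1)
        have : 0 ≤ (t : ℝ) * (ν.real (Set.Ioi M) + κ) := by positivity
        rw [hG]; linarith
      · have := ih σ _ b.1 (insert x A) hs' hfree' hA' (by omega)
        rw [hG]; linarith

/-- Two vertices with many half-edges are joined by an edge with high probability. -/
theorem condAvg_not_adj_le {a b : Fin n} (hab : a ≠ b) (j : ℕ) :
    ∀ (τ : Pairing d) Θ, Closed τ Θ → (∀ h ∈ Θ, h.1 ≠ b) → 2 * j ≤ (halfEdgesAt d a \ Θ).card →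
      condAvg τ Θ (fun σ => by classical exact if (erasedGraph σ).Adj a b then 0 else 1) ≤
        (1 - (pairedDegree d b : ℝ) / Fintype.card (HalfEdge d)) ^ j := by
  classical
  have hp1 : (pairedDegree d b : ℝ) / Fintype.card (HalfEdge d) ≤ 1 := by
    refine div_le_one_of_le₀ ?_ (Nat.cast_nonneg _)
    rw [card_halfEdge]
    exact_mod_cast Finset.single_le_sum (f := fun x => pairedDegree d x) (by simp)
      (Finset.mem_univ b)
  set p := (pairedDegree d b : ℝ) / Fintype.card (HalfEdge d) with hp
  have hp0 : 0 ≤ p := by positivity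
  have h1p : 0 ≤ 1 - p := by linarith
  induction j with
  | zero =>
    intro τ Θ _ _ _
    refine condAvg_le_const fun σ _ => ?_
    split_ifs <;> simp
  | succ j ih =>
    intro τ Θ hc hb hfree
    obtain ⟨h, hh⟩ : (halfEdgesAt d a \ Θ).Nonempty := by
      rw [← Finset.card_pos]; omega
    rw [Finset.mem_sdiff, mem_halfEdgesAt] at hh
    obtain ⟨rfl, hhΘ⟩ := hh
    have hN : 0 < (partners Θ h).card :=
      Finset.card_pos.2 ⟨τ.1 h, mem_partners.2 ⟨τ.apply_ne h, hc.apply_notMem hhΘ⟩⟩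
    -- Hitting `b` makes the failure probability zero; it is written as `G - Δ` with `Δ = G` to fit
    -- `sum_ite_partners_le`.
    refine (condAvg_reveal hc hhΘ (g := fun k => if k.1 ∈ ({b} : Finset (Fin n)) then
      (1 - p) ^ j - (1 - p) ^ j else (1 - p) ^ j) ?_).trans ?_
    · intro k hk σ hσ hσk hcl
      split_ifs with hkb
      · rw [Finset.mem_singleton] at hkb
        rw [sub_self]
        refine condAvg_le_const fun σ' hσ' => ?_
        have h1 : σ'.1 h = k := (mem_cyl.1 hσ' h (Finset.mem_insert_self _ _)).trans hσk
        have h2 := erasedGraph_adj_of_apply h1 (by rw [hkb]; exact hab)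
        rw [hkb] at h2
        rw [if_pos h2]
      · refine ih σ _ hcl ?_ ?_
        · intro l hl
          simp only [Finset.mem_insert] at hl
          rcases hl with rfl | rfl | hl
          · exact hab
          · simpa using hkb
          · exact hb l hl
        · have := card_sdiff_insert_two (halfEdgesAt d h.1) Θ h k
          omega
    · have hH : (0 : ℝ) < Fintype.card (HalfEdge d) := by
        exact_mod_cast Fintype.card_pos_iff.2 ⟨h⟩
      refine (sum_ite_partners_le (p := p) ?_ hhΘ (pow_nonneg h1p _) hp0 ?_ hN).trans
        (le_of_eq ?_)
      · intro z hz
        rw [Finset.mem_singleton] at hz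
        subst hz
        exact ⟨hab.symm, hb⟩
      · rw [Finset.sum_singleton, hp, div_mul_cancel₀ _ hH.ne']
      · rw [pow_succ]; ring

end Stages

/-! ### The law of the weighted erased configuration model -/

section Law

/-- An event that ignores coordinate `i` is a function of the other coordinates, and these are
jointly independent of coordinate `i`. -/
theorem pi_inter_coordinate {ι : Type*} [Fintype ι] [DecidableEq ι] {ν : Measure ℝ}
    [IsProbabilityMeasure ν] {E : Set (ι → ℝ)} (hE : MeasurableSet E) (i : ι)
    (hinv : ∀ w w' : ι → ℝ, (∀ k, k ≠ i → w k = w' k) → (w ∈ E ↔ w' ∈ E)) {B : Set ℝ}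
    (hB : MeasurableSet B) :
    (Measure.pi fun _ : ι => ν) (E ∩ {w | w i ∈ B}) = (Measure.pi fun _ : ι => ν) E * ν B := by
  have h1 : iIndepFun (fun (k : ι) (w : ι → ℝ) => w k) (Measure.pi fun _ : ι => ν) :=
    iIndepFun_pi (X := fun _ x => x) fun _ => aemeasurable_id
  have h2 := h1.indepFun_finset (Finset.univ.erase i) {i} (by simp) fun k => measurable_pi_apply k
  -- The missing coordinate is filled with `0`; the value is immaterial, since `E` does not depend
  -- on it.
  let ext : ((k : ↥(Finset.univ.erase i)) → ℝ) → ι → ℝ := fun g k =>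
    if hk : k = i then 0 else g ⟨k, by simp [hk]⟩
  have hext : Measurable ext := by
    refine measurable_pi_lambda _ fun k => ?_
    by_cases hk : k = i
    · simp only [ext, hk, dite_true]; exact measurable_const
    · simp only [ext, hk, dite_false]; exact measurable_pi_apply _
  have h3 := h2.measure_inter_preimage_eq_mul (ext ⁻¹' E) {g | g ⟨i, by simp⟩ ∈ B} (hext hE)
    (by exact (measurable_pi_apply (⟨i, by simp⟩ : ({i} : Finset ι))) hB)
  have h4 : (fun (w : ι → ℝ) (k : ↥(Finset.univ.erase i)) => w k) ⁻¹' (ext ⁻¹' E) = E := by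
    ext w
    simp only [Set.mem_preimage]
    refine hinv _ _ fun k hk => ?_
    simp [ext, hk]
  have h5 : (Measure.pi fun _ : ι => ν) {w | w i ∈ B} = ν B :=
    (measurePreserving_eval (fun _ : ι => ν) i).measure_preimage hB.nullMeasurableSet
  rw [h4] at h3
  exact h3.trans (by rw [← h5]; rfl)

variable {n : ℕ} {d : Fin n → ℕ}

open Classical in
/-- The weight of an edge of the erased graph. -/
def edgeWeight (σ : Pairing d) (s : Selection d) (w : PotentialEdge d → ℝ) (p : Sym2 (Fin n)) :
    ℝ :=
  if h : (cmEdgesBetween σ p).Nonempty then w (s ⟨cmEdgesBetween σ p, h⟩).1 else 0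

theorem ends_selection (σ : Pairing d) (s : Selection d) {p : Sym2 (Fin n)}
    (h : (cmEdgesBetween σ p).Nonempty) : ends (s ⟨cmEdgesBetween σ p, h⟩).1 = p := by
  have := (s ⟨cmEdgesBetween σ p, h⟩).2
  simp only [cmEdgesBetween, Finset.mem_filter] at this
  exact this.2

theorem measurable_edgeWeight (σ : Pairing d) (s : Selection d) :
    Measurable (edgeWeight σ s) := by
  refine measurable_pi_lambda _ fun p => ?_
  unfold edgeWeight
  by_cases h : (cmEdgesBetween σ p).Nonempty
  · simp only [h, dite_true]; exact measurable_pi_apply _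
  · simp only [h, dite_false]; exact measurable_const

theorem mem_edgeSet_erasedGraph {σ : Pairing d} {p : Sym2 (Fin n)}
    (hp : p ∈ (erasedGraph σ).edgeSet) : (cmEdgesBetween σ p).Nonempty := by
  induction p using Sym2.ind with
  | _ x y => exact hp.2

/-- The joint law of the weights of the erased graph, given the pairing and the selection. -/
def weightLaw (ν : Measure ℝ) (s : Selection d) (σ : Pairing d) : Measure (Sym2 (Fin n) → ℝ) :=
  (Measure.pi fun _ : PotentialEdge d => ν).map (edgeWeight σ s)

theorem weightLaw_real_apply (ν : Measure ℝ) (s : Selection d) (σ : Pairing d)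
    {E : Set (Sym2 (Fin n) → ℝ)} (hE : MeasurableSet E) :
    (weightLaw ν s σ).real E =
      (Measure.pi fun _ : PotentialEdge d => ν).real (edgeWeight σ s ⁻¹' E) :=
  map_measureReal_apply (measurable_edgeWeight σ s) hE

/-- The potential edge selected for a pair of vertices has that pair as its ends, so distinct pairs
read distinct coordinates. This makes the weights on the erased graph independent whichever parallel
edge is kept. -/
theorem weightLaw_edgeLaw (ν : Measure ℝ) [IsProbabilityMeasure ν] (s : Selection d)
    (σ : Pairing d) : EdgeLaw (erasedGraph σ) ν (weightLaw ν s σ) where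
  prob := Measure.isProbabilityMeasure_map (measurable_edgeWeight σ s).aemeasurable
  indep := by
    intro p hp E hE hinv c
    have hne := mem_edgeSet_erasedGraph hp
    have hc : MeasurableSet {W : Sym2 (Fin n) → ℝ | W p ≤ c} :=
      measurableSet_le (measurable_pi_apply _) measurable_const
    rw [weightLaw_real_apply ν s σ (hE.inter hc), weightLaw_real_apply ν s σ hE]
    have := pi_inter_coordinate (ν := ν) (measurable_edgeWeight σ s hE)
      (s ⟨cmEdgesBetween σ p, hne⟩).1 ?_ (measurableSet_Iic (a := c))
    · rw [measureReal_def, measureReal_def, measureReal_def, ← ENNReal.toReal_mul, ← this]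
      congr 2
      ext w
      simp [edgeWeight, hne]
    · intro w w' hw
      refine hinv _ _ fun q hq => ?_
      unfold edgeWeight
      split_ifs with h
      · refine hw _ fun he => hq ?_
        rw [← ends_selection σ s h, he, ends_selection σ s hne]
      · rfl
  tail := by
    intro p c hc
    rw [weightLaw_real_apply ν s σ (measurableSet_lt measurable_const (measurable_pi_apply _))]
    by_cases h : (cmEdgesBetween σ p).Nonempty
    · refine le_of_eq ?_
      rw [measureReal_def, measureReal_def]
      congr 1
      refine Eq.trans ?_ ((measurePreserving_eval (fun _ : PotentialEdge d => ν)
        (s ⟨cmEdgesBetween σ p, h⟩).1).measure_preimage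
          (measurableSet_Ioi (a := c)).nullMeasurableSet)
      congr 1
      ext w
      simp [edgeWeight, h]
    -- A pair that is not joined has weight `0`, which cannot exceed a nonnegative `c`.
    · have : edgeWeight σ s ⁻¹' {W | c < W p} = ∅ := by
        ext w
        simp [edgeWeight, h, hc]
      rw [this]
      simp

theorem pi_edgeWeight_lt (ν : Measure ℝ) [IsProbabilityMeasure ν] (s : Selection d)
    (σ : Pairing d) {p : Sym2 (Fin n)} (hp : p ∈ (erasedGraph σ).edgeSet) (c : ℝ) :
    (Measure.pi fun _ : PotentialEdge d => ν) {w | edgeWeight σ s w p < c} = ν (Set.Iio c) := by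
  have h := mem_edgeSet_erasedGraph hp
  refine Eq.trans ?_ ((measurePreserving_eval (fun _ : PotentialEdge d => ν)
    (s ⟨cmEdgesBetween σ p, h⟩).1).measure_preimage (measurableSet_Iio (a := c)).nullMeasurableSet)
  congr 1
  ext w
  simp [edgeWeight, h]

theorem pi_exists_neg {ι : Type*} [Fintype ι] {ν : Measure ℝ} [IsProbabilityMeasure ν]
    (hν : ν (Set.Iio 0) = 0) : (Measure.pi fun _ : ι => ν) {w | ∃ i, w i < 0} = 0 := by
  have : {w : ι → ℝ | ∃ i, w i < 0} = ⋃ i, {w | w i < 0} := by ext; simp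
  rw [this, measure_iUnion_null_iff]
  intro i
  exact ((measurePreserving_eval (fun _ : ι => ν) i).measure_preimage
    measurableSet_Iio.nullMeasurableSet).trans hν

theorem edgeWeight_nonneg {σ : Pairing d} {s : Selection d} {w : PotentialEdge d → ℝ}
    (hw : ∀ e, 0 ≤ w e) (p : Sym2 (Fin n)) : 0 ≤ edgeWeight σ s w p := by
  unfold edgeWeight
  split_ifs
  · exact hw _
  · exact le_rfl

instance : Finite (Selection d) := by unfold Selection; infer_instance

instance : Nonempty (Selection d) := ⟨fun S => ⟨S.2.choose, S.2.choose_spec⟩⟩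

instance : MeasurableSingletonClass (Pairing d) := ⟨fun _ => trivial⟩

instance : MeasurableSingletonClass (Selection d) := ⟨fun _ => trivial⟩

theorem uniformOn_univ_singleton {Ω : Type*} [Fintype Ω] [MeasurableSpace Ω]
    [MeasurableSingletonClass Ω] (x : Ω) :
    uniformOn (Set.univ : Set Ω) {x} = ENNReal.ofReal (1 / Fintype.card Ω) := by
  have : 0 < Fintype.card Ω := Fintype.card_pos_iff.2 ⟨x⟩
  rw [uniformOn_univ, Measure.count_singleton, ENNReal.ofReal_div_of_pos (by positivity)]
  simp

open Classical in
/-- A bad event has small probability if it has small conditional probability on average over the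
pairing and the marked vertices, for every selection. -/
theorem law_le_of_average {ν : Measure ℝ} [IsProbabilityMeasure ν] {B : Set (Sample d)}
    {F : Pairing d → Selection d → Fin n × Fin n → Set (PotentialEdge d → ℝ)}
    (hB : ∀ ω ∈ B, ω.2.2.1 ∈ F ω.1 ω.2.1 ω.2.2.2) {ε : ℝ}
    (h : ∀ s, ∑ σ, ∑ uv, (Measure.pi fun _ : PotentialEdge d => ν).real (F σ s uv) ≤
      ε * (Fintype.card (Pairing d) * (n : ℝ) ^ 2)) :
    law d ν B ≤ ENNReal.ofReal ε := by
  have := Fintype.ofFinite (Selection d)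
  set μ := Measure.pi fun _ : PotentialEdge d => ν
  -- All components but the weights are finite. The finite cover by products reduces everything to
  -- the product formula, which needs no measurability of `B` or `F`.
  have hsub : B ⊆ ⋃ x : Pairing d × Selection d × (Fin n × Fin n),
      ({x.1} ×ˢ ({x.2.1} ×ˢ (F x.1 x.2.1 x.2.2 ×ˢ {x.2.2})) : Set (Sample d)) := by
    intro ω hω
    refine Set.mem_iUnion.2 ⟨(ω.1, ω.2.1, ω.2.2.2), ?_⟩
    exact ⟨rfl, rfl, hB ω hω, rfl⟩
  rcases isEmpty_or_nonempty (Pairing d × Selection d × (Fin n × Fin n)) with he | hne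
  · have : B = ∅ := by
      refine Set.subset_empty_iff.1 (hsub.trans ?_)
      simp
    simp [this]
  obtain ⟨σ₀, s₀, uv₀⟩ := hne.some
  have hP : (0 : ℝ) < Fintype.card (Pairing d) := by
    exact_mod_cast Fintype.card_pos_iff.2 ⟨σ₀⟩
  have hS : (0 : ℝ) < Fintype.card (Selection d) := by
    exact_mod_cast Fintype.card_pos_iff.2 ⟨s₀⟩
  have hn : (0 : ℝ) < n := by
    have := uv₀.1.pos
    exact_mod_cast this
  have hcardV : (Fintype.card (Fin n × Fin n) : ℝ) = (n : ℝ) ^ 2 := by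
    simp [sq]
  have hterm : ∀ x : Pairing d × Selection d × (Fin n × Fin n),
      law d ν ({x.1} ×ˢ ({x.2.1} ×ˢ (F x.1 x.2.1 x.2.2 ×ˢ {x.2.2}))) =
        ENNReal.ofReal (1 / Fintype.card (Pairing d) * (1 / Fintype.card (Selection d) *
          (μ.real (F x.1 x.2.1 x.2.2) * (1 / (n : ℝ) ^ 2)))) := by
    intro x
    unfold law
    rw [Measure.prod_prod, Measure.prod_prod, Measure.prod_prod, uniformOn_univ_singleton,
      uniformOn_univ_singleton, uniformOn_univ_singleton, hcardV,
      ENNReal.ofReal_mul (by positivity), ENNReal.ofReal_mul (by positivity),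
      ENNReal.ofReal_mul (by positivity), ofReal_measureReal]
  calc law d ν B ≤ _ := measure_mono hsub
    _ ≤ ∑ x : Pairing d × Selection d × (Fin n × Fin n),
          law d ν ({x.1} ×ˢ ({x.2.1} ×ˢ (F x.1 x.2.1 x.2.2 ×ˢ {x.2.2}))) :=
        measure_iUnion_fintype_le _ _
    _ = ENNReal.ofReal (∑ x : Pairing d × Selection d × (Fin n × Fin n),
          1 / Fintype.card (Pairing d) * (1 / Fintype.card (Selection d) *
          (μ.real (F x.1 x.2.1 x.2.2) * (1 / (n : ℝ) ^ 2)))) := by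
        rw [ENNReal.ofReal_sum_of_nonneg fun x _ => by positivity]
        exact Finset.sum_congr rfl fun x _ => hterm x
    _ ≤ ENNReal.ofReal ε := by
        refine ENNReal.ofReal_le_ofReal ?_
        have hre : (∑ x : Pairing d × Selection d × (Fin n × Fin n),
            1 / (Fintype.card (Pairing d) : ℝ) * (1 / (Fintype.card (Selection d) : ℝ) *
            (μ.real (F x.1 x.2.1 x.2.2) * (1 / (n : ℝ) ^ 2)))) =
            ∑ s : Selection d, 1 / (Fintype.card (Selection d) : ℝ) *
              ((∑ σ, ∑ uv, μ.real (F σ s uv)) *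
                (1 / (Fintype.card (Pairing d) * (n : ℝ) ^ 2))) := by
          rw [Fintype.sum_prod_type, Finset.sum_congr rfl fun σ _ => Fintype.sum_prod_type _,
            Finset.sum_comm]
          refine Finset.sum_congr rfl fun s _ => ?_
          simp only [Finset.sum_mul, Finset.mul_sum]
          refine Finset.sum_congr rfl fun σ _ => Finset.sum_congr rfl fun uv _ => ?_
          field_simp
        rw [hre]
        calc _ ≤ ∑ s : Selection d, 1 / (Fintype.card (Selection d) : ℝ) * ε := by
              refine Finset.sum_le_sum fun s _ => ?_
              gcongr
              rw [← div_eq_mul_one_div, div_le_iff₀ (by positivity)]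
              exact h s
          _ = ε := by
              rw [Finset.sum_const, Finset.card_univ, nsmul_eq_mul]
              field_simp

end Law

/-! ### Balls and potentials -/

section Balls

variable {V : Type*} [Fintype V]

open Classical in
/-- The vertices at graph distance at most `k` from `x`. -/
def ball (G : SimpleGraph V) (x : V) (k : ℕ) : Finset V :=
  Finset.univ.filter fun y => ∃ p : G.Walk x y, p.length ≤ k

variable {G : SimpleGraph V} {x y z : V} {k l : ℕ}

theorem mem_ball : y ∈ ball G x k ↔ ∃ p : G.Walk x y, p.length ≤ k := by simp [ball]

theorem mem_ball_zero : y ∈ ball G x 0 ↔ y = x := by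
  rw [mem_ball]
  constructor
  · rintro ⟨p, hp⟩
    exact (SimpleGraph.Walk.eq_of_length_eq_zero (Nat.le_zero.1 hp)).symm
  · rintro rfl
    exact ⟨SimpleGraph.Walk.nil, le_rfl⟩

theorem ball_mono (h : k ≤ l) : ball G x k ⊆ ball G x l := by
  intro y hy
  rw [mem_ball] at hy ⊢
  obtain ⟨p, hp⟩ := hy
  exact ⟨p, hp.trans h⟩

theorem self_mem_ball (x : V) (k : ℕ) : x ∈ ball G x k :=
  mem_ball.2 ⟨SimpleGraph.Walk.nil, Nat.zero_le _⟩

theorem mem_ball_comm : y ∈ ball G x k ↔ x ∈ ball G y k := by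
  rw [mem_ball, mem_ball]
  exact ⟨fun ⟨p, hp⟩ => ⟨p.reverse, by simpa using hp⟩,
    fun ⟨p, hp⟩ => ⟨p.reverse, by simpa using hp⟩⟩

theorem mem_ball_succ_of_adj (hz : z ∈ ball G x k) (h : G.Adj z y) : y ∈ ball G x (k + 1) := by
  rw [mem_ball] at hz ⊢
  obtain ⟨p, hp⟩ := hz
  exact ⟨p.concat h, by rw [SimpleGraph.Walk.length_concat]; omega⟩

theorem exists_adj_of_mem_ball_succ (hy : y ∈ ball G x (k + 1)) (hk : y ∉ ball G x k) :
    ∃ z ∈ ball G x k, G.Adj z y := by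
  rw [mem_ball] at hy
  obtain ⟨p, hp⟩ := hy
  have hxy : ¬ p.reverse.Nil := by
    intro h
    have : p.length = 0 := by simpa using SimpleGraph.Walk.length_eq_zero_iff.2 h
    exact hk (mem_ball.2 ⟨p, by omega⟩)
  revert hxy
  generalize hq : p.reverse = q
  intro hxy
  cases q with
  | nil => simp at hxy
  | @cons _ z _ h q =>
    refine ⟨z, mem_ball.2 ⟨q.reverse, ?_⟩, h.symm⟩
    have := congrArg SimpleGraph.Walk.length hq
    simp only [SimpleGraph.Walk.length_reverse, SimpleGraph.Walk.length_cons] at this ⊢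
    omega

open Classical in
theorem card_ball_succ_le {m : ℕ}
    (hm : ∀ z ∈ ball G x k, (Finset.univ.filter fun y => G.Adj z y).card ≤ m) :
    (ball G x (k + 1)).card ≤ (ball G x k).card * (1 + m) := by
  have hsub : ball G x (k + 1) ⊆
      ball G x k ∪ (ball G x k).biUnion fun z => Finset.univ.filter fun y => G.Adj z y := by
    intro y hy
    by_cases hk : y ∈ ball G x k
    · exact Finset.mem_union_left _ hk
    · obtain ⟨z, hz, hzy⟩ := exists_adj_of_mem_ball_succ hy hk
      exact Finset.mem_union_right _ (Finset.mem_biUnion.2 ⟨z, hz, by simpa using hzy⟩)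
  refine (Finset.card_le_card hsub).trans ((Finset.card_union_le _ _).trans ?_)
  have := Finset.card_biUnion_le_card_mul (ball G x k)
    (fun z => Finset.univ.filter fun y => G.Adj z y) m hm
  linarith [mul_add (ball G x k).card 1 m]

/-- The cost of leaving the balls around `x`, if leaving the ball of radius `k` costs `h k`. -/
def potential (G : SimpleGraph V) (h : ℕ → ℝ) (K : ℕ) (x y : V) : ℝ := by
  classical exact ∑ k ∈ Finset.range K, if y ∈ ball G x k then 0 else h k

/-- Distances from `u` change by at most one along an edge, so the edge leaves the ball of radius
`k` and no other. Hence only the summand `h k` changes. -/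
theorem potential_sub_le {h : ℕ → ℝ} (hh : ∀ k, 0 ≤ h k) {K : ℕ} {u : V} {W : Sym2 V → ℝ}
    (hW : ∀ k < K, ∀ x ∈ ball G u k, ∀ y, y ∉ ball G u k → G.Adj x y → h k ≤ W s(x, y))
    {x y : V} (hxy : G.Adj x y) (hk : k < K) (hx : x ∈ ball G u k) (hy : y ∉ ball G u k) :
    potential G h K u y - potential G h K u x ≤ W s(x, y) := by
  classical
  unfold potential
  rw [← Finset.sum_sub_distrib]
  refine le_trans (Finset.sum_le_sum (g := fun i => if i = k then h k else 0) fun i hi => ?_) ?_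
  · by_cases hik : i = k
    · subst hik; simp [hx, hy]
    · rw [if_neg hik]
      rcases lt_or_gt_of_ne hik with hlt | hlt
      · have : x ∉ ball G u i := fun hxi =>
          hy (ball_mono (show i + 1 ≤ k by omega) (mem_ball_succ_of_adj hxi hxy))
        rw [if_neg this]
        split_ifs
        · linarith [hh i]
        · simp
      · have : y ∈ ball G u i := ball_mono (show k + 1 ≤ i by omega) (mem_ball_succ_of_adj hx hxy)
        rw [if_pos this]
        split_ifs
        · simp
        · linarith [hh i]
  · rw [Finset.sum_ite_eq' _ k, if_pos (Finset.mem_range.2 hk)]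
    exact hW k hk x hx y hy hxy

theorem potential_le {h : ℕ → ℝ} (hh : ∀ k, 0 ≤ h k) {K : ℕ} {u x y : V}
    (hk : ¬ ∃ k < K, x ∈ ball G u k ∧ y ∉ ball G u k) :
    potential G h K u y ≤ potential G h K u x := by
  classical
  unfold potential
  refine Finset.sum_le_sum fun i hi => ?_
  rw [Finset.mem_range] at hi
  have : x ∈ ball G u i → y ∈ ball G u i := fun hx => by
    by_contra hy
    exact hk ⟨i, hi, hx, hy⟩
  split_ifs with h1 h2 h2
  · exact le_rfl
  · exact hh i
  · exact absurd (this h2) h1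
  · exact le_rfl

/-- If the balls of radius `K` around `u` and `v` are disjoint and leaving a ball of radius `k`
costs at least `h k`, then a walk from `u` to `v` costs at least twice the sum of the `h k`. -/
theorem two_mul_sum_le_walkWeight {h : ℕ → ℝ} (hh : ∀ k, 0 ≤ h k) {K : ℕ} {u v : V}
    {W : Sym2 V → ℝ} (hW0 : ∀ p, 0 ≤ W p)
    (hu : ∀ k < K, ∀ x ∈ ball G u k, ∀ y, y ∉ ball G u k → G.Adj x y → h k ≤ W s(x, y))
    (hv : ∀ k < K, ∀ x ∈ ball G v k, ∀ y, y ∉ ball G v k → G.Adj x y → h k ≤ W s(x, y))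
    (hdisj : ∀ x ∈ ball G u K, x ∉ ball G v K) (p : G.Walk u v) :
    2 * ∑ k ∈ Finset.range K, h k ≤ walkWeight W p := by
  -- The difference of the two potentials increases along an edge by at most its weight, and by
  -- twice the sum of the `h k` from `u` to `v`.
  set f : V → ℝ := fun x => potential G h K u x - potential G h K v x with hf
  have hstep : ∀ x y, G.Adj x y → f y - f x ≤ W s(x, y) := by
    intro x y hxy
    by_cases h1 : ∃ k < K, x ∈ ball G u k ∧ y ∉ ball G u k
    · have h2 : ¬ ∃ k < K, y ∈ ball G v k ∧ x ∉ ball G v k := by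
        rintro ⟨l, hl, hyl, -⟩
        obtain ⟨k, hk, hxk, -⟩ := h1
        exact hdisj x (ball_mono hk.le hxk)
          (ball_mono (show l + 1 ≤ K by omega) (mem_ball_succ_of_adj hyl hxy.symm))
      obtain ⟨k, hk, hxk, hyk⟩ := h1
      have h3 := potential_sub_le hh hu hxy hk hxk hyk
      have h4 := potential_le (G := G) hh h2
      simp only [hf]
      linarith
    · have h3 := potential_le (G := G) hh h1
      by_cases h2 : ∃ k < K, y ∈ ball G v k ∧ x ∉ ball G v k
      · obtain ⟨k, hk, hyk, hxk⟩ := h2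
        have h4 := potential_sub_le hh hv hxy.symm hk hyk hxk
        rw [Sym2.eq_swap] at h4
        simp only [hf]
        linarith
      · have h4 := potential_le (G := G) hh h2
        have := hW0 s(x, y)
        simp only [hf]
        linarith
  have hwalk : ∀ x y (p : G.Walk x y), f y - f x ≤ walkWeight W p := by
    intro x y p
    induction p with
    | nil => simp [walkWeight]
    | cons h p ih =>
      rw [walkWeight_cons]
      linarith [hstep _ _ h]
  have e1 : ∀ a, potential G h K a a = 0 := by
    intro a
    unfold potential
    exact Finset.sum_eq_zero fun i _ => if_pos (self_mem_ball a i)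
  have e2 : potential G h K u v = ∑ k ∈ Finset.range K, h k := by
    unfold potential
    refine Finset.sum_congr rfl fun i hi => if_neg fun hmem => ?_
    exact hdisj v (ball_mono (Finset.mem_range.1 hi).le hmem) (self_mem_ball _ _)
  have e3 : potential G h K v u = ∑ k ∈ Finset.range K, h k := by
    unfold potential
    refine Finset.sum_congr rfl fun i hi => if_neg fun hmem => ?_
    exact hdisj u (self_mem_ball _ _) (ball_mono (Finset.mem_range.1 hi).le hmem)
  have := hwalk u v p
  simp only [hf, e1, e2, e3] at this
  linarith

/-- With unit weights, the previous bound is a bound on the number of edges. -/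
theorem two_mul_le_length {K : ℕ} {u v : V} (hdisj : ∀ x ∈ ball G u K, x ∉ ball G v K)
    (p : G.Walk u v) : 2 * K ≤ p.length := by
  have h := two_mul_sum_le_walkWeight (G := G) (h := fun _ => 1) (W := fun _ => 1)
    (fun _ => zero_le_one) (fun _ => zero_le_one) (fun _ _ _ _ _ _ _ => le_rfl)
    (fun _ _ _ _ _ _ _ => le_rfl) hdisj p
  have hl : walkWeight (fun _ => (1 : ℝ)) p = p.length := by
    simp [walkWeight]
  rw [hl] at h
  simp only [Finset.sum_const, Finset.card_range, nsmul_eq_mul, mul_one] at h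
  exact_mod_cast h

end Balls

/-! ### Counting paths with prescribed degrees -/

section Paths

section Events

variable {V : Type*} [DecidableEq V]

/-- There is a path of `m` steps from `x` that avoids `A` and visits `Λ i, Λ (i + 1), …`. -/
def PathEvent (G : SimpleGraph V) (Λ : ℕ → Finset V) : ℕ → ℕ → V → Finset V → Prop
  | 0, _, _, _ => True
  | m + 1, i, x, A => ∃ z ∈ Λ i, z ∉ insert x A ∧ G.Adj x z ∧ PathEvent G Λ m (i + 1) z (insert x A)

/-- A shortest path increases the distance from `u` by exactly one in each step, so it avoids the
vertices it has visited and its `j`th vertex lies in the ball of radius `j`. -/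
theorem pathEvent_of_mem_ball [Fintype V] {G : SimpleGraph V} {Λ : ℕ → Finset V} {u x : V} {k : ℕ}
    (hx : x ∈ ball G u k) (hxk : ∀ j < k, x ∉ ball G u j) (hΛk : x ∈ Λ k)
    (hΛ : ∀ j < k, ∀ z ∈ ball G u j, z ∈ Λ j) : PathEvent G Λ k 1 u ∅ := by
  have key : ∀ m i, i + m = k → ∃ z ∈ Λ i, z ∈ ball G u i ∧ (∀ j < i, z ∉ ball G u j) ∧
      ∀ A : Finset V, (∀ a ∈ A, ∃ j < i, a ∈ ball G u j) → PathEvent G Λ m (i + 1) z A := by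
    intro m
    induction m with
    | zero =>
      rintro i rfl
      exact ⟨x, hΛk, hx, hxk, fun _ _ => trivial⟩
    | succ m ih =>
      intro i hi
      obtain ⟨z, hzΛ, hz, hzj, hP⟩ := ih (i + 1) (by omega)
      obtain ⟨z', hz', hadj⟩ := exists_adj_of_mem_ball_succ hz (hzj i (Nat.lt_succ_self i))
      refine ⟨z', hΛ i (by omega) z' hz', hz', fun j hj hzj' => ?_, fun A hA => ?_⟩
      · exact hzj (j + 1) (by omega) (mem_ball_succ_of_adj hzj' hadj)
      · refine ⟨z, hzΛ, ?_, hadj, hP _ ?_⟩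
        · rw [Finset.mem_insert, not_or]
          refine ⟨hadj.ne', fun hzA => ?_⟩
          obtain ⟨j, hj, hzj'⟩ := hA z hzA
          exact hzj j (by omega) hzj'
        · intro a ha
          rcases Finset.mem_insert.1 ha with rfl | ha
          · exact ⟨i, Nat.lt_succ_self i, hz'⟩
          · obtain ⟨j, hj, haj⟩ := hA a ha
            exact ⟨j, by omega, haj⟩
  obtain ⟨z, -, hz, -, hP⟩ := key k 0 (by omega)
  rw [mem_ball_zero] at hz
  subst hz
  exact hP ∅ (by simp)

end Events

variable {n : ℕ} {d : Fin n → ℕ}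

/-- Upper bound for the probability of a path of `m` steps from `x` through `Λ i, Λ (i + 1), …`. -/
def pathBound (d : Fin n → ℕ) (Λ : ℕ → Finset (Fin n)) : ℕ → ℕ → Fin n → ℝ
  | 0, _, _ => 1
  | m + 1, i, x => pairedDegree d x * (2 / Fintype.card (HalfEdge d) *
      ∑ z ∈ Λ i, pairedDegree d z * pathBound d Λ m (i + 1) z)

theorem pathBound_nonneg (Λ : ℕ → Finset (Fin n)) (m : ℕ) :
    ∀ i x, 0 ≤ pathBound d Λ m i x := by
  induction m with
  | zero => intro i x; exact zero_le_one
  | succ m ih =>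
    intro i x
    have : 0 ≤ ∑ z ∈ Λ i, pairedDegree d z * pathBound d Λ m (i + 1) z :=
      Finset.sum_nonneg fun z _ => mul_nonneg (Nat.cast_nonneg _) (ih _ _)
    unfold pathBound
    positivity

open Classical in
-- Union bound over the free half-edges at `x`. While at most half of all half-edges are
-- unavailable, each given partner has probability at most two divided by their total number; this
-- is the factor in `pathBound`.
theorem condAvg_pathEvent_le (Λ : ℕ → Finset (Fin n)) (m : ℕ) :
    ∀ i (τ : Pairing d) Θ x A, Closed τ Θ → (∀ h ∈ Θ, h.1 ∈ insert x A) →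
      2 * (Θ.card + 2 * m) ≤ Fintype.card (HalfEdge d) →
      condAvg τ Θ (fun σ => if PathEvent (erasedGraph σ) Λ m i x A then 1 else 0) ≤
        pathBound d Λ m i x := by
  induction m with
  | zero =>
    intro i τ Θ x A _ _ _
    refine condAvg_le_const fun σ _ => ?_
    split_ifs <;> simp [pathBound]
  | succ m ih =>
    intro i τ Θ x A hc hsub hcard
    set S := ∑ z ∈ Λ i, pairedDegree d z * pathBound d Λ m (i + 1) z with hS
    have hS0 : 0 ≤ S :=
      Finset.sum_nonneg fun z _ => mul_nonneg (Nat.cast_nonneg _) (pathBound_nonneg _ _ _ _)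
    have hone : ∀ a ∈ halfEdgesAt d x \ Θ, condAvg τ Θ (fun σ =>
        if (σ.1 a).1 ∈ Λ i ∧ (σ.1 a).1 ∉ insert x A ∧
          PathEvent (erasedGraph σ) Λ m (i + 1) (σ.1 a).1 (insert x A) then 1 else 0) ≤
        2 / Fintype.card (HalfEdge d) * S := by
      intro a ha
      rw [Finset.mem_sdiff, mem_halfEdgesAt] at ha
      obtain ⟨hax, haΘ⟩ := ha
      have hN := card_partners haΘ
      have hN' : (Fintype.card (HalfEdge d) : ℝ) / 2 ≤ (partners Θ a).card := by
        rw [div_le_iff₀ two_pos]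
        exact_mod_cast (by omega)
      have hH : (0 : ℝ) < Fintype.card (HalfEdge d) := by
        exact_mod_cast (by omega)
      refine (condAvg_reveal hc haΘ (g := fun b => if b.1 ∈ Λ i then
        pathBound d Λ m (i + 1) b.1 else 0) ?_).trans ?_
      · intro b hb σ hσ hσb hcl
        by_cases hbΛ : b.1 ∈ Λ i ∧ b.1 ∉ insert x A
        · rw [if_pos hbΛ.1]
          refine le_trans (condAvg_mono fun σ' hσ' => ?_)
            (ih (i + 1) σ (insert a (insert b Θ)) b.1 (insert x A) hcl ?_ ?_)
          · have h1 : σ'.1 a = b := (mem_cyl.1 hσ' a (Finset.mem_insert_self _ _)).trans hσb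
            rw [h1]
            simp only [hbΛ, true_and, not_false_eq_true]
            exact le_rfl
          · intro h hh
            simp only [Finset.mem_insert] at hh
            rcases hh with rfl | rfl | hh
            · simp [hax]
            · simp
            · exact Finset.mem_insert_of_mem (hsub h hh)
          · have h1 := Finset.card_insert_le a (insert b Θ)
            have h2 := Finset.card_insert_le b Θ
            omega
        · refine le_trans (condAvg_le_const (c := 0) fun σ' hσ' => ?_) ?_
          · have h1 : σ'.1 a = b := (mem_cyl.1 hσ' a (Finset.mem_insert_self _ _)).trans hσb
            rw [h1, if_neg fun h => hbΛ ⟨h.1, h.2.1⟩]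
          · split_ifs
            · exact pathBound_nonneg _ _ _ _
            · exact le_rfl
      · have hsum : ∑ b ∈ partners Θ a, (if b.1 ∈ Λ i then pathBound d Λ m (i + 1) b.1 else 0) ≤
            S := by
          refine (Finset.sum_le_sum_of_subset_of_nonneg (Finset.subset_univ _)
            fun b _ _ => ?_).trans (le_of_eq ?_)
          · split_ifs
            · exact pathBound_nonneg _ _ _ _
            · exact le_rfl
          · rw [Fintype.sum_sigma, hS]
            simp only [Finset.sum_const, Finset.card_univ, Fintype.card_fin, nsmul_eq_mul, mul_ite,
              mul_zero, Finset.sum_ite_mem, Finset.univ_inter]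
        calc _ ≤ S / (Fintype.card (HalfEdge d) / 2) := by gcongr
          _ = _ := by field_simp
    calc condAvg τ Θ (fun σ => if PathEvent (erasedGraph σ) Λ (m + 1) i x A then 1 else 0)
        ≤ condAvg τ Θ (fun σ => ∑ a ∈ halfEdgesAt d x \ Θ,
          if (σ.1 a).1 ∈ Λ i ∧ (σ.1 a).1 ∉ insert x A ∧
            PathEvent (erasedGraph σ) Λ m (i + 1) (σ.1 a).1 (insert x A) then 1 else 0) := by
          refine condAvg_mono fun σ hσ => ?_
          split_ifs with hev
          · obtain ⟨z, hz, hzA, hadj, hP⟩ := hev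
            obtain ⟨-, a, ha, haz⟩ := (erasedGraph_adj_iff σ x z).1 hadj
            have haΘ : a ∉ Θ := fun h => hzA (haz ▸ hsub _ ((hc.of_mem_cyl hσ) a h))
            refine le_trans (le_of_eq ?_) (Finset.single_le_sum (fun a _ => ?_)
              (Finset.mem_sdiff.2 ⟨mem_halfEdgesAt.2 ha, haΘ⟩))
            · rw [haz, if_pos ⟨hz, hzA, hP⟩]
            · split_ifs <;> simp
          · exact Finset.sum_nonneg fun a _ => by split_ifs <;> simp
      _ = ∑ a ∈ halfEdgesAt d x \ Θ, _ := condAvg_sum _ _ _ _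
      _ ≤ (halfEdgesAt d x \ Θ).card • (2 / Fintype.card (HalfEdge d) * S) :=
          Finset.sum_le_card_nsmul _ _ _ hone
      _ ≤ pathBound d Λ (m + 1) i x := by
          rw [nsmul_eq_mul]
          unfold pathBound
          gcongr
          rw [← card_halfEdgesAt]
          exact Finset.card_le_card Finset.sdiff_subset

end Paths

/-! ### Lower bound for a fixed number of vertices -/

section LowerBound

variable {n : ℕ} {d : Fin n → ℕ}

/-- Vertex sets along a path whose degrees stay below `y` until step `k`. -/
def levelSet (d : Fin n → ℕ) (y : ℕ → ℝ) (k j : ℕ) : Finset (Fin n) :=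
  if j < k then Finset.univ.filter fun z => (pairedDegree d z : ℝ) ≤ y j
  else Finset.univ.filter fun z => y j < (pairedDegree d z : ℝ)

/-- An inner vertex contributes its degree twice, once to be entered and once to be left, so
truncated second moments `s j` appear. The last vertex is only entered and contributes the tail `b
k`. -/
theorem pathBound_levelSet_le {y s b : ℕ → ℝ}
    (hs : ∀ j, 2 / (Fintype.card (HalfEdge d) : ℝ) *
      ∑ z with (pairedDegree d z : ℝ) ≤ y j, (pairedDegree d z : ℝ) ^ 2 ≤ s j)
    (hb : ∀ j, 2 / (Fintype.card (HalfEdge d) : ℝ) *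
      ∑ z with y j < (pairedDegree d z : ℝ), (pairedDegree d z : ℝ) ≤ b j) (k m : ℕ) :
    ∀ i x, i + m = k → pathBound d (levelSet d y k) (m + 1) i x ≤
      pairedDegree d x * ((∏ j ∈ Finset.Ico i k, s j) * b k) := by
  induction m with
  | zero =>
    rintro i x rfl
    simp only [pathBound, levelSet, add_zero, lt_irrefl, if_false, Finset.Ico_self,
      Finset.prod_empty, one_mul, mul_one]
    gcongr
    exact hb i
  | succ m ih =>
    intro i x hi
    have hik : i < k := by omega
    set R := (∏ j ∈ Finset.Ico (i + 1) k, s j) * b k with hR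
    have hs0 : ∀ j, 0 ≤ s j := fun j => le_trans (by positivity) (hs j)
    have hb0 : 0 ≤ b k := le_trans (by positivity) (hb k)
    have hR0 : 0 ≤ R := mul_nonneg (Finset.prod_nonneg fun j _ => hs0 j) hb0
    rw [Finset.prod_eq_prod_Ico_succ_bot hik, mul_assoc, ← hR]
    rw [pathBound, levelSet, if_pos hik]
    refine mul_le_mul_of_nonneg_left ?_ (Nat.cast_nonneg _)
    calc 2 / (Fintype.card (HalfEdge d) : ℝ) *
          ∑ z with (pairedDegree d z : ℝ) ≤ y i,
            pairedDegree d z * pathBound d (levelSet d y k) (m + 1) (i + 1) z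
        ≤ 2 / (Fintype.card (HalfEdge d) : ℝ) *
          ∑ z with (pairedDegree d z : ℝ) ≤ y i, (pairedDegree d z : ℝ) ^ 2 * R := by
          refine mul_le_mul_of_nonneg_left (Finset.sum_le_sum fun z _ => ?_) (by positivity)
          rw [sq, mul_assoc]
          exact mul_le_mul_of_nonneg_left (ih (i + 1) z (by omega)) (Nat.cast_nonneg _)
      _ ≤ s i * R := by
          rw [← Finset.sum_mul, ← mul_assoc]
          gcongr
          exact hs i

/-- Some vertex at distance at most `K` from `u` has an exceptionally large degree. -/
def HighDegree (σ : Pairing d) (y : ℕ → ℝ) (K : ℕ) (u : Fin n) : Prop :=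
  ∃ k ≤ K, ∃ x ∈ ball (erasedGraph σ) u k, y k < pairedDegree d x

/-- Take the smallest radius at which the threshold is exceeded. Before it all degrees are small,
which is the truncation that keeps the second moments finite; radius zero is the case of `u` itself.
-/
theorem HighDegree.pathEvent {σ : Pairing d} {y : ℕ → ℝ} (hy : Monotone y) {K : ℕ} {u : Fin n}
    (h : HighDegree σ y K u) : y 0 < pairedDegree d u ∨ ∃ k ∈ Finset.range K,
      PathEvent (erasedGraph σ) (levelSet d y (k + 1)) (k + 1) 1 u ∅ := by
  classical
  let p : ℕ → Prop := fun k => k ≤ K ∧ ∃ x ∈ ball (erasedGraph σ) u k, y k < pairedDegree d x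
  have hp : ∃ k, p k := by
    obtain ⟨k, hk, h⟩ := h
    exact ⟨k, hk, h⟩
  obtain ⟨hkK, x, hx, hyx⟩ := Nat.find_spec hp
  have hmin : ∀ j < Nat.find hp, ∀ z ∈ ball (erasedGraph σ) u j, (pairedDegree d z : ℝ) ≤ y j := by
    intro j hj z hz
    by_contra hcon
    exact Nat.find_min hp hj ⟨by omega, z, hz, not_le.1 hcon⟩
  rcases hk : Nat.find hp with _ | k
  · rw [hk] at hx hyx
    rw [mem_ball_zero] at hx
    subst hx
    exact Or.inl hyx
  · rw [hk] at hx hyx hmin hkK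
    refine Or.inr ⟨k, Finset.mem_range.2 (by omega), pathEvent_of_mem_ball hx ?_ ?_ ?_⟩
    · intro j hj hxj
      exact absurd (hyx.trans_le (hmin j hj x hxj)) (not_lt.2 (hy hj.le))
    · simpa [levelSet] using hyx
    · intro j hj z hz
      simpa [levelSet, hj] using hmin j hj z hz

open Classical in
-- The path bound is linear in the degree of the starting vertex, so summing over the start gives
-- the total number of half-edges.
theorem sum_highDegree_le {y s b : ℕ → ℝ} (hy : Monotone y)
    (hs : ∀ j, 2 / (Fintype.card (HalfEdge d) : ℝ) *
      ∑ z with (pairedDegree d z : ℝ) ≤ y j, (pairedDegree d z : ℝ) ^ 2 ≤ s j)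
    (hb : ∀ j, 2 / (Fintype.card (HalfEdge d) : ℝ) *
      ∑ z with y j < (pairedDegree d z : ℝ), (pairedDegree d z : ℝ) ≤ b j) {K : ℕ}
    (hK : 4 * K ≤ Fintype.card (HalfEdge d)) :
    ∑ σ : Pairing d, ∑ u, (if HighDegree σ y K u then (1 : ℝ) else 0) ≤
      ((Finset.univ.filter fun z => y 0 < (pairedDegree d z : ℝ)).card +
        Fintype.card (HalfEdge d) * ∑ k ∈ Finset.range K,
          (∏ j ∈ Finset.Ico 1 (k + 1), s j) * b (k + 1)) * Fintype.card (Pairing d) := by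
  rcases isEmpty_or_nonempty (Pairing d) with he | ⟨⟨τ⟩⟩
  · simp
  rw [Finset.sum_comm]
  have hone : ∀ u : Fin n, ∑ σ : Pairing d, (if HighDegree σ y K u then (1 : ℝ) else 0) ≤
      ((if y 0 < (pairedDegree d u : ℝ) then 1 else 0) + pairedDegree d u *
        ∑ k ∈ Finset.range K, (∏ j ∈ Finset.Ico 1 (k + 1), s j) * b (k + 1)) *
        Fintype.card (Pairing d) := by
    intro u
    rw [← Finset.card_univ, ← cyl_empty τ, ← condAvg_le_iff]
    calc condAvg τ ∅ (fun σ => if HighDegree σ y K u then (1 : ℝ) else 0)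
        ≤ condAvg τ ∅ (fun σ => (if y 0 < (pairedDegree d u : ℝ) then 1 else 0) +
          ∑ k ∈ Finset.range K,
            if PathEvent (erasedGraph σ) (levelSet d y (k + 1)) (k + 1) 1 u ∅ then 1 else 0) := by
          refine condAvg_mono fun σ _ => ?_
          have h0 : 0 ≤ ∑ k ∈ Finset.range K, (if PathEvent (erasedGraph σ)
              (levelSet d y (k + 1)) (k + 1) 1 u ∅ then (1 : ℝ) else 0) :=
            Finset.sum_nonneg fun k _ => by split_ifs <;> simp
          by_cases hH : HighDegree σ y K u
          · rw [if_pos hH]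
            rcases hH.pathEvent hy with h | ⟨k, hk, h⟩
            · rw [if_pos h]; linarith
            · refine le_trans ?_ (le_add_of_nonneg_left (by split_ifs <;> simp))
              refine le_trans (le_of_eq ?_) (Finset.single_le_sum (fun k _ => ?_) hk)
              · rw [if_pos h]
              · split_ifs <;> simp
          · rw [if_neg hH]
            refine add_nonneg (by split_ifs <;> simp) h0
      _ ≤ _ := by
          rw [condAvg_add, condAvg_const, condAvg_sum, Finset.mul_sum]
          gcongr with k hk
          rw [Finset.mem_range] at hk
          refine (condAvg_pathEvent_le _ (k + 1) 1 τ ∅ u ∅ (closed_empty τ) (by simp)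
            (by rw [Finset.card_empty]; omega)).trans ?_
          exact pathBound_levelSet_le hs hb (k + 1) k 1 u (by omega)
  refine (Finset.sum_le_sum fun u _ => hone u).trans (le_of_eq ?_)
  rw [← Finset.sum_mul, Finset.sum_add_distrib, ← Finset.sum_mul, card_halfEdge]
  congr 3
  · rw [Finset.sum_ite, Finset.sum_const_zero, add_zero, Finset.sum_const, nsmul_one]
  · push_cast
    rfl

/-- The subgraph of the erased graph on the vertices of degree at most `m`. -/
def lowDegreeGraph (σ : Pairing d) (m : ℕ) : SimpleGraph (Fin n) where
  Adj x y := (erasedGraph σ).Adj x y ∧ pairedDegree d x ≤ m ∧ pairedDegree d y ≤ m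
  symm := ⟨fun _ _ h => ⟨h.1.symm, h.2.2, h.2.1⟩⟩
  loopless := ⟨fun _ h => h.1.ne rfl⟩

theorem card_ball_lowDegreeGraph_le (σ : Pairing d) (m : ℕ) (w : Fin n) (k : ℕ) :
    (ball (lowDegreeGraph σ m) w k).card ≤ (1 + m) ^ k := by
  classical
  induction k with
  | zero =>
    refine Finset.card_le_one.2 fun a ha b hb => ?_
    rw [mem_ball_zero] at ha hb
    rw [ha, hb]
  | succ k ih =>
    refine (card_ball_succ_le (m := m) fun z _ => ?_).trans ?_
    · by_cases hz : pairedDegree d z ≤ m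
      · exact (card_neighbors_le σ z _ fun y hy => (Finset.mem_filter.1 hy).2.1).trans hz
      · rw [Finset.card_eq_zero.2]
        · exact Nat.zero_le _
        · refine Finset.filter_eq_empty_iff.2 fun y _ hy => hz hy.2.1
    · rw [pow_succ]
      gcongr

theorem ball_subset_lowDegreeGraph {σ : Pairing d} {m K : ℕ} {u : Fin n}
    (h : ∀ k ≤ K, ∀ x ∈ ball (erasedGraph σ) u k, pairedDegree d x ≤ m) (k : ℕ) (hk : k ≤ K) :
    ball (erasedGraph σ) u k ⊆ ball (lowDegreeGraph σ m) u k := by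
  induction k with
  | zero =>
    intro x hx
    rw [mem_ball_zero] at hx ⊢
    exact hx
  | succ k ih =>
    intro x hx
    by_cases hxk : x ∈ ball (erasedGraph σ) u k
    · exact ball_mono (Nat.le_succ k) (ih (by omega) hxk)
    · obtain ⟨z, hz, hadj⟩ := exists_adj_of_mem_ball_succ hx hxk
      exact mem_ball_succ_of_adj (ih (by omega) hz)
        ⟨hadj, h k (by omega) z hz, h (k + 1) hk x hx⟩

open Classical in
-- If two such balls meet in `w`, then both centres lie within distance `K` of `w` in the subgraph
-- of vertices of degree at most `m`. Balls there have at most `(1 + m) ^ K` vertices, and `w` can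
-- be chosen in `n` ways. Restricting to the subgraph is needed because the degrees are not
-- controlled around `w`, only around the centres.
theorem card_close_pairs_le (σ : Pairing d) {y : ℕ → ℝ} {K m : ℕ} (hm : ∀ k ≤ K, y k ≤ m) :
    (Finset.univ.filter fun uv : Fin n × Fin n => ¬ HighDegree σ y K uv.1 ∧
      ¬ HighDegree σ y K uv.2 ∧
      ∃ w ∈ ball (erasedGraph σ) uv.1 K, w ∈ ball (erasedGraph σ) uv.2 K).card ≤
      n * (1 + m) ^ (2 * K) := by
  have hsub : (Finset.univ.filter fun uv : Fin n × Fin n => ¬ HighDegree σ y K uv.1 ∧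
      ¬ HighDegree σ y K uv.2 ∧
      ∃ w ∈ ball (erasedGraph σ) uv.1 K, w ∈ ball (erasedGraph σ) uv.2 K) ⊆
      Finset.univ.biUnion fun w =>
        ball (lowDegreeGraph σ m) w K ×ˢ ball (lowDegreeGraph σ m) w K := by
    intro uv huv
    obtain ⟨hu, hv, w, hwu, hwv⟩ := (Finset.mem_filter.1 huv).2
    have key : ∀ x, ¬ HighDegree σ y K x → w ∈ ball (erasedGraph σ) x K →
        x ∈ ball (lowDegreeGraph σ m) w K := by
      intro x hx hwx
      rw [mem_ball_comm]
      refine ball_subset_lowDegreeGraph (fun k hk z hz => ?_) K le_rfl hwx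
      by_contra hcon
      refine hx ⟨k, hk, z, hz, (hm k hk).trans_lt ?_⟩
      exact_mod_cast not_le.1 hcon
    exact Finset.mem_biUnion.2 ⟨w, Finset.mem_univ _,
      Finset.mem_product.2 ⟨key _ hu hwu, key _ hv hwv⟩⟩
  refine (Finset.card_le_card hsub).trans (Finset.card_biUnion_le.trans ?_)
  calc _ ≤ ∑ _w : Fin n, (1 + m) ^ (2 * K) := by
        refine Finset.sum_le_sum fun w _ => ?_
        rw [Finset.card_product, two_mul, pow_add]
        exact Nat.mul_le_mul (card_ball_lowDegreeGraph_le σ m w K)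
          (card_ball_lowDegreeGraph_le σ m w K)
    _ = _ := by simp

theorem card_ball_le_prod {σ : Pairing d} {y : ℕ → ℝ} {K : ℕ} {u : Fin n}
    (hu : ¬ HighDegree σ y K u) (k : ℕ) (hk : k ≤ K) :
    ((ball (erasedGraph σ) u k).card : ℝ) ≤ ∏ j ∈ Finset.range k, (1 + y j) := by
  classical
  induction k with
  | zero =>
    simp only [Finset.range_zero, Finset.prod_empty]
    have : (ball (erasedGraph σ) u 0).card ≤ 1 := by
      refine Finset.card_le_one.2 fun a ha b hb => ?_
      rw [mem_ball_zero] at ha hb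
      rw [ha, hb]
    exact_mod_cast this
  | succ k ih =>
    have hdeg : ∀ z ∈ ball (erasedGraph σ) u k, (pairedDegree d z : ℝ) ≤ y k := fun z hz => by
      by_contra hcon
      exact hu ⟨k, by omega, z, hz, not_le.1 hcon⟩
    have hy0 : 0 ≤ y k := le_trans (Nat.cast_nonneg _) (hdeg u (self_mem_ball u k))
    have h1 := card_ball_succ_le (G := erasedGraph σ) (x := u) (k := k) (m := ⌊y k⌋₊)
      fun z hz => (card_neighbors_le σ z _ fun y hy => (Finset.mem_filter.1 hy).2).trans
        (Nat.le_floor (hdeg z hz))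
    rw [Finset.prod_range_succ]
    have h2 := Nat.floor_le hy0
    calc ((ball (erasedGraph σ) u (k + 1)).card : ℝ)
        ≤ (ball (erasedGraph σ) u k).card * (1 + (⌊y k⌋₊ : ℝ)) := by exact_mod_cast h1
      _ ≤ _ := mul_le_mul (ih (by omega)) (by linarith) (by positivity)
          (le_trans (Nat.cast_nonneg _) (ih (by omega)))

/-- Some edge that leaves a ball of radius `k < K` around `u` is cheaper than `h k`. -/
def CheapExit (σ : Pairing d) (s : Selection d) (h : ℕ → ℝ) (K : ℕ) (u : Fin n) :
    Set (PotentialEdge d → ℝ) :=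
  {w | ∃ k < K, ∃ x ∈ ball (erasedGraph σ) u k, ∃ y, (erasedGraph σ).Adj x y ∧
    edgeWeight σ s w s(x, y) < h k}

/-- Union bound over all edges at vertices of the ball of radius `k`: the degree bounds limit both
the size of the ball and the number of edges at each of its vertices. -/
theorem pi_cheapExit_le {ν : Measure ℝ} [IsProbabilityMeasure ν] {σ : Pairing d} (s : Selection d)
    {y h ξ : ℕ → ℝ} (hξ : ∀ k, ν.real (Set.Iio (h k)) ≤ ξ k) {K : ℕ} {u : Fin n}
    (hu : ¬ HighDegree σ y K u) :
    (Measure.pi fun _ : PotentialEdge d => ν).real (CheapExit σ s h K u) ≤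
      ∑ k ∈ Finset.range K, (∏ j ∈ Finset.range k, (1 + y j)) * y k * ξ k := by
  classical
  set μ := Measure.pi fun _ : PotentialEdge d => ν
  have hsub : CheapExit σ s h K u ⊆ ⋃ k ∈ Finset.range K, ⋃ x ∈ ball (erasedGraph σ) u k,
      ⋃ z ∈ Finset.univ.filter (fun z => (erasedGraph σ).Adj x z),
        {w | edgeWeight σ s w s(x, z) < h k} := by
    rintro w ⟨k, hk, x, hx, z, hz, hw⟩
    simp only [Set.mem_iUnion]
    exact ⟨k, Finset.mem_range.2 hk, x, hx, z, by simpa using hz, hw⟩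
  refine (measureReal_mono hsub (measure_ne_top _ _)).trans ((measureReal_biUnion_finset_le _ _).trans ?_)
  refine Finset.sum_le_sum fun k hk => ?_
  rw [Finset.mem_range] at hk
  have hξ0 : 0 ≤ ξ k := measureReal_nonneg.trans (hξ k)
  have hdeg : ∀ z ∈ ball (erasedGraph σ) u k, (pairedDegree d z : ℝ) ≤ y k := fun z hz => by
    by_contra hcon
    exact hu ⟨k, hk.le, z, hz, not_le.1 hcon⟩
  have hy0 : 0 ≤ y k := le_trans (Nat.cast_nonneg _) (hdeg u (self_mem_ball u k))
  refine (measureReal_biUnion_finset_le _ _).trans ?_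
  calc _ ≤ ∑ x ∈ ball (erasedGraph σ) u k, y k * ξ k := by
        refine Finset.sum_le_sum fun x hx => (measureReal_biUnion_finset_le _ _).trans ?_
        calc _ ≤ ∑ z ∈ Finset.univ.filter (fun z => (erasedGraph σ).Adj x z), ξ k := by
              refine Finset.sum_le_sum fun z hz => ?_
              rw [measureReal_def, pi_edgeWeight_lt ν s σ (p := s(x, z)) (Finset.mem_filter.1 hz).2]
              exact hξ k
          _ ≤ _ := by
              rw [Finset.sum_const, nsmul_eq_mul]
              gcongr
              refine le_trans ?_ (hdeg x hx)
              exact_mod_cast card_neighbors_le σ x _ fun y hy => (Finset.mem_filter.1 hy).2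
    _ ≤ _ := by
        rw [Finset.sum_const, nsmul_eq_mul, mul_assoc]
        gcongr
        exact card_ball_le_prod hu k hk.le

/-- Lower bound for weighted and unweighted distances between two uniform vertices. -/
theorem law_short_path_le {ν : Measure ℝ} [IsProbabilityMeasure ν] (hν : ν (Set.Iio 0) = 0)
    (hn : 0 < n) {y s b h ξ : ℕ → ℝ} (hy : Monotone y)
    (hs : ∀ j, 2 / (Fintype.card (HalfEdge d) : ℝ) *
      ∑ z with (pairedDegree d z : ℝ) ≤ y j, (pairedDegree d z : ℝ) ^ 2 ≤ s j)
    (hb : ∀ j, 2 / (Fintype.card (HalfEdge d) : ℝ) *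
      ∑ z with y j < (pairedDegree d z : ℝ), (pairedDegree d z : ℝ) ≤ b j) {K m : ℕ}
    (hK : 4 * K ≤ Fintype.card (HalfEdge d)) (hm : ∀ k ≤ K, y k ≤ m)
    (hh : ∀ k, 0 ≤ h k) (hξ : ∀ k, ν.real (Set.Iio (h k)) ≤ ξ k) (hy0 : 0 ≤ y 0) :
    law d ν {ω | ¬ ((∀ p : ω.graph.Walk ω.u ω.v,
        2 * ∑ k ∈ Finset.range K, h k ≤ walkWeight ω.weight p) ∧
        ∀ p : ω.graph.Walk ω.u ω.v, 2 * K ≤ p.length)} ≤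
      ENNReal.ofReal (2 * (((Finset.univ.filter fun z => y 0 < (pairedDegree d z : ℝ)).card +
        Fintype.card (HalfEdge d) * ∑ k ∈ Finset.range K,
          (∏ j ∈ Finset.Ico 1 (k + 1), s j) * b (k + 1)) / n) + (1 + m : ℝ) ^ (2 * K) / n +
        2 * ∑ k ∈ Finset.range K, (∏ j ∈ Finset.range k, (1 + y j)) * y k * ξ k) := by
  classical
  set μ := Measure.pi fun _ : PotentialEdge d => ν
  set β := ((Finset.univ.filter fun z => y 0 < (pairedDegree d z : ℝ)).card +
        Fintype.card (HalfEdge d) * ∑ k ∈ Finset.range K,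
          (∏ j ∈ Finset.Ico 1 (k + 1), s j) * b (k + 1)) with hβ
  set ω₁ := ∑ k ∈ Finset.range K, (∏ j ∈ Finset.range k, (1 + y j)) * y k * ξ k with hω₁
  have hyk : ∀ k, 0 ≤ y k := fun k => hy0.trans (hy (Nat.zero_le k))
  have hω₁0 : 0 ≤ ω₁ := Finset.sum_nonneg fun k _ => by
    have h1 : 0 ≤ ξ k := measureReal_nonneg.trans (hξ k)
    have h2 : 0 ≤ ∏ j ∈ Finset.range k, (1 + y j) :=
      Finset.prod_nonneg fun j _ => by linarith [hyk j]
    have h3 := hyk k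
    positivity
  have hn' : (0 : ℝ) < n := by exact_mod_cast hn
  let close : Pairing d → Fin n × Fin n → Prop := fun σ uv =>
    ¬ HighDegree σ y K uv.1 ∧ ¬ HighDegree σ y K uv.2 ∧
      ∃ w ∈ ball (erasedGraph σ) uv.1 K, w ∈ ball (erasedGraph σ) uv.2 K
  let gbad : Pairing d → Fin n × Fin n → Prop := fun σ uv =>
    HighDegree σ y K uv.1 ∨ HighDegree σ y K uv.2 ∨ close σ uv
  -- For a bad pairing all weights are counted as bad. Otherwise only negative weights, a null
  -- event, and cheap exits around one of the two vertices can spoil the bound.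
  refine law_le_of_average (F := fun σ s uv => if gbad σ uv then Set.univ else
    {w | ∃ e, w e < 0} ∪ (CheapExit σ s h K uv.1 ∪ CheapExit σ s h K uv.2)) ?_ ?_
  · rintro ⟨σ, s, w, u, v⟩ hω
    by_cases hg : gbad σ (u, v)
    · simp [hg]
    simp only [if_neg hg]
    by_contra hcon
    simp only [Set.mem_union, Set.mem_ofPred_eq, not_or, not_exists, not_lt] at hcon
    obtain ⟨hw, hcu, hcv⟩ := hcon
    simp only [gbad, close, not_or, not_and, not_exists] at hg
    have hdisj : ∀ x ∈ ball (erasedGraph σ) u K, x ∉ ball (erasedGraph σ) v K :=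
      fun x hx hx' => hg.2.2 hg.1 hg.2.1 x hx hx'
    have hexit : ∀ u, w ∉ CheapExit σ s h K u → ∀ k < K, ∀ x ∈ ball (erasedGraph σ) u k, ∀ y,
        y ∉ ball (erasedGraph σ) u k → (erasedGraph σ).Adj x y →
        h k ≤ edgeWeight σ s w s(x, y) := by
      intro u hu k hk x hx y _ hadj
      by_contra hlt
      exact hu ⟨k, hk, x, hx, y, hadj, not_le.1 hlt⟩
    exact hω ⟨fun p => two_mul_sum_le_walkWeight (W := edgeWeight σ s w) hh (edgeWeight_nonneg hw)
      (hexit u hcu) (hexit v hcv) hdisj p, fun p => two_mul_le_length hdisj p⟩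
  · intro s'
    have hterm : ∀ σ uv, μ.real (if gbad σ uv then Set.univ else
        {w | ∃ e, w e < 0} ∪ (CheapExit σ s' h K uv.1 ∪ CheapExit σ s' h K uv.2)) ≤
        (if HighDegree σ y K uv.1 then 1 else 0) + (if HighDegree σ y K uv.2 then 1 else 0) +
          (if close σ uv then 1 else 0) + 2 * ω₁ := by
      intro σ uv
      by_cases hg : gbad σ uv
      · rw [if_pos hg]
        refine measureReal_le_one.trans ?_
        have i1 : (0 : ℝ) ≤ if HighDegree σ y K uv.1 then 1 else 0 := by split_ifs <;> simp
        have i2 : (0 : ℝ) ≤ if HighDegree σ y K uv.2 then 1 else 0 := by split_ifs <;> simp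
        have i3 : (0 : ℝ) ≤ if close σ uv then 1 else 0 := by split_ifs <;> simp
        rcases hg with hg | hg | hg
        · rw [if_pos hg]; linarith
        · rw [if_pos hg]; linarith
        · rw [if_pos hg]; linarith
      · rw [if_neg hg]
        simp only [gbad, not_or] at hg
        rw [if_neg hg.1, if_neg hg.2.1, if_neg hg.2.2]
        have h0 : μ.real {w | ∃ e, w e < 0} = 0 := by
          rw [measureReal_def, pi_exists_neg hν, ENNReal.toReal_zero]
        have h1 := pi_cheapExit_le s' hξ hg.1
        have h2 := pi_cheapExit_le s' hξ hg.2.1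
        refine (measureReal_union_le _ _).trans ?_
        rw [h0]
        have := measureReal_union_le (μ := μ) (CheapExit σ s' h K uv.1) (CheapExit σ s' h K uv.2)
        linarith
    have hH := sum_highDegree_le hy hs hb hK
    have hclose : ∀ σ : Pairing d, ∑ uv, (if close σ uv then (1 : ℝ) else 0) ≤
        n * (1 + m : ℝ) ^ (2 * K) := by
      intro σ
      rw [Finset.sum_ite, Finset.sum_const_zero, add_zero, Finset.sum_const, nsmul_one]
      exact_mod_cast card_close_pairs_le σ hm
    have hfst : ∀ σ : Pairing d, ∑ uv : Fin n × Fin n,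
        (if HighDegree σ y K uv.1 then (1 : ℝ) else 0) =
        n * ∑ u, (if HighDegree σ y K u then (1 : ℝ) else 0) := by
      intro σ
      have hgen : ∀ f : Fin n → ℝ, ∑ uv : Fin n × Fin n, f uv.1 = n * ∑ u, f u := by
        intro f
        rw [Fintype.sum_prod_type]
        simp [Finset.mul_sum]
      exact hgen fun u => if HighDegree σ y K u then 1 else 0
    have hsnd : ∀ σ : Pairing d, ∑ uv : Fin n × Fin n,
        (if HighDegree σ y K uv.2 then (1 : ℝ) else 0) =
        n * ∑ u, (if HighDegree σ y K u then (1 : ℝ) else 0) := by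
      intro σ
      have hgen : ∀ f : Fin n → ℝ, ∑ uv : Fin n × Fin n, f uv.2 = n * ∑ u, f u := by
        intro f
        rw [Fintype.sum_prod_type]
        simp
      exact hgen fun u => if HighDegree σ y K u then 1 else 0
    calc _ ≤ ∑ σ : Pairing d, (2 * n * (∑ u, (if HighDegree σ y K u then (1 : ℝ) else 0)) +
          (n * (1 + m : ℝ) ^ (2 * K) + (n : ℝ) ^ 2 * (2 * ω₁))) := by
          refine Finset.sum_le_sum fun σ _ => ?_
          refine (Finset.sum_le_sum fun uv _ => hterm σ uv).trans ?_
          simp only [Finset.sum_add_distrib]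
          rw [hfst, hsnd, Finset.sum_const, Finset.card_univ, Fintype.card_prod, Fintype.card_fin,
            nsmul_eq_mul]
          have := hclose σ
          push_cast
          linarith
      _ ≤ 2 * n * (β * Fintype.card (Pairing d)) + Fintype.card (Pairing d) *
          (n * (1 + m : ℝ) ^ (2 * K) + (n : ℝ) ^ 2 * (2 * ω₁)) := by
          rw [Finset.sum_add_distrib, ← Finset.mul_sum, Finset.sum_const, Finset.card_univ,
            nsmul_eq_mul]
          gcongr
      _ = _ := by
          field_simp
          ring

end LowerBound

/-! ### Upper bound for a fixed number of vertices -/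

section UpperBound

variable {n : ℕ} {d : Fin n → ℕ}

theorem sum_le_of_condAvg_le {φ : Pairing d → ℝ} {c : ℝ} (h : ∀ τ, condAvg τ ∅ φ ≤ c) :
    ∑ σ, φ σ ≤ c * Fintype.card (Pairing d) := by
  rcases isEmpty_or_nonempty (Pairing d) with he | ⟨⟨τ⟩⟩
  · simp
  · have := h τ
    rwa [condAvg_le_iff, cyl_empty, Finset.card_univ] at this

/-- Existence of cheap short paths between two vertices: the search starts with at most `t₀` steps
of cost `M` to a vertex of degree at least `Y 0`, continues with `N` stages through the degree
thresholds `Y i`, and ends with an edge to the hub. -/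
theorem law_no_cheap_path_le {ν : Measure ℝ} [IsProbabilityMeasure ν] (hν : ν (Set.Iio 0) = 0)
    {hub : Fin n} (hdeg : ∀ x, 2 ≤ pairedDegree d x) {M : ℝ} (hM : 0 ≤ M) {N : ℕ}
    {Y c q p : ℕ → ℝ} {j r : ℕ → ℕ} {R jhub t₀ : ℕ} {p₀ κ : ℝ}
    (hY0 : 0 ≤ Y 0) (hc : ∀ i < N, 0 ≤ c i) (hY : ∀ i < N, Y i ≤ Y (i + 1))
    (hj : ∀ i < N, (2 * j i + 1 : ℝ) ≤ Y i)
    (hq0 : ∀ i < N, 0 ≤ q i) (hq : ∀ i < N, q i ≤ ν.real (Set.Iic (c i)))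
    (hp0 : ∀ i < N, 0 ≤ p i) (hp1 : ∀ i < N, p i ≤ 1)
    (hp : ∀ i < N, ∀ A : Finset (Fin n),
      (A ∩ Finset.univ.filter fun z => Y (i + 1) ≤ pairedDegree d z).card ≤ R →
      p i * Fintype.card (HalfEdge d) ≤
        ∑ z ∈ (Finset.univ.filter fun z => Y (i + 1) ≤ pairedDegree d z) \ A,
          (pairedDegree d z : ℝ))
    (hR : 2 + ∑ k ∈ Finset.range N, r k ≤ R)
    (hp₀ : 0 ≤ p₀) (hp₀1 : p₀ ≤ 1) (hκ : 0 ≤ κ)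
    (hstart : p₀ * Fintype.card (HalfEdge d) ≤
      ∑ z ∈ (Finset.univ.filter fun z => Y 0 ≤ pairedDegree d z).erase hub,
        (pairedDegree d z : ℝ))
    (hκ' : pairedDegree d hub + (t₀ + 1) * Y 0 ≤
      κ * (Fintype.card (HalfEdge d) - 1 - (pairedDegree d hub + (t₀ + 1) * Y 0)))
    (hjhub : (2 * jhub : ℝ) ≤ Y N) :
    law d ν {ω | ¬ ∃ p : ω.graph.Path ω.u ω.v,
        walkWeight ω.weight p.1 ≤ 2 * (t₀ * M + (∑ k ∈ Finset.range N, c k + M)) ∧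
        p.1.length ≤ 2 * (t₀ + (N + 1))} ≤
      ENNReal.ofReal (2 * ((1 - p₀) ^ t₀ + t₀ * (ν.real (Set.Ioi M) + κ) +
        (∑ k ∈ Finset.range N, ((1 - p k * q k) ^ j k + (1 - q k) ^ r k) + ν.real (Set.Ioi M))) +
        n * (1 - (pairedDegree d hub : ℝ) / Fintype.card (HalfEdge d)) ^ jhub) := by
  classical
  set θ := ∑ k ∈ Finset.range N, ((1 - p k * q k) ^ j k + (1 - q k) ^ r k) + ν.real (Set.Ioi M)
    with hθ
  set S : Set (Fin n) := {z | Y N ≤ pairedDegree d z} with hS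
  -- The hub is forbidden from the start, so the explorations use it only as the common final
  -- vertex.
  set E : Pairing d → Fin n → Set (Sym2 (Fin n) → ℝ) := fun σ x =>
    preStage (erasedGraph σ) M (stageEvent (erasedGraph σ) hub S M c N 0) t₀ x {hub} with hE
  set μ := Measure.pi fun _ : PotentialEdge d => ν with hμ
  set ηhub := (1 - (pairedDegree d hub : ℝ) / Fintype.card (HalfEdge d)) ^ jhub with hηhub
  set η := (1 - p₀) ^ t₀ + t₀ * (ν.real (Set.Ioi M) + κ) + θ with hη
  have hθ0 : 0 ≤ θ := by
    refine add_nonneg (Finset.sum_nonneg fun k hk => ?_) measureReal_nonneg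
    rw [Finset.mem_range] at hk
    have h1 : q k ≤ 1 := (hq k hk).trans measureReal_le_one
    have h2 := hp1 k hk
    have h3 := hp0 k hk
    have h4 := hq0 k hk
    have h5 : 0 ≤ 1 - p k * q k := by nlinarith
    have h6 : 0 ≤ 1 - q k := by linarith
    positivity
  have hη0 : 0 ≤ η := by
    have h1 : 0 ≤ 1 - p₀ := by linarith
    have h2 : 0 ≤ ν.real (Set.Ioi M) := measureReal_nonneg
    positivity
  have hEmeas : ∀ σ x, MeasurableSet (E σ x) := fun σ x =>
    (preStage_avoiding (erasedGraph σ) hub M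
      (stageEvent_avoiding (erasedGraph σ) hub S M c N 0) t₀).meas x {hub}
  have hfail : ∀ (s : Selection d) (x : Fin n), x ≠ hub → ∀ τ,
      condAvg τ ∅ (fun σ => (weightLaw ν s σ).real (E σ x)ᶜ) ≤ η := by
    intro s x hx τ
    refine condAvg_preStage_compl_le (fun σ => weightLaw_edgeLaw ν s σ) hdeg hM
      (P := fun σ => stageEvent (erasedGraph σ) hub S M c N 0) (t₀ := t₀) hp₀ hp₀1 hκ hθ0 hY0 ?_
      hstart hκ' t₀ τ ∅ x {hub} ⟨closed_empty τ, by simp, by simpa using hx, by simp⟩ (by simp)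
      (by simp) (by simp)
    intro τ' Θ z A hs hz hfree hcard
    have := condAvg_stageEvent_compl_le (fun σ => weightLaw_edgeLaw ν s σ) hM hY hj hq0 hq hp0
      hp1 hp hR N 0 (zero_add N) τ' Θ z A hs hz hfree (by simpa using hcard)
    rwa [Nat.Ico_zero_eq_range] at this
  -- This event concerns the pairing only. It is removed by a union bound over all vertices, without
  -- revealing anything in the exploration.
  let nohub : Pairing d → Prop := fun σ => ∃ a ∈ S, a ≠ hub ∧ ¬ (erasedGraph σ).Adj a hub
  have hnohub : ∑ σ, (if nohub σ then (1 : ℝ) else 0) ≤ n * ηhub * Fintype.card (Pairing d) := by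
    refine sum_le_of_condAvg_le fun τ => ?_
    have hdeg_le : (pairedDegree d hub : ℝ) / Fintype.card (HalfEdge d) ≤ 1 := by
      refine div_le_one_of_le₀ ?_ (Nat.cast_nonneg _)
      rw [card_halfEdge]
      exact_mod_cast Finset.single_le_sum (f := fun x => pairedDegree d x) (by simp)
        (Finset.mem_univ hub)
    have hηhub0 : 0 ≤ ηhub := pow_nonneg (by linarith) _
    calc condAvg τ ∅ (fun σ => if nohub σ then (1 : ℝ) else 0)
        ≤ condAvg τ ∅ (fun σ => ∑ a ∈ Finset.univ.filter (fun a => a ∈ S ∧ a ≠ hub),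
          if (erasedGraph σ).Adj a hub then 0 else 1) := by
          refine condAvg_mono fun σ _ => ?_
          have hnn : ∀ a ∈ Finset.univ.filter (fun a => a ∈ S ∧ a ≠ hub),
              (0 : ℝ) ≤ if (erasedGraph σ).Adj a hub then 0 else 1 := fun a _ => by
            split_ifs <;> simp
          by_cases h : nohub σ
          · rw [if_pos h]
            obtain ⟨a, ha, hah, hadj⟩ := h
            refine le_trans (le_of_eq ?_) (Finset.single_le_sum hnn
              (Finset.mem_filter.2 ⟨Finset.mem_univ a, ha, hah⟩))
            rw [if_neg hadj]
          · rw [if_neg h]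
            exact Finset.sum_nonneg hnn
      _ = _ := condAvg_sum _ _ _ _
      _ ≤ ∑ a ∈ Finset.univ.filter (fun a => a ∈ S ∧ a ≠ hub), ηhub := by
          refine Finset.sum_le_sum fun a ha => ?_
          obtain ⟨haS, hah⟩ := (Finset.mem_filter.1 ha).2
          have := condAvg_not_adj_le hah jhub τ ∅ (closed_empty τ) (by simp) (by
            rw [Finset.sdiff_empty, card_halfEdgesAt]
            have : (2 * jhub : ℝ) ≤ pairedDegree d a := hjhub.trans haS
            exact_mod_cast this)
          refine le_trans (le_of_eq ?_) this
          congr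
      _ ≤ n * ηhub := by
          rw [Finset.sum_const, nsmul_eq_mul]
          gcongr
          exact (Finset.card_le_univ _).trans_eq (Fintype.card_fin n)
  refine law_le_of_average (F := fun σ s uv => if nohub σ then Set.univ else
    {w | ∃ e, w e < 0} ∪ ({w | uv.1 ≠ hub ∧ edgeWeight σ s w ∉ E σ uv.1} ∪
      {w | uv.2 ≠ hub ∧ edgeWeight σ s w ∉ E σ uv.2})) ?_ ?_
  · rintro ⟨σ, s, w, u, v⟩ hω
    by_cases hg : nohub σ
    · simp [hg]
    simp only [if_neg hg]
    by_contra hcon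
    simp only [Set.mem_union, Set.mem_ofPred_eq, not_or, not_exists, not_lt, not_and,
      not_not] at hcon
    obtain ⟨hw, hcu, hcv⟩ := hcon
    have hSadj : ∀ a ∈ S, a ≠ hub → (erasedGraph σ).Adj a hub := by
      intro a ha hah
      by_contra hadj
      exact hg ⟨a, ha, hah, hadj⟩
    have hL : 0 ≤ t₀ * M + (∑ k ∈ Finset.range N, c k + M) := by
      have : 0 ≤ ∑ k ∈ Finset.range N, c k :=
        Finset.sum_nonneg fun k hk => hc k (Finset.mem_range.1 hk)
      positivity
    have hwalk : ∀ x, (x ≠ hub → edgeWeight σ s w ∈ E σ x) →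
        ∃ p : (erasedGraph σ).Walk x hub, p.length ≤ t₀ + (N + 1) ∧
          walkWeight (edgeWeight σ s w) p ≤ t₀ * M + (∑ k ∈ Finset.range N, c k + M) := by
      intro x hx
      -- The exploration cannot start at a forbidden vertex, but at the hub itself the empty walk
      -- suffices.
      by_cases hxh : x = hub
      · subst hxh
        exact ⟨SimpleGraph.Walk.nil, by simp, by simpa [walkWeight] using hL⟩
      refine exists_walk_of_preStage hM (fun z A hz hA hW => ?_) t₀ x {hub} hxh (by simp) (hx hxh)
      obtain ⟨p, hp1, hp2⟩ := exists_walk_of_stageEvent hSadj N 0 z A hz hA hW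
      refine ⟨p, hp1.le, ?_⟩
      rwa [zero_add, Nat.Ico_zero_eq_range] at hp2
    obtain ⟨p₁, hl₁, hw₁⟩ := hwalk u hcu
    obtain ⟨p₂, hl₂, hw₂⟩ := hwalk v hcv
    have hpath : ∃ p : (erasedGraph σ).Path u v, walkWeight (edgeWeight σ s w) p.1 ≤
        2 * (t₀ * M + (∑ k ∈ Finset.range N, c k + M)) ∧ p.1.length ≤ 2 * (t₀ + (N + 1)) := by
      refine ⟨⟨(p₁.append p₂.reverse).bypass, SimpleGraph.Walk.bypass_isPath _⟩, ?_, ?_⟩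
      · refine (walkWeight_bypass_le (edgeWeight_nonneg hw) _).trans ?_
        rw [walkWeight_append, walkWeight_reverse]
        linarith
      · refine (SimpleGraph.Walk.length_bypass_le_length _).trans ?_
        rw [SimpleGraph.Walk.length_append, SimpleGraph.Walk.length_reverse]
        omega
    exact hω hpath
  · intro s
    have hreal : ∀ σ x, μ.real {w | x ≠ hub ∧ edgeWeight σ s w ∉ E σ x} =
        if x = hub then 0 else (weightLaw ν s σ).real (E σ x)ᶜ := by
      intro σ x
      split_ifs with hx
      · simp [hx]
      · rw [weightLaw_real_apply ν s σ (hEmeas σ x).compl]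
        simp only [ne_eq, hx, not_false_eq_true, true_and]
        rfl
    have hterm : ∀ σ (uv : Fin n × Fin n), μ.real (if nohub σ then Set.univ else
        {w | ∃ e, w e < 0} ∪ ({w | uv.1 ≠ hub ∧ edgeWeight σ s w ∉ E σ uv.1} ∪
          {w | uv.2 ≠ hub ∧ edgeWeight σ s w ∉ E σ uv.2})) ≤
        (if nohub σ then 1 else 0) +
          ((if uv.1 = hub then 0 else (weightLaw ν s σ).real (E σ uv.1)ᶜ) +
          (if uv.2 = hub then 0 else (weightLaw ν s σ).real (E σ uv.2)ᶜ)) := by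
      intro σ uv
      rw [← hreal, ← hreal]
      split_ifs
      · refine measureReal_le_one.trans ?_
        have := measureReal_nonneg (μ := μ) (s := {w | uv.1 ≠ hub ∧ edgeWeight σ s w ∉ E σ uv.1})
        have := measureReal_nonneg (μ := μ) (s := {w | uv.2 ≠ hub ∧ edgeWeight σ s w ∉ E σ uv.2})
        linarith
      · have h0 : μ.real {w | ∃ e, w e < 0} = 0 := by
          rw [measureReal_def, pi_exists_neg hν, ENNReal.toReal_zero]
        refine (measureReal_union_le _ _).trans ?_
        rw [h0]
        exact add_le_add le_rfl (measureReal_union_le _ _)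
    have hsum : ∀ x : Fin n, ∑ σ : Pairing d,
        (if x = hub then 0 else (weightLaw ν s σ).real (E σ x)ᶜ) ≤
        η * Fintype.card (Pairing d) := by
      intro x
      split_ifs with hx
      · simp only [Finset.sum_const_zero]; positivity
      · exact sum_le_of_condAvg_le (hfail s x hx)
    calc _ ≤ ∑ σ : Pairing d, ∑ uv : Fin n × Fin n, ((if nohub σ then (1 : ℝ) else 0) +
          ((if uv.1 = hub then 0 else (weightLaw ν s σ).real (E σ uv.1)ᶜ) +
          (if uv.2 = hub then 0 else (weightLaw ν s σ).real (E σ uv.2)ᶜ))) :=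
          Finset.sum_le_sum fun σ _ => Finset.sum_le_sum fun uv _ => hterm σ uv
      _ = ∑ uv : Fin n × Fin n, (∑ σ : Pairing d, (if nohub σ then (1 : ℝ) else 0) +
          (∑ σ : Pairing d, (if uv.1 = hub then 0 else (weightLaw ν s σ).real (E σ uv.1)ᶜ) +
          ∑ σ : Pairing d, (if uv.2 = hub then 0 else (weightLaw ν s σ).real (E σ uv.2)ᶜ))) := by
          rw [Finset.sum_comm]
          simp only [Finset.sum_add_distrib]
      _ ≤ ∑ _uv : Fin n × Fin n, (n * ηhub * Fintype.card (Pairing d) +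
          (η * Fintype.card (Pairing d) + η * Fintype.card (Pairing d))) :=
          Finset.sum_le_sum fun uv _ => add_le_add hnohub (add_le_add (hsum _) (hsum _))
      _ = _ := by
          rw [Finset.sum_const, Finset.card_univ, Fintype.card_prod, Fintype.card_fin,
            nsmul_eq_mul]
          push_cast
          ring

end UpperBound

/-! ### Consequences of the assumptions on the degrees -/

section Tails

/-- Since `γ < 1`, the correction factor of the power law is smaller than any positive power, up to
a constant. -/
theorem exists_exp_rpow_log_le {C γ η : ℝ} (hC : 0 < C) (hγ : 0 < γ) (hγ1 : γ < 1) (hη : 0 < η) :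
    ∃ A : ℝ, 1 ≤ A ∧ ∀ x : ℝ, 1 ≤ x → Real.exp (C * (Real.log x) ^ γ) ≤ A * x ^ η := by
  -- From `t = T` on, `C * t ^ γ ≤ η * t`; below `T` the constant absorbs everything.
  set T : ℝ := (C / η) ^ (1 / (1 - γ)) with hT
  have hT0 : 0 ≤ T := by positivity
  refine ⟨Real.exp (C * T ^ γ), Real.one_le_exp (by positivity), fun x hx => ?_⟩
  have hx0 : 0 < x := by linarith
  have ht : 0 ≤ Real.log x := Real.log_nonneg hx
  set t := Real.log x
  rw [Real.rpow_def_of_pos hx0, ← Real.exp_add]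
  apply Real.exp_le_exp.2
  rcases le_total t T with h | h
  · have : t ^ γ ≤ T ^ γ := Real.rpow_le_rpow ht h hγ.le
    have : 0 ≤ t * η := by positivity
    nlinarith
  · have h1 : C / η ≤ t ^ (1 - γ) := by
      have h2 : T ^ (1 - γ) ≤ t ^ (1 - γ) := Real.rpow_le_rpow hT0 h (by linarith)
      rwa [hT, ← Real.rpow_mul (by positivity), one_div_mul_cancel (by linarith),
        Real.rpow_one] at h2
    have h3 : C * t ^ γ ≤ η * t := by
      rcases ht.eq_or_lt with h0 | h0
      · rw [← h0, Real.zero_rpow hγ.ne']; simp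
      · have h4 : t = t ^ (1 - γ) * t ^ γ := by
          rw [← Real.rpow_add h0]; simp
        rw [div_le_iff₀ hη] at h1
        calc C * t ^ γ ≤ t ^ (1 - γ) * η * t ^ γ := by gcongr
          _ = η * (t ^ (1 - γ) * t ^ γ) := by ring
          _ = η * t := by rw [← h4]
    have : 0 ≤ C * T ^ γ := by positivity
    linarith

theorem sum_Ico_rpow_le {c : ℝ} (hc : 0 < c) (hc1 : c ≠ 1) {y N : ℕ} (hy : 1 ≤ y) (hN : y ≤ N) :
    ∑ s ∈ Finset.Ico y N, ((s + 1 : ℕ) : ℝ) ^ (-c) ≤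
      ((N : ℝ) ^ (1 - c) - (y : ℝ) ^ (1 - c)) / (1 - c) := by
  have hy' : (0 : ℝ) < y := by exact_mod_cast hy
  have hN' : (y : ℝ) ≤ N := by exact_mod_cast hN
  have h := AntitoneOn.sum_le_integral_Ico (f := fun x : ℝ => x ^ (-c)) hN (fun a ha b hb hab => by
    exact Real.rpow_le_rpow_of_nonpos (hy'.trans_le ha.1) hab (by linarith))
  refine h.trans (le_of_eq ?_)
  rw [integral_rpow]
  · rw [show -c + 1 = 1 - c by ring]
  · refine Or.inr ⟨fun h => hc1 (by linarith), ?_⟩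
    rw [Set.uIcc_of_le hN']
    exact fun h => hy'.not_ge h.1

variable {n : ℕ} {d : Fin n → ℕ}

/-- Number of vertices of degree larger than `x`. -/
def countAbove (d : Fin n → ℕ) (x : ℝ) : ℝ :=
  ((Finset.univ.filter fun v => x < (d v : ℝ)).card : ℝ)

theorem countAbove_nonneg (d : Fin n → ℕ) (x : ℝ) : 0 ≤ countAbove d x := Nat.cast_nonneg _

theorem countAbove_eq (hn : 0 < n) (x : ℝ) : countAbove d x = n * (1 - empiricalCDF d x) := by
  have h := Finset.card_filter_add_card_filter_not (s := (Finset.univ : Finset (Fin n)))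
    (fun v => (d v : ℝ) ≤ x)
  simp only [not_le, Finset.card_univ, Fintype.card_fin] at h
  have hn' : (n : ℝ) ≠ 0 := by positivity
  unfold countAbove empiricalCDF
  rw [mul_sub, mul_one, mul_div_cancel₀ _ hn']
  have : ((Finset.univ.filter fun v => (d v : ℝ) ≤ x).card : ℝ) +
    ((Finset.univ.filter fun v => x < (d v : ℝ)).card : ℝ) = n := by exact_mod_cast h
  linarith

theorem sum_countAbove (s : Finset ℕ) (f : ℕ → ℝ) :
    ∑ k ∈ s, f k * countAbove d k = ∑ v, ∑ k ∈ s with k < d v, f k := by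
  simp only [Finset.sum_filter, countAbove, Nat.cast_lt]
  rw [Finset.sum_comm]
  refine Finset.sum_congr rfl fun k _ => ?_
  rw [Finset.sum_ite, Finset.sum_const_zero, add_zero, Finset.sum_const, nsmul_eq_mul, mul_comm]

/-- Summation by layers: a degree above `y` splits into `y` and the number of levels in `[y, N)`
that it exceeds. -/
theorem sum_degree_between_le (y N : ℕ) :
    ∑ v with y < d v ∧ d v ≤ N, (d v : ℝ) ≤
      y * countAbove d y + ∑ k ∈ Finset.Ico y N, countAbove d k := by
  have h1 : ∑ k ∈ Finset.Ico y N, countAbove d k =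
      ∑ v, ∑ k ∈ Finset.Ico y N with k < d v, (1 : ℝ) := by
    rw [← sum_countAbove]; simp
  have h2 : (y : ℝ) * countAbove d y = ∑ v, if y < d v then (y : ℝ) else 0 := by
    rw [Finset.sum_ite, Finset.sum_const_zero, add_zero, Finset.sum_const, nsmul_eq_mul, mul_comm]
    simp [countAbove]
  rw [h1, h2, ← Finset.sum_add_distrib, Finset.sum_filter]
  refine Finset.sum_le_sum fun v _ => ?_
  split_ifs with h h' h'
  · have : (Finset.Ico y N).filter (fun k => k < d v) = Finset.Ico y (d v) := by
      ext k; simp only [Finset.mem_filter, Finset.mem_Ico]; omega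
    rw [this, Finset.sum_const, Nat.card_Ico, nsmul_one, Nat.cast_sub h.1.le]
    linarith
  · exact absurd h.1 h'
  · positivity
  · positivity

theorem sum_degree_sq_le (m : ℕ) :
    ∑ v with d v ≤ m, (d v : ℝ) ^ 2 ≤
      ∑ k ∈ Finset.range m, (2 * k + 1 : ℝ) * countAbove d k := by
  rw [sum_countAbove, Finset.sum_filter]
  refine Finset.sum_le_sum fun v _ => ?_
  split_ifs with h
  · have : (Finset.range m).filter (fun k => k < d v) = Finset.range (d v) := by
      ext k; simp only [Finset.mem_filter, Finset.mem_range]; omega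
    rw [this]
    have key : ∀ t : ℕ, (t : ℝ) ^ 2 = ∑ k ∈ Finset.range t, (2 * k + 1 : ℝ) := by
      intro t
      induction t with
      | zero => simp
      | succ t ih => rw [Finset.sum_range_succ, ← ih]; push_cast; ring
    exact (key _).le
  · positivity

/-- Size-biasing weights a vertex by its degree, and the shift by one turns the index range `[a, b)`
into degrees in `(a, b]`. -/
theorem sum_sizeBiasedMass (a b : ℕ) :
    ∑ k ∈ Finset.Ico a b, sizeBiasedMass d k =
      (∑ v with a < d v ∧ d v ≤ b, (d v : ℝ)) / totalDegree d := by
  have h : ∀ k, sizeBiasedMass d k =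
      (∑ v, if d v = k + 1 then (d v : ℝ) else 0) / totalDegree d := by
    intro k
    have : (∑ v, if d v = k + 1 then (d v : ℝ) else 0) =
        ∑ v, if d v = k + 1 then (k + 1 : ℝ) else 0 := by
      refine Finset.sum_congr rfl fun v _ => ?_
      split_ifs with h
      · rw [h]; push_cast; rfl
      · rfl
    rw [this, Finset.sum_ite, Finset.sum_const_zero, add_zero, Finset.sum_const, nsmul_eq_mul,
      sizeBiasedMass]
    ring
  simp only [h]
  rw [← Finset.sum_div, Finset.sum_comm, Finset.sum_filter]
  congr 1
  refine Finset.sum_congr rfl fun v _ => ?_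
  split_ifs with hv
  · rw [Finset.sum_eq_single_of_mem (d v - 1)]
    · rw [if_pos]; omega
    · rw [Finset.mem_Ico]; omega
    · intro k _ hk
      rw [if_neg]; omega
  · refine Finset.sum_eq_zero fun k hk => if_neg ?_
    rw [Finset.mem_Ico] at hk
    omega

theorem sum_sizeBiasedMass_sub_le {B : PMF ℕ} {t : ℝ}
    (h : tvDist (sizeBiasedMass d) (fun k => (B k).toReal) ≤ t) (s : Finset ℕ) :
    |∑ k ∈ s, sizeBiasedMass d k - ∑ k ∈ s, (B k).toReal| ≤ 2 * t := by
  have hB : Summable fun k => (B k).toReal := ENNReal.summable_toReal B.tsum_coe_ne_top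
  have hm : Summable fun k => sizeBiasedMass d k := by
    refine summable_of_ne_finset_zero (s := Finset.univ.image fun v => d v - 1) fun k hk => ?_
    have : (Finset.univ.filter fun v => d v = k + 1) = ∅ := by
      refine Finset.filter_eq_empty_iff.2 fun v _ hv => hk ?_
      exact Finset.mem_image.2 ⟨v, Finset.mem_univ v, by omega⟩
    rw [sizeBiasedMass, this]
    simp
  have hs : Summable fun k => |sizeBiasedMass d k - (B k).toReal| := (hm.sub hB).abs
  unfold tvDist at h
  rw [← Finset.sum_sub_distrib]
  refine (Finset.abs_sum_le_sum_abs _ _).trans ?_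
  have := hs.sum_le_tsum s fun k _ => abs_nonneg _
  linarith

theorem two_mul_le_totalDegree (hd : ∀ v, 2 ≤ d v) : 2 * n ≤ totalDegree d := by
  unfold totalDegree
  calc 2 * n = ∑ _v : Fin n, 2 := by simp [mul_comm]
    _ ≤ _ := Finset.sum_le_sum fun v _ => hd v

theorem le_pairedDegree (v : Fin n) : d v ≤ pairedDegree d v := Nat.le_add_right _ _

theorem pairedDegree_le (hd : ∀ v, 2 ≤ d v) (v : Fin n) : pairedDegree d v ≤ 2 * d v := by
  have := hd v
  unfold pairedDegree
  split_ifs <;> omega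

end Tails

/-! ### Power bounds for the number of vertices of large degree -/

section Asymptotics

variable {d : (n : ℕ) → Fin n → ℕ} {τ : ℝ}

theorem PowerLawTail.bounds (h : PowerLawTail d τ) : ∃ α : ℝ, 1 / 2 < α ∧ ∀ η : ℝ, 0 < η →
    ∃ A : ℝ, 1 ≤ A ∧ ∀ᶠ n : ℕ in atTop, (∀ v, 2 ≤ d n v) ∧ ∀ x : ℝ, 1 ≤ x → x < (n : ℝ) ^ α →
      n * x ^ (-(τ - 1) - η) ≤ A * countAbove (d n) x ∧
      countAbove (d n) x ≤ A * (n * x ^ (-(τ - 1) + η)) := by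
  obtain ⟨-, -, γ, C, α, hγ, hγ1, hC, hα, hev⟩ := h
  refine ⟨α, hα, fun η hη => ?_⟩
  obtain ⟨A, hA1, hA⟩ := exists_exp_rpow_log_le hC hγ hγ1 hη
  refine ⟨A, hA1, ?_⟩
  filter_upwards [hev, eventually_gt_atTop 0] with n hn hn0
  refine ⟨hn.1, fun x hx hxα => ?_⟩
  have hx0 : 0 < x := by linarith
  obtain ⟨h1, h2⟩ := hn.2 x hx hxα
  rw [countAbove_eq hn0]
  have hn' : (0 : ℝ) < n := by exact_mod_cast hn0
  have hA0 : 0 < A := by linarith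
  have hE := hA x hx
  rw [one_div, ← Real.rpow_neg hx0.le] at h1 h2
  constructor
  · rw [mul_left_comm]
    gcongr
    have h3 : x ^ (-(τ - 1) - η) ≤ A * (x ^ (-(τ - 1)) * Real.exp (-C * Real.log x ^ γ)) := by
      rw [Real.rpow_sub hx0, div_le_iff₀ (by positivity), neg_mul, Real.exp_neg]
      have : 0 < Real.exp (C * Real.log x ^ γ) := Real.exp_pos _
      rw [show A * (x ^ (-(τ - 1)) * (Real.exp (C * Real.log x ^ γ))⁻¹) * x ^ η =
        x ^ (-(τ - 1)) * ((A * x ^ η) / Real.exp (C * Real.log x ^ γ)) by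
          rw [div_eq_mul_inv]; ring]
      refine le_mul_of_one_le_right (by positivity) ?_
      rwa [one_le_div this]
    exact h3.trans (by gcongr)
  · rw [mul_left_comm]
    gcongr
    refine h2.trans ?_
    rw [Real.rpow_add hx0, mul_left_comm]
    gcongr

end Asymptotics

/-! ### Sums over vertices of high and of low degree -/

section MoreTails

variable {d : (n : ℕ) → Fin n → ℕ} {τ : ℝ}

theorem PowerLawTail.two_le (h : PowerLawTail d τ) : ∀ᶠ n : ℕ in atTop, ∀ v, 2 ≤ d n v := by
  obtain ⟨-, -, γ, C, α, -, -, -, -, hev⟩ := h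
  exact hev.mono fun n hn => hn.1

theorem tendsto_rpow_neg_nat {κ : ℝ} (hκ : 0 < κ) :
    Tendsto (fun n : ℕ => (n : ℝ) ^ (-κ)) atTop (𝓝 0) :=
  (tendsto_rpow_neg_atTop hκ).comp tendsto_natCast_atTop_atTop

theorem HasLimitingDistributions.sizeBiased (h : HasLimitingDistributions d) :
    ∃ B : PMF ℕ, ∃ κ : ℝ, 0 < κ ∧ ∀ᶠ n : ℕ in atTop, ∀ s : Finset ℕ,
      |∑ k ∈ s, sizeBiasedMass (d n) k - ∑ k ∈ s, (B k).toReal| ≤ 2 * (n : ℝ) ^ (-κ) := by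
  obtain ⟨D, B, κ, hκ, hev⟩ := h
  exact ⟨B, κ, hκ, hev.mono fun n hn s => sum_sizeBiasedMass_sub_le ((le_max_right _ _).trans hn) s⟩

/-- The power law says nothing beyond `n ^ α`, so a linear bound on the total degree has to come
from the limit law. For a `k` charged by `B`, the mass of `B_n` at `k` stays bounded below, while
its numerator is at most `(k + 1) * n`. -/
theorem exists_totalDegree_le (hlim : HasLimitingDistributions d)
    (hpow : PowerLawTail d τ) :
    ∃ A : ℝ, 1 ≤ A ∧ ∀ᶠ n : ℕ in atTop, (totalDegree (d n) : ℝ) ≤ A * n := by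
  obtain ⟨B, κ, hκ, hB⟩ := hlim.sizeBiased
  obtain ⟨k, hk⟩ : ∃ k, B k ≠ 0 := by
    by_contra hcon
    push Not at hcon
    have := B.tsum_coe
    simp [hcon] at this
  have hb : 0 < (B k).toReal := ENNReal.toReal_pos hk (B.apply_ne_top k)
  set b := (B k).toReal
  refine ⟨max 1 (2 * (k + 1) / b), le_max_left _ _, ?_⟩
  have hsmall := (tendsto_rpow_neg_nat hκ).eventually (gt_mem_nhds (show 0 < b / 4 by positivity))
  filter_upwards [hB, hsmall, hpow.two_le, eventually_gt_atTop 0] with n hn hn2 hn3 hn0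
  have h1 := hn {k}
  simp only [Finset.sum_singleton] at h1
  have h2 : b / 2 ≤ sizeBiasedMass (d n) k := by
    have := (abs_le.1 h1).1
    linarith
  have hn' : (0 : ℝ) < n := by exact_mod_cast hn0
  have hH : (0 : ℝ) < totalDegree (d n) := by
    have := two_mul_le_totalDegree hn3
    exact_mod_cast (by omega)
  have h3 : ((Finset.univ.filter fun v => d n v = k + 1).card : ℝ) ≤ n := by
    exact_mod_cast (Finset.card_le_univ _).trans_eq (Fintype.card_fin n)
  unfold sizeBiasedMass at h2
  rw [div_mul_eq_mul_div, le_div_iff₀ hH] at h2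
  have h4 : b / 2 * totalDegree (d n) ≤ (k + 1) * n := h2.trans (by gcongr)
  calc (totalDegree (d n) : ℝ) ≤ 2 * (k + 1) / b * n := by
        rw [div_mul_eq_mul_div, le_div_iff₀ hb]
        linarith
    _ ≤ _ := by gcongr; exact le_max_right _ _

theorem sum_Ico_rpow_tail_le {a : ℝ} (ha : 1 < a) {y N : ℕ} (hy : 1 ≤ y) :
    ∑ s ∈ Finset.Ico y N, (s : ℝ) ^ (-a) ≤ (1 + 1 / (a - 1)) * (y : ℝ) ^ (1 - a) := by
  have hy' : (0 : ℝ) < y := by exact_mod_cast hy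
  have hy1 : (1 : ℝ) ≤ y := by exact_mod_cast hy
  have ha1 : 0 < a - 1 := by linarith
  have hpos : (0 : ℝ) ≤ (y : ℝ) ^ (1 - a) := by positivity
  rcases le_or_gt N y with hN | hN
  · rw [Finset.Ico_eq_empty (by omega), Finset.sum_empty]
    positivity
  obtain ⟨N, rfl⟩ : ∃ N', N = N' + 1 := ⟨N - 1, by omega⟩
  rw [Finset.sum_eq_sum_Ico_succ_bot hN]
  have h1 : ∑ s ∈ Finset.Ico (y + 1) (N + 1), (s : ℝ) ^ (-a) =
      ∑ s ∈ Finset.Ico y N, ((s + 1 : ℕ) : ℝ) ^ (-a) := by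
    rw [← Finset.sum_Ico_add' (fun s : ℕ => (s : ℝ) ^ (-a)) y N 1]
  rw [h1]
  have h2 := sum_Ico_rpow_le (c := a) (by linarith) (by linarith) hy (show y ≤ N by omega)
  have h3 : ((N : ℝ) ^ (1 - a) - (y : ℝ) ^ (1 - a)) / (1 - a) ≤ (y : ℝ) ^ (1 - a) / (a - 1) := by
    rw [← neg_div_neg_eq, neg_sub, neg_sub]
    gcongr
    have : (0 : ℝ) ≤ (N : ℝ) ^ (1 - a) := by positivity
    linarith
  have h4 : (y : ℝ) ^ (-a) ≤ (y : ℝ) ^ (1 - a) := Real.rpow_le_rpow_of_exponent_le hy1 (by linarith)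
  calc _ ≤ (y : ℝ) ^ (1 - a) + (y : ℝ) ^ (1 - a) / (a - 1) := by linarith
    _ = _ := by ring

theorem exists_sum_degree_between_le (hpow : PowerLawTail d τ) {η : ℝ} (hη : 0 < η)
    (hητ : η < τ - 2) : ∃ A : ℝ, 1 ≤ A ∧ ∃ α : ℝ, 0 < α ∧ ∀ᶠ n : ℕ in atTop, ∀ y N : ℕ, 1 ≤ y →
      (N : ℝ) < (n : ℝ) ^ α →
      ∑ v with y < d n v ∧ d n v ≤ N, (d n v : ℝ) ≤ A * (n * (y : ℝ) ^ (-(τ - 2) + η)) := by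
  obtain ⟨α, hα, hT⟩ := hpow.bounds
  obtain ⟨A, hA1, hA⟩ := hT η hη
  refine ⟨A * (2 + 1 / (τ - 1 - η - 1)), ?_, α, by linarith, ?_⟩
  · have : 0 < 1 / (τ - 1 - η - 1) := one_div_pos.2 (by linarith)
    nlinarith
  filter_upwards [hA] with n hn y N hy hN
  have hy' : (0 : ℝ) < y := by exact_mod_cast hy
  rcases le_or_gt N y with hyN | hyN
  · have : (Finset.univ.filter fun v => y < d n v ∧ d n v ≤ N) = ∅ :=
      Finset.filter_eq_empty_iff.2 fun v _ hv => by omega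
    rw [this, Finset.sum_empty]
    have : 0 < 1 / (τ - 1 - η - 1) := one_div_pos.2 (by linarith)
    positivity
  refine (sum_degree_between_le y N).trans ?_
  have hbd : ∀ k : ℕ, y ≤ k → k ≤ N → countAbove (d n) k ≤ A * (n * (k : ℝ) ^ (-(τ - 1 - η))) := by
    intro k hk hkN
    have h1 : (1 : ℝ) ≤ k := by exact_mod_cast hy.trans hk
    have h2 : (k : ℝ) < (n : ℝ) ^ α := lt_of_le_of_lt (by exact_mod_cast hkN) hN
    have := (hn.2 k h1 h2).2
    rwa [show -(τ - 1) + η = -(τ - 1 - η) by ring] at this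
  have hsum := sum_Ico_rpow_tail_le (a := τ - 1 - η) (by linarith) (N := N) hy
  have e1 : (y : ℝ) * (y : ℝ) ^ (-(τ - 1 - η)) = (y : ℝ) ^ (-(τ - 2) + η) := by
    rw [← Real.rpow_one_add' hy'.le (by linarith)]
    congr 1; ring
  have e2 : 1 - (τ - 1 - η) = -(τ - 2) + η := by ring
  rw [e2] at hsum
  have hA0 : 0 < A := by linarith
  calc y * countAbove (d n) y + ∑ k ∈ Finset.Ico y N, countAbove (d n) k
      ≤ y * (A * (n * (y : ℝ) ^ (-(τ - 1 - η)))) +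
        ∑ k ∈ Finset.Ico y N, A * (n * (k : ℝ) ^ (-(τ - 1 - η))) := by
        gcongr with k hk
        · exact hbd y le_rfl hyN.le
        · rw [Finset.mem_Ico] at hk
          exact hbd k hk.1 hk.2.le
    _ = A * (n * (y : ℝ) ^ (-(τ - 2) + η)) +
        A * (n * ∑ k ∈ Finset.Ico y N, (k : ℝ) ^ (-(τ - 1 - η))) := by
        rw [← e1, Finset.mul_sum, Finset.mul_sum]
        ring
    _ ≤ A * (n * (y : ℝ) ^ (-(τ - 2) + η)) +
        A * (n * ((1 + 1 / (τ - 1 - η - 1)) * (y : ℝ) ^ (-(τ - 2) + η))) := by gcongr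
    _ = _ := by ring

/-- Degrees beyond `n ^ α` are invisible to the power law. The tail of the limit `B` is bounded
first, by sending `n` to infinity in bounds over finite ranges. Total variation then transfers it
back to `B_n`, with the error `2 * n ^ (-κ)`. -/
theorem exists_sum_degree_above_le (hpow : PowerLawTail d τ) (hlim : HasLimitingDistributions d)
    {η : ℝ} (hη : 0 < η) (hητ : η < τ - 2) :
    ∃ A : ℝ, 1 ≤ A ∧ ∃ κ : ℝ, 0 < κ ∧ ∀ᶠ n : ℕ in atTop, ∀ y : ℕ, 1 ≤ y →
      (y : ℝ) ≤ (n : ℝ) ^ κ →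
      ∑ v with y < d n v, (d n v : ℝ) ≤ A * (n * (y : ℝ) ^ (-(τ - 2) + η)) := by
  obtain ⟨B, κ, hκ, hB⟩ := hlim.sizeBiased
  obtain ⟨A₁, hA₁, hH⟩ := exists_totalDegree_le hlim hpow
  obtain ⟨A₂, hA₂, α, hα, hbet⟩ := exists_sum_degree_between_le hpow hη hητ
  have hlimit : ∀ s : Finset ℕ, Tendsto (fun n => ∑ k ∈ s, sizeBiasedMass (d n) k) atTop
      (𝓝 (∑ k ∈ s, (B k).toReal)) := by
    intro s
    rw [tendsto_iff_norm_sub_tendsto_zero]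
    have h0 : Tendsto (fun n : ℕ => 2 * (n : ℝ) ^ (-κ)) atTop (𝓝 0) := by
      simpa using (tendsto_rpow_neg_nat hκ).const_mul 2
    refine squeeze_zero' (Eventually.of_forall fun n => norm_nonneg _) ?_ h0
    filter_upwards [hB] with n hn
    exact hn s
  have hBtail : ∀ y N : ℕ, 1 ≤ y →
      ∑ k ∈ Finset.Ico y N, (B k).toReal ≤ A₂ * (y : ℝ) ^ (-(τ - 2) + η) := by
    intro y N hy
    refine le_of_tendsto (hlimit _) ?_
    have hNα : ∀ᶠ n : ℕ in atTop, (N : ℝ) < (n : ℝ) ^ α :=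
      ((tendsto_rpow_atTop hα).comp tendsto_natCast_atTop_atTop).eventually_gt_atTop _
    filter_upwards [hbet, hNα, hpow.two_le, eventually_gt_atTop 0] with n hn hn2 hn3 hn0
    have hn' : (0 : ℝ) < n := by exact_mod_cast hn0
    have hHn : (n : ℝ) ≤ totalDegree (d n) := by
      have := two_mul_le_totalDegree hn3
      exact_mod_cast (by omega)
    rw [sum_sizeBiasedMass, div_le_iff₀ (hn'.trans_le hHn)]
    refine (hn y N hy hn2).trans ?_
    have : (0 : ℝ) ≤ (y : ℝ) ^ (-(τ - 2) + η) := by positivity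
    calc A₂ * (n * (y : ℝ) ^ (-(τ - 2) + η)) = A₂ * (y : ℝ) ^ (-(τ - 2) + η) * n := by ring
      _ ≤ _ := by gcongr
  have hτ : 0 < τ - 2 := by linarith
  -- With the exponent `κ / (τ - 2)`, the error `n ^ (-κ)` is at most `y ^ (-(τ - 2))` and
  -- disappears in the constant.
  refine ⟨A₁ * (A₂ + 2), by nlinarith, κ / (τ - 2), by positivity, ?_⟩
  filter_upwards [hB, hH, hpow.two_le, eventually_gt_atTop 0] with n hn hn2 hn3 hn0 y hy hyκ
  have hn' : (0 : ℝ) < n := by exact_mod_cast hn0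
  have hy' : (0 : ℝ) < y := by exact_mod_cast hy
  have hy1 : (1 : ℝ) ≤ y := by exact_mod_cast hy
  have hHpos : (0 : ℝ) < totalDegree (d n) := by
    have := two_mul_le_totalDegree hn3
    exact_mod_cast (by omega)
  -- No degree exceeds the total degree, so the upper cut-off at `N` removes nothing.
  set N := totalDegree (d n) with hN
  have hfilter : (Finset.univ.filter fun v => y < d n v) =
      Finset.univ.filter fun v => y < d n v ∧ d n v ≤ N := by
    ext v
    simp only [Finset.mem_filter, Finset.mem_univ, true_and, iff_self_and]
    intro _
    exact Finset.single_le_sum (f := fun v => d n v) (by simp) (Finset.mem_univ v)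
  have h1 := (abs_le.1 (hn (Finset.Ico y N))).2
  rw [sum_sizeBiasedMass, ← hfilter] at h1
  have h2 := hBtail y N hy
  have h3 : (n : ℝ) ^ (-κ) ≤ (y : ℝ) ^ (-(τ - 2) + η) := by
    calc (n : ℝ) ^ (-κ) = ((n : ℝ) ^ (κ / (τ - 2))) ^ (-(τ - 2)) := by
          rw [← Real.rpow_mul hn'.le]
          congr 1
          field_simp
      _ ≤ (y : ℝ) ^ (-(τ - 2)) := Real.rpow_le_rpow_of_nonpos hy' hyκ (by linarith)
      _ ≤ _ := Real.rpow_le_rpow_of_exponent_le hy1 (by linarith)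
  have h4 : (∑ v with y < d n v, (d n v : ℝ)) / totalDegree (d n) ≤
      (A₂ + 2) * (y : ℝ) ^ (-(τ - 2) + η) := by linarith
  rw [div_le_iff₀ hHpos] at h4
  refine h4.trans ?_
  have : (0 : ℝ) ≤ (y : ℝ) ^ (-(τ - 2) + η) := by positivity
  calc (A₂ + 2) * (y : ℝ) ^ (-(τ - 2) + η) * totalDegree (d n)
      ≤ (A₂ + 2) * (y : ℝ) ^ (-(τ - 2) + η) * (A₁ * n) := by gcongr
    _ = _ := by ring

/-- By layers the sum is of order `n * ∑ k ^ (-c)` with `c = τ - 2 - η` between zero and one, hence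
dominated by its largest indices. -/
theorem exists_sum_degree_sq_le (hpow : PowerLawTail d τ) {η : ℝ} (hη : 0 < η)
    (hητ : η < τ - 2) : ∃ A : ℝ, 1 ≤ A ∧ ∃ α : ℝ, 0 < α ∧ ∀ᶠ n : ℕ in atTop, ∀ m : ℕ, 1 ≤ m →
      (m : ℝ) < (n : ℝ) ^ α →
      ∑ v with d n v ≤ m, (d n v : ℝ) ^ 2 ≤ A * (n * (m : ℝ) ^ (3 - τ + η)) := by
  obtain ⟨α, hα, hT⟩ := hpow.bounds
  obtain ⟨A, hA1, hA⟩ := hT η hη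
  have hτ3 : τ < 3 := hpow.2.1
  set c : ℝ := τ - 2 - η with hc
  have hc0 : 0 < c := by linarith
  have hc1 : c < 1 := by linarith
  have h1c : 0 < 1 - c := by linarith
  refine ⟨1 + 3 * A * (1 + 1 / (1 - c)), ?_, α, by linarith, ?_⟩
  · have : 0 < 1 / (1 - c) := one_div_pos.2 h1c
    have : 0 ≤ 3 * A * (1 + 1 / (1 - c)) := by positivity
    linarith
  filter_upwards [hA] with n hn m hm hmα
  have hm1 : (1 : ℝ) ≤ m := by exact_mod_cast hm
  have hm0 : (0 : ℝ) < m := by linarith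
  have hA0 : 0 < A := by linarith
  have hone : (1 : ℝ) ≤ (m : ℝ) ^ (1 - c) := Real.one_le_rpow hm1 h1c.le
  have hsum : ∑ s ∈ Finset.Ico 1 m, (s : ℝ) ^ (-c) ≤ (1 + 1 / (1 - c)) * (m : ℝ) ^ (1 - c) := by
    rcases Nat.lt_or_ge 1 m with h1m | h1m
    · obtain ⟨N, rfl⟩ : ∃ N', m = N' + 1 := ⟨m - 1, by omega⟩
      rw [Finset.sum_eq_sum_Ico_succ_bot h1m, ← Finset.sum_Ico_add' (fun s : ℕ => (s : ℝ) ^ (-c)) 1 N 1]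
      have h2 := sum_Ico_rpow_le (c := c) hc0 hc1.ne le_rfl (show 1 ≤ N by omega)
      have h3 : ((N : ℝ) ^ (1 - c) - ((1 : ℕ) : ℝ) ^ (1 - c)) / (1 - c) ≤
          1 / (1 - c) * ((N + 1 : ℕ) : ℝ) ^ (1 - c) := by
        rw [div_mul_eq_mul_div, one_mul]
        gcongr
        have : (N : ℝ) ^ (1 - c) ≤ ((N + 1 : ℕ) : ℝ) ^ (1 - c) :=
          Real.rpow_le_rpow (Nat.cast_nonneg _) (by push_cast; linarith) h1c.le
        have : (0 : ℝ) ≤ ((1 : ℕ) : ℝ) ^ (1 - c) := by positivity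
        linarith
      have h4 : ((1 : ℕ) : ℝ) ^ (-c) = 1 := by simp
      rw [h4]
      linarith
    · rw [Finset.Ico_eq_empty (by omega), Finset.sum_empty]
      positivity
  refine (sum_degree_sq_le m).trans ?_
  rw [Finset.range_eq_Ico, Finset.sum_eq_sum_Ico_succ_bot hm]
  have h0 : (2 * ((0 : ℕ) : ℝ) + 1) * countAbove (d n) ((0 : ℕ) : ℝ) ≤ n := by
    have : countAbove (d n) ((0 : ℕ) : ℝ) ≤ n := by
      unfold countAbove
      exact_mod_cast (Finset.card_le_univ _).trans_eq (Fintype.card_fin n)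
    simpa using this
  have h1 : ∑ k ∈ Finset.Ico (0 + 1) m, (2 * (k : ℝ) + 1) * countAbove (d n) k ≤
      ∑ k ∈ Finset.Ico 1 m, 3 * A * n * (k : ℝ) ^ (-c) := by
    refine Finset.sum_le_sum fun k hk => ?_
    rw [Finset.mem_Ico] at hk
    have hk1 : (1 : ℝ) ≤ k := by exact_mod_cast hk.1
    have hk0 : (0 : ℝ) < k := by linarith
    have h2 := (hn.2 k hk1 (lt_trans (by exact_mod_cast hk.2) hmα)).2
    have e1 : (k : ℝ) * (k : ℝ) ^ (-(τ - 1) + η) = (k : ℝ) ^ (-c) := by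
      rw [← Real.rpow_one_add' hk0.le (by linarith)]
      congr 1; rw [hc]; ring
    calc (2 * (k : ℝ) + 1) * countAbove (d n) k
        ≤ (3 * k) * (A * (n * (k : ℝ) ^ (-(τ - 1) + η))) := by
          gcongr
          · exact countAbove_nonneg _ _
          · linarith
      _ = 3 * A * n * (k * (k : ℝ) ^ (-(τ - 1) + η)) := by ring
      _ = _ := by rw [e1]
  rw [← Finset.mul_sum] at h1
  have e3 : 3 - τ + η = 1 - c := by rw [hc]; ring
  rw [e3]
  calc _ ≤ (n : ℝ) + 3 * A * n * ((1 + 1 / (1 - c)) * (m : ℝ) ^ (1 - c)) := by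
        refine add_le_add h0 (h1.trans ?_)
        gcongr
    _ ≤ n * (m : ℝ) ^ (1 - c) + 3 * A * n * ((1 + 1 / (1 - c)) * (m : ℝ) ^ (1 - c)) := by
        gcongr
        exact le_mul_of_one_le_right (Nat.cast_nonneg _) hone
    _ = _ := by ring

end MoreTails

/-! ### Degree bounds for the half-edges that are paired -/

section PairedTails

variable {d : (n : ℕ) → Fin n → ℕ} {τ : ℝ}

theorem totalDegree_le_card_halfEdge {n : ℕ} (d : Fin n → ℕ) :
    totalDegree d ≤ Fintype.card (HalfEdge d) := by
  rw [card_halfEdge]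
  exact Finset.sum_le_sum fun v _ => le_pairedDegree v

theorem exists_card_halfEdge_bounds (hpow : PowerLawTail d τ) (hlim : HasLimitingDistributions d) :
    ∃ A : ℝ, 1 ≤ A ∧ ∀ᶠ n : ℕ in atTop, (∀ v, 2 ≤ pairedDegree (d n) v) ∧
      (n : ℝ) ≤ Fintype.card (HalfEdge (d n)) ∧ (Fintype.card (HalfEdge (d n)) : ℝ) ≤ A * n := by
  obtain ⟨A, hA, hH⟩ := exists_totalDegree_le hlim hpow
  refine ⟨2 * A, by linarith, ?_⟩
  filter_upwards [hH, hpow.two_le] with n hn hn2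
  refine ⟨fun v => (hn2 v).trans (le_pairedDegree v), ?_, ?_⟩
  · have h1 := two_mul_le_totalDegree hn2
    have h2 := totalDegree_le_card_halfEdge (d n)
    exact_mod_cast (by omega)
  · have h1 : Fintype.card (HalfEdge (d n)) ≤ 2 * totalDegree (d n) := by
      rw [card_halfEdge, totalDegree, Finset.mul_sum]
      exact Finset.sum_le_sum fun v _ => pairedDegree_le hn2 v
    have h2 : (Fintype.card (HalfEdge (d n)) : ℝ) ≤ 2 * totalDegree (d n) := by exact_mod_cast h1
    linarith

theorem exists_count_lower (hpow : PowerLawTail d τ) : ∃ α : ℝ, 1 / 2 < α ∧ ∀ η : ℝ, 0 < η →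
    ∃ A : ℝ, 1 ≤ A ∧ ∀ᶠ n : ℕ in atTop, ∀ x : ℝ, 1 ≤ x → x < (n : ℝ) ^ α →
      n * x ^ (-(τ - 1) - η) ≤
        A * ((Finset.univ.filter fun v => x ≤ (pairedDegree (d n) v : ℝ)).card : ℝ) := by
  obtain ⟨α, hα, h⟩ := hpow.bounds
  refine ⟨α, hα, fun η hη => ?_⟩
  obtain ⟨A, hA, hev⟩ := h η hη
  refine ⟨A, hA, ?_⟩
  filter_upwards [hev] with n hn x hx hxα
  refine (hn.2 x hx hxα).1.trans ?_
  unfold countAbove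
  gcongr with v hv
  intro hxv
  exact hxv.le.trans (by exact_mod_cast le_pairedDegree v)

theorem exists_tail_upper (hpow : PowerLawTail d τ) (hlim : HasLimitingDistributions d)
    {η : ℝ} (hη : 0 < η) (hητ : η < τ - 2) :
    ∃ A : ℝ, 1 ≤ A ∧ ∃ κ : ℝ, 0 < κ ∧ ∀ᶠ n : ℕ in atTop, ∀ y : ℝ, 2 ≤ y → y ≤ (n : ℝ) ^ κ →
      2 / (Fintype.card (HalfEdge (d n)) : ℝ) *
        ∑ z with y < (pairedDegree (d n) z : ℝ), (pairedDegree (d n) z : ℝ) ≤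
          A * y ^ (-(τ - 2) + η) ∧
      2 / (Fintype.card (HalfEdge (d n)) : ℝ) *
        ∑ z with (pairedDegree (d n) z : ℝ) ≤ y, (pairedDegree (d n) z : ℝ) ^ 2 ≤
          A * y ^ (3 - τ + η) := by
  have hτ3 : τ < 3 := hpow.2.1
  obtain ⟨A₁, hA₁, κ, hκ, h1⟩ := exists_sum_degree_above_le hpow hlim hη hητ
  obtain ⟨A₂, hA₂, α, hα, h2⟩ := exists_sum_degree_sq_le hpow hη hητ
  obtain ⟨A₃, -, h3⟩ := exists_card_halfEdge_bounds hpow hlim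
  refine ⟨16 * A₁ + 8 * A₂, by linarith, min κ (α / 2), by positivity, ?_⟩
  filter_upwards [h1, h2, h3, hpow.two_le, eventually_gt_atTop 1] with n hn1 hn2 hn3 hd hn0 y hy hyn
  have hn' : (1 : ℝ) < n := by exact_mod_cast hn0
  have hn0' : (0 : ℝ) < n := by linarith
  have hy0 : 0 < y := by linarith
  have hyκ : y ≤ (n : ℝ) ^ κ :=
    hyn.trans (Real.rpow_le_rpow_of_exponent_le hn'.le (min_le_left _ _))
  have hyα : y < (n : ℝ) ^ α :=
    hyn.trans_lt (Real.rpow_lt_rpow_of_exponent_lt hn' ((min_le_right _ _).trans_lt (by linarith)))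
  have hℓ : (0 : ℝ) < Fintype.card (HalfEdge (d n)) := hn0'.trans_le hn3.2.1
  have hfrac : ∀ S : ℝ, 0 ≤ S → 2 / (Fintype.card (HalfEdge (d n)) : ℝ) * (n * S) ≤ 2 * S := by
    intro S hS
    rw [div_mul_eq_mul_div, div_le_iff₀ hℓ]
    nlinarith [hn3.2.1]
  have hD : ∀ v, (pairedDegree (d n) v : ℝ) ≤ 2 * d n v := fun v => by
    exact_mod_cast pairedDegree_le hd v
  constructor
  -- A paired degree is at most twice the degree, so paired degree above `y` forces degree above
  -- `m`.
  · set m := ⌊y / 2⌋₊ with hm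
    have hm1 : 1 ≤ m := Nat.le_floor (by norm_num; linarith)
    have hmy : (m : ℝ) ≤ y / 2 := Nat.floor_le (by positivity)
    have hm4 : y / 4 ≤ m := by
      have := Nat.lt_floor_add_one (y / 2)
      have : (1 : ℝ) ≤ m := by exact_mod_cast hm1
      linarith
    have hS := hn1 m hm1 (by linarith)
    have hsum : ∑ z with y < (pairedDegree (d n) z : ℝ), (pairedDegree (d n) z : ℝ) ≤
        2 * ∑ v with m < d n v, (d n v : ℝ) := by
      rw [Finset.mul_sum]
      refine (Finset.sum_le_sum fun v _ => hD v).trans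
        (Finset.sum_le_sum_of_subset_of_nonneg (fun v hv => ?_) fun v _ _ => by positivity)
      simp only [Finset.mem_filter, Finset.mem_univ, true_and] at hv ⊢
      have : (m : ℝ) < d n v := by
        have := hD v
        linarith
      exact_mod_cast this
    have hpw : (m : ℝ) ^ (-(τ - 2) + η) ≤ 4 * y ^ (-(τ - 2) + η) := by
      calc (m : ℝ) ^ (-(τ - 2) + η) ≤ (y / 4) ^ (-(τ - 2) + η) :=
            Real.rpow_le_rpow_of_nonpos (by positivity) hm4 (by linarith)
        _ = y ^ (-(τ - 2) + η) * (4 : ℝ) ^ (-(-(τ - 2) + η)) := by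
            rw [Real.div_rpow hy0.le (by norm_num), Real.rpow_neg (by norm_num), div_eq_mul_inv]
        _ ≤ y ^ (-(τ - 2) + η) * (4 : ℝ) ^ (1 : ℝ) := by
            gcongr
            · norm_num
            · linarith
        _ = _ := by rw [Real.rpow_one]; ring
    have hp0 : 0 ≤ y ^ (-(τ - 2) + η) := by positivity
    calc _ ≤ 2 / (Fintype.card (HalfEdge (d n)) : ℝ) *
          (2 * (A₁ * (n * (m : ℝ) ^ (-(τ - 2) + η)))) := by gcongr; exact hsum.trans (by linarith)
      _ = 2 / (Fintype.card (HalfEdge (d n)) : ℝ) *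
          (n * (2 * A₁ * (m : ℝ) ^ (-(τ - 2) + η))) := by ring
      _ ≤ 2 * (2 * A₁ * (m : ℝ) ^ (-(τ - 2) + η)) := hfrac _ (by positivity)
      _ ≤ 2 * (2 * A₁ * (4 * y ^ (-(τ - 2) + η))) := by gcongr
      _ = 16 * A₁ * y ^ (-(τ - 2) + η) := by ring
      _ ≤ _ := by gcongr; linarith
  · set m := ⌊y⌋₊ with hm
    have hm1 : 1 ≤ m := Nat.le_floor (by norm_num; linarith)
    have hmy : (m : ℝ) ≤ y := Nat.floor_le hy0.le
    have hS := hn2 m hm1 (hmy.trans_lt hyα)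
    have hsum : ∑ z with (pairedDegree (d n) z : ℝ) ≤ y, (pairedDegree (d n) z : ℝ) ^ 2 ≤
        4 * ∑ v with d n v ≤ m, (d n v : ℝ) ^ 2 := by
      rw [Finset.mul_sum]
      refine (Finset.sum_le_sum fun v _ => ?_).trans
        (Finset.sum_le_sum_of_subset_of_nonneg (fun v hv => ?_) fun v _ _ => by positivity)
      · have := hD v
        have h0 : (0 : ℝ) ≤ pairedDegree (d n) v := Nat.cast_nonneg _
        nlinarith
      · simp only [Finset.mem_filter, Finset.mem_univ, true_and] at hv ⊢
        refine Nat.le_floor (le_trans ?_ hv)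
        exact_mod_cast le_pairedDegree v
    have hpw : (m : ℝ) ^ (3 - τ + η) ≤ y ^ (3 - τ + η) :=
      Real.rpow_le_rpow (Nat.cast_nonneg _) hmy (by linarith)
    have hp0 : 0 ≤ y ^ (3 - τ + η) := by positivity
    calc _ ≤ 2 / (Fintype.card (HalfEdge (d n)) : ℝ) *
          (4 * (A₂ * (n * (m : ℝ) ^ (3 - τ + η)))) := by gcongr; exact hsum.trans (by linarith)
      _ = 2 / (Fintype.card (HalfEdge (d n)) : ℝ) * (n * (4 * A₂ * (m : ℝ) ^ (3 - τ + η))) := by ring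
      _ ≤ 2 * (4 * A₂ * (m : ℝ) ^ (3 - τ + η)) := hfrac _ (by positivity)
      _ ≤ 2 * (4 * A₂ * y ^ (3 - τ + η)) := by gcongr
      _ = 8 * A₂ * y ^ (3 - τ + η) := by ring
      _ ≤ _ := by gcongr; linarith

/-- A degree above a large constant `y` is bounded by the whole sum over degrees above `y`, and this
is a small fraction of the number of half-edges. -/
theorem eventually_pairedDegree_le (hpow : PowerLawTail d τ) (hlim : HasLimitingDistributions d)
    {ζ : ℝ} (hζ : 0 < ζ) : ∀ᶠ n : ℕ in atTop, ∀ v, (pairedDegree (d n) v : ℝ) ≤ ζ * n := by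
  have hτ2 : 2 < τ := hpow.1
  obtain ⟨A, hA, κ, hκ, h⟩ := exists_tail_upper hpow hlim (η := (τ - 2) / 2) (by linarith)
    (by linarith)
  obtain ⟨A₃, hA₃, h3⟩ := exists_card_halfEdge_bounds hpow hlim
  have hlim0 : Tendsto (fun y : ℝ => A * A₃ * y ^ (-((τ - 2) / 2))) atTop (𝓝 0) := by
    simpa using (tendsto_rpow_neg_atTop (show 0 < (τ - 2) / 2 by linarith)).const_mul (A * A₃)
  obtain ⟨y, hy, hy2⟩ :=
    ((hlim0.eventually (gt_mem_nhds hζ)).and (eventually_ge_atTop 2)).exists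
  have hyκ : ∀ᶠ n : ℕ in atTop, y ≤ (n : ℝ) ^ κ :=
    ((tendsto_rpow_atTop hκ).comp tendsto_natCast_atTop_atTop).eventually_ge_atTop _
  have hyζ : ∀ᶠ n : ℕ in atTop, y ≤ ζ * (n : ℝ) :=
    (tendsto_natCast_atTop_atTop.const_mul_atTop hζ).eventually_ge_atTop _
  filter_upwards [h, h3, hyκ, hyζ, eventually_gt_atTop 0] with n hn hn3 hn1 hn2 hn0 v
  have hn' : (0 : ℝ) < n := by exact_mod_cast hn0
  rcases le_or_gt (pairedDegree (d n) v : ℝ) y with hv | hv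
  · exact hv.trans hn2
  · have h1 := (hn y hy2 hn1).1
    have hℓ : (0 : ℝ) < Fintype.card (HalfEdge (d n)) := hn'.trans_le hn3.2.1
    rw [div_mul_eq_mul_div, div_le_iff₀ hℓ] at h1
    have h2 : (pairedDegree (d n) v : ℝ) ≤
        ∑ z with y < (pairedDegree (d n) z : ℝ), (pairedDegree (d n) z : ℝ) :=
      Finset.single_le_sum (f := fun z => (pairedDegree (d n) z : ℝ)) (fun z _ => Nat.cast_nonneg _)
        (by simpa using hv)
    have e : -(τ - 2) + (τ - 2) / 2 = -((τ - 2) / 2) := by ring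
    rw [e] at h1
    have h0 : (0 : ℝ) ≤ pairedDegree (d n) v := Nat.cast_nonneg _
    calc (pairedDegree (d n) v : ℝ) ≤ A * y ^ (-((τ - 2) / 2)) * Fintype.card (HalfEdge (d n)) := by
          linarith
      _ ≤ A * y ^ (-((τ - 2) / 2)) * (A₃ * n) := by gcongr; exact hn3.2.2
      _ = A * A₃ * y ^ (-((τ - 2) / 2)) * n := by ring
      _ ≤ ζ * n := by gcongr

end PairedTails

/-! ### Quantiles of the edge weights -/

section Quantile

variable {ν : Measure ℝ}

theorem quantile_set_nonempty {x : ℝ} (hx : x < 1) : {y : ℝ | x ≤ cdf ν y}.Nonempty :=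
  ((tendsto_cdf_atTop ν).eventually (lt_mem_nhds hx)).exists.imp fun _ h => h.le

/-- The quantile of the edge weights at `exp (-exp t)`. -/
def tailQuantile (ν : Measure ℝ) (t : ℝ) : ℝ :=
  generalizedInverse (cdf ν) (Real.exp (-Real.exp t))

/-- On the scale of `tailQuantile`, geometric growth of the exponent becomes an arithmetic
progression with mesh `log ρ`, and the constant `c` becomes a shift. -/
theorem quantile_exp_eq (c : ℝ) (hc : 0 < c) {ρ : ℝ} (hρ : 0 < ρ) (k : ℕ) :
    generalizedInverse (cdf ν) (Real.exp (-(c * ρ ^ k))) =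
      tailQuantile ν (k * Real.log ρ + Real.log c) := by
  unfold tailQuantile
  rw [Real.exp_add, Real.exp_log hc, mul_comm (k : ℝ), Real.exp_mul, Real.exp_log hρ,
    Real.rpow_natCast, mul_comm c]

variable [IsProbabilityMeasure ν]

theorem quantile_set_nonneg (hν : ν (Set.Iio 0) = 0) {x : ℝ} (hx : 0 < x) :
    ∀ y ∈ {y : ℝ | x ≤ cdf ν y}, 0 ≤ y := by
  intro y hy
  by_contra hneg
  rw [not_le] at hneg
  have h0 : cdf ν y = 0 := by
    rw [cdf_eq_real, measureReal_def, measure_mono_null (fun z hz => ?_) hν, ENNReal.toReal_zero]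
    exact lt_of_le_of_lt hz hneg
  have : x ≤ cdf ν y := hy
  linarith

theorem quantile_nonneg (hν : ν (Set.Iio 0) = 0) {x : ℝ} (hx : 0 < x) :
    0 ≤ generalizedInverse (cdf ν) x :=
  Real.sInf_nonneg (quantile_set_nonneg hν hx)

theorem quantile_mono (hν : ν (Set.Iio 0) = 0) {x x' : ℝ} (hx : 0 < x) (hxx : x ≤ x')
    (hx' : x' < 1) : generalizedInverse (cdf ν) x ≤ generalizedInverse (cdf ν) x' :=
  csInf_le_csInf ⟨0, quantile_set_nonneg hν hx⟩ (quantile_set_nonempty hx')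
    fun _ hy => hxx.trans hy

/-- Right continuity of the distribution function. This and `measure_Iio_quantile_le` are the two
halves of the quantile property: the first makes edges cheap enough, the second makes cheaper edges
rare. -/
theorem le_measure_Iic_quantile {x : ℝ} (hx1 : x < 1) :
    x ≤ ν.real (Set.Iic (generalizedInverse (cdf ν) x)) := by
  rw [← cdf_eq_real]
  set q := generalizedInverse (cdf ν) x with hq
  have hright : Tendsto (cdf ν) (𝓝[>] q) (𝓝 (cdf ν q)) :=
    ((cdf ν).right_continuous q).mono Set.Ioi_subset_Ici_self
  refine ge_of_tendsto hright ?_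
  filter_upwards [self_mem_nhdsWithin] with z hz
  obtain ⟨y, hy, hyz⟩ := exists_lt_of_csInf_lt (quantile_set_nonempty hx1) hz
  exact le_trans hy (monotone_cdf ν hyz.le)

theorem measure_Iio_quantile_le (hν : ν (Set.Iio 0) = 0) {x : ℝ} (hx : 0 < x) :
    ν.real (Set.Iio (generalizedInverse (cdf ν) x)) ≤ x := by
  set q := generalizedInverse (cdf ν) x with hq
  have hun : Set.Iio q = ⋃ k : ℕ, Set.Iic (q - 1 / (k + 1 : ℝ)) := by
    ext z
    simp only [Set.mem_Iio, Set.mem_iUnion, Set.mem_Iic]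
    constructor
    · intro hz
      obtain ⟨k, hk⟩ := exists_nat_one_div_lt (sub_pos.2 hz)
      exact ⟨k, by linarith⟩
    · rintro ⟨k, hk⟩
      have : (0 : ℝ) < 1 / (k + 1 : ℝ) := by positivity
      linarith
  have hmono : Monotone fun k : ℕ => Set.Iic (q - 1 / (k + 1 : ℝ)) := by
    intro k l hkl
    refine Set.Iic_subset_Iic.2 ?_
    have : 1 / (l + 1 : ℝ) ≤ 1 / (k + 1 : ℝ) := by
      have : (k : ℝ) ≤ l := by exact_mod_cast hkl
      gcongr
    linarith
  have ht := (tendsto_measure_iUnion_atTop (μ := ν) hmono)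
  rw [← hun] at ht
  have ht' := (ENNReal.tendsto_toReal (measure_ne_top ν (Set.Iio q))).comp ht
  refine le_of_tendsto ht' (Eventually.of_forall fun k => ?_)
  have hk : (0 : ℝ) < 1 / (k + 1 : ℝ) := by positivity
  by_contra hcon
  simp only [Function.comp, not_le] at hcon
  have hmem : q - 1 / (k + 1 : ℝ) ∈ {y : ℝ | x ≤ cdf ν y} := by
    simp only [Set.mem_ofPred_eq, cdf_eq_real]
    exact hcon.le
  have := csInf_le ⟨0, quantile_set_nonneg hν hx⟩ hmem
  change q ≤ _ at this
  linarith

theorem exp_neg_exp_lt_one (t : ℝ) : Real.exp (-Real.exp t) < 1 :=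
  Real.exp_lt_one_iff.2 (neg_lt_zero.2 (Real.exp_pos t))

theorem tailQuantile_nonneg (hν : ν (Set.Iio 0) = 0) (t : ℝ) : 0 ≤ tailQuantile ν t :=
  quantile_nonneg hν (Real.exp_pos _)

theorem tailQuantile_antitone (hν : ν (Set.Iio 0) = 0) : Antitone (tailQuantile ν) :=
  fun _ _ hst => quantile_mono hν (Real.exp_pos _)
    (Real.exp_le_exp.2 (neg_le_neg (Real.exp_le_exp.2 hst))) (exp_neg_exp_lt_one _)

end Quantile

/-! ### Sums and integrals of antitone functions -/

section Antitone

variable {h : ℝ → ℝ}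

/-- The primitive of `h`. -/
def primitive (h : ℝ → ℝ) (x : ℝ) : ℝ := ∫ t in (0 : ℝ)..x, h t

theorem sum_range_succ_le_primitive (hh : Antitone h) {l : ℝ} (hl : 0 < l) (N : ℕ) :
    ∑ i ∈ Finset.range N, h (((i + 1 : ℕ) : ℝ) * l) ≤ primitive h (N * l) / l := by
  have hg : Antitone fun s => h (s * l) := fun a b hab => hh (by gcongr)
  have := (hg.antitoneOn (Set.Icc (0 : ℝ) (0 + (N : ℕ)))).sum_le_integral
  simp only [zero_add] at this
  refine this.trans (le_of_eq ?_)
  rw [intervalIntegral.integral_comp_mul_right _ hl.ne', zero_mul, smul_eq_mul, primitive]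
  ring

theorem primitive_sub_le (hh : Antitone h) {l c : ℝ} (hl : 0 < l) (N : ℕ) :
    (primitive h (c + N * l) - primitive h c) / l ≤ ∑ i ∈ Finset.range N, h (i * l + c) := by
  have hg : Antitone fun s => h (s * l + c) := fun a b hab => hh (by gcongr)
  have := (hg.antitoneOn (Set.Icc (0 : ℝ) (0 + (N : ℕ)))).integral_le_sum
  simp only [zero_add] at this
  refine le_trans (le_of_eq ?_) this
  simp_rw [mul_comm _ l]
  rw [intervalIntegral.integral_comp_mul_add _ hl.ne', mul_zero, zero_add, smul_eq_mul, primitive,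
    primitive, intervalIntegral.integral_interval_sub_left hh.intervalIntegrable
      hh.intervalIntegrable, mul_comm l, add_comm, div_eq_inv_mul]

theorem primitive_mono (hh : Antitone h) (h0 : ∀ t, 0 ≤ h t) : Monotone (primitive h) := by
  intro a b hab
  have := intervalIntegral.integral_interval_sub_left (μ := volume) (f := h) (a := 0) (b := b)
    (c := a) hh.intervalIntegrable hh.intervalIntegrable
  have h1 : 0 ≤ ∫ t in a..b, h t := intervalIntegral.integral_nonneg hab fun t _ => h0 t
  unfold primitive
  linarith

/-- The primitive of an antitone function is concave and vanishes at zero. This shows that stopping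
at a fraction of `log log n` loses no more than that fraction of the cost. -/
theorem mul_primitive_le (hh : Antitone h) {x θ : ℝ} (hx : 0 ≤ x) (hθ : 0 < θ)
    (hθ1 : θ ≤ 1) : θ * primitive h x ≤ primitive h (θ * x) := by
  have h1 : primitive h (θ * x) = θ * ∫ t in (0 : ℝ)..x, h (θ * t) := by
    rw [intervalIntegral.integral_comp_mul_left _ hθ.ne', mul_zero, smul_eq_mul, primitive,
      mul_inv_cancel_left₀ hθ.ne']
  rw [h1, primitive]
  have hg : Antitone fun t => h (θ * t) := fun a b hab => hh (by gcongr)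
  gcongr
  refine intervalIntegral.integral_mono_on hx hh.intervalIntegrable hg.intervalIntegrable
    fun t ht => hh ?_
  nlinarith [ht.1]

theorem tendsto_primitive (hh : Antitone h) (h0 : ∀ t, 0 ≤ h t)
    (hdiv : Tendsto (fun N : ℕ => ∑ k ∈ Finset.Icc 1 N, h k) atTop atTop) :
    Tendsto (primitive h) atTop atTop := by
  refine tendsto_atTop_mono' _ ?_ (hdiv.comp (tendsto_nat_floor_atTop (α := ℝ)))
  filter_upwards [eventually_ge_atTop 0] with x hx
  have h1 := sum_range_succ_le_primitive hh one_pos ⌊x⌋₊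
  simp only [mul_one, div_one] at h1
  have h2 := primitive_mono hh h0 (Nat.floor_le hx)
  refine le_trans (le_of_eq ?_) (h1.trans h2)
  simp only [Function.comp]
  rw [Finset.range_eq_Ico, Finset.sum_Ico_add' (fun k : ℕ => h k) 0 ⌊x⌋₊ 1]
  rfl

end Antitone

/-! ### The typical distance -/

section Typical

variable {ν : Measure ℝ} {τ : ℝ}

theorem abs_log_pos (h2 : 2 < τ) (h3 : τ < 3) : 0 < |Real.log (τ - 2)| :=
  abs_pos.2 (Real.log_neg (by linarith) (by linarith)).ne

theorem exp_abs_log (h2 : 2 < τ) (h3 : τ < 3) : Real.exp |Real.log (τ - 2)| = 1 / (τ - 2) := by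
  rw [abs_of_neg (Real.log_neg (by linarith) (by linarith)), Real.exp_neg,
    Real.exp_log (by linarith), one_div]

theorem tendsto_log_log_nat : Tendsto (fun n : ℕ => Real.log (Real.log n)) atTop atTop :=
  Real.tendsto_log_atTop.comp (Real.tendsto_log_atTop.comp tendsto_natCast_atTop_atTop)

theorem tendsto_depth (h2 : 2 < τ) (h3 : τ < 3) : Tendsto (depth τ) atTop atTop :=
  tendsto_log_log_nat.atTop_div_const (abs_log_pos h2 h3)

theorem typicalDist_eq (h2 : 2 < τ) (h3 : τ < 3) (n : ℕ) :
    typicalDist ν τ n = 2 * ∑ i ∈ Finset.range ⌊depth τ n⌋₊,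
      tailQuantile ν (((i + 1 : ℕ) : ℝ) * |Real.log (τ - 2)|) := by
  have hsum := Finset.sum_Ico_add' (fun i : ℕ => generalizedInverse (cdf ν)
    (Real.exp (-(1 / (τ - 2)) ^ i))) 0 ⌊depth τ n⌋₊ 1
  unfold typicalDist
  rw [show Finset.Icc 1 ⌊depth τ n⌋₊ = Finset.Ico (0 + 1) (⌊depth τ n⌋₊ + 1) from rfl, ← hsum,
    ← Finset.range_eq_Ico]
  congr 1
  refine Finset.sum_congr rfl fun i _ => ?_
  have := quantile_exp_eq (ν := ν) 1 one_pos (ρ := 1 / (τ - 2)) (by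
    have : 0 < τ - 2 := by linarith
    positivity) (i + 1)
  rw [one_mul, Real.log_one, add_zero, ← exp_abs_log h2 h3, Real.log_exp] at this
  rw [← exp_abs_log h2 h3, this]

theorem typicalDist_le [IsProbabilityMeasure ν] (hν : ν (Set.Iio 0) = 0) (h2 : 2 < τ) (h3 : τ < 3)
    {n : ℕ} (hn : 0 ≤ Real.log (Real.log n)) :
    typicalDist ν τ n ≤
      2 * (primitive (tailQuantile ν) (Real.log (Real.log n)) / |Real.log (τ - 2)|) := by
  have hl := abs_log_pos h2 h3
  rw [typicalDist_eq h2 h3]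
  have hanti := tailQuantile_antitone (ν := ν) hν
  refine mul_le_mul_of_nonneg_left ((sum_range_succ_le_primitive hanti hl _).trans ?_) two_pos.le
  refine div_le_div_of_nonneg_right (primitive_mono hanti (tailQuantile_nonneg hν) ?_) hl.le
  have hd : 0 ≤ depth τ n := div_nonneg hn hl.le
  calc (⌊depth τ n⌋₊ : ℝ) * |Real.log (τ - 2)| ≤ depth τ n * |Real.log (τ - 2)| := by
        gcongr; exact Nat.floor_le hd
    _ = _ := div_mul_cancel₀ _ hl.ne'

/-- Together with `typicalDist_le`, this replaces the typical distance by the primitive at `log log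
n`, up to a constant: the sum is a Riemann sum of mesh `|log (τ - 2)|` up to the floor of `depth τ
n`. -/
theorem le_typicalDist [IsProbabilityMeasure ν] (hν : ν (Set.Iio 0) = 0) (h2 : 2 < τ) (h3 : τ < 3)
    (n : ℕ) : 2 * ((primitive (tailQuantile ν) (Real.log (Real.log n)) -
      primitive (tailQuantile ν) |Real.log (τ - 2)|) / |Real.log (τ - 2)|) ≤
      typicalDist ν τ n := by
  have hl := abs_log_pos h2 h3
  rw [typicalDist_eq h2 h3]
  have hanti := tailQuantile_antitone (ν := ν) hν
  have h := primitive_sub_le hanti (c := |Real.log (τ - 2)|) hl ⌊depth τ n⌋₊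
  have hle : Real.log (Real.log n) ≤ |Real.log (τ - 2)| + ⌊depth τ n⌋₊ * |Real.log (τ - 2)| := by
    calc Real.log (Real.log n) = depth τ n * |Real.log (τ - 2)| := (div_mul_cancel₀ _ hl.ne').symm
      _ ≤ (⌊depth τ n⌋₊ + 1) * |Real.log (τ - 2)| := by
          gcongr; exact (Nat.lt_floor_add_one _).le
      _ = _ := by ring
  have hm := primitive_mono hanti (tailQuantile_nonneg hν) hle
  refine mul_le_mul_of_nonneg_left (le_trans (div_le_div_of_nonneg_right
    (sub_le_sub_right hm _) hl.le) (h.trans (le_of_eq ?_))) two_pos.le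
  refine Finset.sum_congr rfl fun i _ => ?_
  congr 1
  push_cast
  ring

theorem tendsto_primitive_tailQuantile [IsProbabilityMeasure ν] (hν : ν (Set.Iio 0) = 0)
    (hdiv : NonExplosive ν) : Tendsto (primitive (tailQuantile ν)) atTop atTop :=
  tendsto_primitive (tailQuantile_antitone hν) (tailQuantile_nonneg hν) hdiv

theorem tendsto_typicalDist [IsProbabilityMeasure ν] (hν : ν (Set.Iio 0) = 0)
    (hdiv : NonExplosive ν) (h2 : 2 < τ) (h3 : τ < 3) :
    Tendsto (typicalDist ν τ) atTop atTop := by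
  refine tendsto_atTop_mono (le_typicalDist hν h2 h3) ?_
  refine Tendsto.const_mul_atTop two_pos (Tendsto.atTop_div_const (abs_log_pos h2 h3) ?_)
  exact tendsto_atTop_add_const_right _ _
    ((tendsto_primitive_tailQuantile hν hdiv).comp tendsto_log_log_nat)

end Typical

/-! ### Doubly exponential growth -/

section Growth

theorem mul_sub_one_le_pow {ρ : ℝ} (hρ : 1 ≤ ρ) (k : ℕ) : 1 + k * (ρ - 1) ≤ ρ ^ k := by
  have := one_add_mul_le_pow (a := ρ - 1) (by linarith) k
  simpa using this

theorem sum_pow_le_two {r : ℝ} (h0 : 0 ≤ r) (h1 : r ≤ 1 / 2) (K : ℕ) :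
    ∑ k ∈ Finset.range K, r ^ k ≤ 2 := by
  calc ∑ k ∈ Finset.range K, r ^ k ≤ ∑ k ∈ Finset.range K, (1 / 2 : ℝ) ^ k := by
        gcongr
    _ ≤ 2 := by
        rw [geom_sum_eq (by norm_num)]
        have : (0 : ℝ) ≤ (1 / 2) ^ K := by positivity
        rw [div_le_iff_of_neg (by norm_num)]
        linarith

theorem sum_pow_succ_le {r : ℝ} (h0 : 0 ≤ r) (h1 : r ≤ 1 / 2) (K : ℕ) :
    ∑ k ∈ Finset.range K, r ^ (k + 1) ≤ 2 * r := by
  have h := sum_pow_le_two h0 h1 K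
  calc ∑ k ∈ Finset.range K, r ^ (k + 1) = r * ∑ k ∈ Finset.range K, r ^ k := by
        rw [Finset.mul_sum]; exact Finset.sum_congr rfl fun k _ => by ring
    _ ≤ r * 2 := by gcongr
    _ = 2 * r := by ring

theorem sum_Ico_pow_le {ρ : ℝ} (hρ : 1 < ρ) (k : ℕ) :
    ∑ j ∈ Finset.Ico 1 (k + 1), ρ ^ j ≤ ρ ^ (k + 1) / (ρ - 1) := by
  rw [geom_sum_Ico hρ.ne' (by omega)]
  have : 0 < ρ - 1 := by linarith
  gcongr
  linarith

theorem sum_range_pow_le {ρ : ℝ} (hρ : 1 < ρ) (k : ℕ) :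
    ∑ j ∈ Finset.range k, ρ ^ j ≤ ρ ^ k / (ρ - 1) := by
  rw [geom_sum_eq hρ.ne']
  have : 0 < ρ - 1 := by linarith
  gcongr
  linarith

/-- In the exponent, the second moments of all earlier levels add up to `a * G * ρ ^ (k + 1) / (ρ -
1)`, while the tail contributes `-e * G * ρ ^ (k + 1)`. So `a / (ρ - 1) < e` is what makes path
counts decay, and Bernoulli's inequality turns the double exponential into a geometric term. -/
theorem prod_growth_mul_tail_le {A G ρ a e : ℝ} (hA : 1 ≤ A) (hG : 0 ≤ G) (hρ : 1 < ρ)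
    (ha : 0 ≤ a) (hae : a / (ρ - 1) ≤ e) (k : ℕ) :
    (∏ j ∈ Finset.Ico 1 (k + 1), A * Real.exp (G * ρ ^ j) ^ a) *
      (A * Real.exp (G * ρ ^ (k + 1)) ^ (-e)) ≤
    (A * Real.exp (-((e - a / (ρ - 1)) * (ρ - 1) * G))) ^ (k + 1) := by
  simp only [← Real.exp_mul]
  rw [Finset.prod_mul_distrib, Finset.prod_const, Nat.card_Ico, Nat.add_sub_cancel, ← Real.exp_sum,
    mul_pow, ← Real.exp_nat_mul, pow_succ A k]
  have h1 := sum_Ico_pow_le hρ k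
  have h2 := mul_sub_one_le_pow hρ.le (k + 1)
  have hsum : ∑ j ∈ Finset.Ico 1 (k + 1), G * ρ ^ j * a =
      G * a * ∑ j ∈ Finset.Ico 1 (k + 1), ρ ^ j := by
    rw [Finset.mul_sum]; exact Finset.sum_congr rfl fun j _ => by ring
  have hexp : G * a * ∑ j ∈ Finset.Ico 1 (k + 1), ρ ^ j + G * ρ ^ (k + 1) * -e ≤
      ((k + 1 : ℕ) : ℝ) * -((e - a / (ρ - 1)) * (ρ - 1) * G) := by
    have h3 : G * a * ∑ j ∈ Finset.Ico 1 (k + 1), ρ ^ j ≤ G * a * (ρ ^ (k + 1) / (ρ - 1)) := by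
      gcongr
    have h4 : (e - a / (ρ - 1)) * G * (((k + 1 : ℕ) : ℝ) * (ρ - 1)) ≤
        (e - a / (ρ - 1)) * G * ρ ^ (k + 1) := by
      have : 0 ≤ e - a / (ρ - 1) := by linarith
      gcongr
      linarith
    have h5 : G * a * (ρ ^ (k + 1) / (ρ - 1)) = a / (ρ - 1) * G * ρ ^ (k + 1) := by ring
    nlinarith
  calc _ = A ^ k * A * Real.exp (G * a * ∑ j ∈ Finset.Ico 1 (k + 1), ρ ^ j +
        G * ρ ^ (k + 1) * -e) := by rw [hsum, Real.exp_add]; ring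
    _ ≤ _ := by gcongr

/-- The constant `G / (ρ - 1) + G + C` has one summand for the size of the ball, one for the degree
of its vertices, and a surplus `C` that makes the sum of the failure probabilities small. -/
theorem prod_growth_mul_failure_le {G ρ C : ℝ} (hG : 0 ≤ G) (hρ : 1 < ρ) (hC : 0 ≤ C) (k : ℕ) :
    (∏ j ∈ Finset.range k, (1 + Real.exp (G * ρ ^ j))) * Real.exp (G * ρ ^ k) *
      Real.exp (-((G / (ρ - 1) + G + C) * ρ ^ k)) ≤
    Real.exp (-C) * (2 * Real.exp (-((ρ - 1) * C))) ^ k := by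
  have hprod : ∏ j ∈ Finset.range k, (1 + Real.exp (G * ρ ^ j)) ≤
      2 ^ k * Real.exp (G * ∑ j ∈ Finset.range k, ρ ^ j) := by
    calc _ ≤ ∏ j ∈ Finset.range k, (2 * Real.exp (G * ρ ^ j)) := by
          refine Finset.prod_le_prod (fun j _ => by positivity) fun j _ => ?_
          have : 1 ≤ Real.exp (G * ρ ^ j) := Real.one_le_exp (by positivity)
          linarith
      _ = _ := by
          rw [Finset.prod_mul_distrib, Finset.prod_const, Finset.card_range, ← Real.exp_sum,
            Finset.mul_sum]
  have h1 := sum_range_pow_le hρ k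
  have h2 := mul_sub_one_le_pow hρ.le k
  have h3 : G * ∑ j ∈ Finset.range k, ρ ^ j ≤ G * (ρ ^ k / (ρ - 1)) := by gcongr
  have h4 : C * (1 + k * (ρ - 1)) ≤ C * ρ ^ k := by gcongr
  calc _ ≤ 2 ^ k * Real.exp (G * ∑ j ∈ Finset.range k, ρ ^ j) * Real.exp (G * ρ ^ k) *
        Real.exp (-((G / (ρ - 1) + G + C) * ρ ^ k)) := by gcongr
    _ = 2 ^ k * Real.exp (G * ∑ j ∈ Finset.range k, ρ ^ j + G * ρ ^ k +
        -((G / (ρ - 1) + G + C) * ρ ^ k)) := by rw [Real.exp_add, Real.exp_add]; ring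
    _ ≤ 2 ^ k * Real.exp (-C + k * -((ρ - 1) * C)) := by
        refine mul_le_mul_of_nonneg_left (Real.exp_le_exp.2 ?_) (by positivity)
        have : G / (ρ - 1) * ρ ^ k = G * (ρ ^ k / (ρ - 1)) := by ring
        nlinarith
    _ = _ := by rw [Real.exp_add, Real.exp_nat_mul, mul_pow]; ring

end Growth

/-! ### The lower bound as the number of vertices tends to infinity -/

theorem eventually_const_mul_rpow_le (c : ℝ) {s κ : ℝ} (hs : s < 1) (hκ : 0 < κ) :
    ∀ᶠ x : ℝ in atTop, c * x ^ s ≤ κ * x := by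
  filter_upwards [(tendsto_rpow_atTop (sub_pos.2 hs)).eventually_ge_atTop (c / κ),
    eventually_gt_atTop 0] with x hx hx0
  rw [div_le_iff₀ hκ] at hx
  calc c * x ^ s ≤ x ^ (1 - s) * κ * x ^ s := by gcongr
    _ = κ * x ^ (1 - s + s) := by rw [Real.rpow_add hx0]; ring
    _ = κ * x := by rw [sub_add_cancel, Real.rpow_one]

theorem eventually_log_le_rpow {s : ℝ} (hs : 0 < s) : ∀ᶠ x : ℝ in atTop, Real.log x ≤ x ^ s := by
  filter_upwards [(isLittleO_log_rpow_atTop hs).bound one_pos, eventually_gt_atTop 0] with x hx hx0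
  rw [one_mul, Real.norm_of_nonneg (Real.rpow_nonneg hx0.le s)] at hx
  exact (le_abs_self _).trans hx

theorem tendsto_log_nat : Tendsto (fun n : ℕ => Real.log n) atTop atTop :=
  Real.tendsto_log_atTop.comp tendsto_natCast_atTop_atTop

/-- The last bound is the meeting probability of the two balls: `log log n` times a power of `log n`
with exponent below one is negligible against `log n`. -/
theorem eventually_growth_bounds {G l δ κ ξ : ℝ} (hG : 0 ≤ G) (hl : 0 < l) (hδ : 0 < δ)
    (hδ1 : δ ≤ 1) (hκ : 0 < κ) (hξ : 0 < ξ) : ∀ᶠ n : ℕ in atTop, 1 ≤ Real.log n ∧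
      G * Real.log n ^ (1 - δ) ≤ κ * Real.log n ∧
      4 * (Real.log (Real.log n) / l) ≤ n ∧
      Real.exp (2 * (Real.log (Real.log n) / l) * (2 + G * Real.log n ^ (1 - δ))) / n ≤ ξ := by
  have key : ∀ᶠ x : ℝ in atTop, 1 ≤ x ∧ Real.log x ≤ x ^ (δ / 2) ∧ G * x ^ (1 - δ) ≤ κ * x ∧
      2 / l * (2 + G) * x ^ (1 - δ / 2) ≤ 1 / 2 * x ∧ 4 / l * Real.log x ≤ x := by
    filter_upwards [eventually_ge_atTop 1, eventually_log_le_rpow (half_pos hδ),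
      eventually_const_mul_rpow_le G (s := 1 - δ) (by linarith) hκ,
      eventually_const_mul_rpow_le (2 / l * (2 + G)) (s := 1 - δ / 2) (by linarith)
        (half_pos one_pos),
      eventually_const_mul_rpow_le (4 / l) (s := 1 / 2) (by norm_num) one_pos,
      eventually_log_le_rpow (s := 1 / 2) (by norm_num)] with x h1 h2 h3 h4 h6 h7
    refine ⟨h1, h2, h3, h4, ?_⟩
    calc 4 / l * Real.log x ≤ 4 / l * x ^ (1 / 2 : ℝ) := by gcongr
      _ ≤ x := by linarith
  filter_upwards [tendsto_log_nat.eventually key,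
    tendsto_log_nat.eventually_ge_atTop (-Real.log ξ * 2), eventually_ge_atTop 1]
    with n hkey hξn hn
  obtain ⟨h1, h2, h3, h4, h6⟩ := hkey
  have hn0 : (0 : ℝ) < n := by exact_mod_cast hn
  have hx0 : 0 < Real.log n := by linarith
  refine ⟨h1, h3, ?_, ?_⟩
  · calc 4 * (Real.log (Real.log n) / l) = 4 / l * Real.log (Real.log n) := by ring
      _ ≤ Real.log n := h6
      _ ≤ n := (Real.log_le_sub_one_of_pos hn0).trans (by linarith)
  · rw [div_le_iff₀ hn0]
    have hexp : 2 * (Real.log (Real.log n) / l) * (2 + G * Real.log n ^ (1 - δ)) ≤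
        Real.log n / 2 := by
      have hp : Real.log n ^ (δ / 2) * Real.log n ^ (1 - δ) = Real.log n ^ (1 - δ / 2) := by
        rw [← Real.rpow_add hx0]; ring_nf
      have hone : 1 ≤ Real.log n ^ (1 - δ) := Real.one_le_rpow h1 (by linarith)
      calc _ ≤ 2 * (Real.log n ^ (δ / 2) / l) * ((2 + G) * Real.log n ^ (1 - δ)) := by
            gcongr
            linarith
        _ = 2 / l * (2 + G) * (Real.log n ^ (δ / 2) * Real.log n ^ (1 - δ)) := by ring
        _ ≤ Real.log n / 2 := by rw [hp]; linarith
    calc _ ≤ Real.exp (Real.log n / 2) := Real.exp_le_exp.2 hexp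
      _ ≤ Real.exp (Real.log ξ + Real.log n) := Real.exp_le_exp.2 (by linarith)
      _ = ξ * n := by rw [Real.exp_add, Real.exp_log hξ, Real.exp_log hn0]

theorem law_short_path_le_of_growth {n : ℕ} {d : Fin n → ℕ} {ν : Measure ℝ}
    [IsProbabilityMeasure ν] (hν : ν (Set.Iio 0) = 0) (hn : 0 < n) {A G ρ a e C Y : ℝ} {K : ℕ}
    (hA : 1 ≤ A) (hG : 1 ≤ G) (hρ : 1 < ρ) (ha : 0 ≤ a) (hae : a / (ρ - 1) ≤ e) (hC : 0 ≤ C)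
    (hdeg : ∀ v, 2 ≤ pairedDegree d v) (hcard : (Fintype.card (HalfEdge d) : ℝ) ≤ A * n)
    (hK : 4 * K ≤ Fintype.card (HalfEdge d)) (hY : Real.exp (G * ρ ^ K) ≤ Y)
    (htail : ∀ y : ℝ, 2 ≤ y → y ≤ Y →
      2 / (Fintype.card (HalfEdge d) : ℝ) *
        ∑ z with y < (pairedDegree d z : ℝ), (pairedDegree d z : ℝ) ≤ A * y ^ (-e) ∧
      2 / (Fintype.card (HalfEdge d) : ℝ) *
        ∑ z with (pairedDegree d z : ℝ) ≤ y, (pairedDegree d z : ℝ) ^ 2 ≤ A * y ^ a)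
    (hr : A * Real.exp (-((e - a / (ρ - 1)) * (ρ - 1) * G)) ≤ 1 / 2)
    (hC2 : 2 * Real.exp (-((ρ - 1) * C)) ≤ 1 / 2) :
    law d ν {ω | ¬ ((∀ p : ω.graph.Walk ω.u ω.v,
        2 * ∑ k ∈ Finset.range K, tailQuantile ν (k * Real.log ρ + Real.log (G / (ρ - 1) + G + C)) ≤
          walkWeight ω.weight p) ∧ ∀ p : ω.graph.Walk ω.u ω.v, 2 * K ≤ p.length)} ≤
      ENNReal.ofReal (2 * (A * (A * Real.exp (-(e * G))) +
        A * (2 * (A * Real.exp (-((e - a / (ρ - 1)) * (ρ - 1) * G))))) +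
        Real.exp (2 * K * (2 + G * ρ ^ K)) / n + 2 * (2 * Real.exp (-C))) := by
  have hρ0 : 0 < ρ := by linarith
  have hρ1 : 0 < ρ - 1 := by linarith
  have hn' : (0 : ℝ) < n := by exact_mod_cast hn
  have hA0 : 0 < A := by linarith
  set c₀ := G / (ρ - 1) + G + C with hc₀
  have hc₀0 : 0 < c₀ := by positivity
  -- The thresholds are frozen after `K`, so that the degree estimates, valid only up to `Y`, apply
  -- for every index.
  set y : ℕ → ℝ := fun j => Real.exp (G * ρ ^ min j K) with hydef
  have hyK : ∀ j ≤ K, y j = Real.exp (G * ρ ^ j) := fun j hj => by simp [hydef, min_eq_left hj]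
  have hmono : Monotone y := fun i j hij => Real.exp_le_exp.2 (by
    have := hρ.le
    gcongr)
  have hy2 : ∀ j, 2 ≤ y j := fun j => by
    have h1 : (1 : ℝ) ≤ G * ρ ^ min j K := one_le_mul_of_one_le_of_one_le hG (one_le_pow₀ hρ.le)
    have := Real.add_one_le_exp (G * ρ ^ min j K)
    simp only [hydef]
    linarith
  have hyY : ∀ j, y j ≤ Y := fun j => le_trans (Real.exp_le_exp.2 (by
    have := hρ.le
    gcongr
    exact min_le_right _ _)) hY
  have hmain := law_short_path_le (d := d) (ν := ν) hν hn (y := y)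
    (s := fun j => A * y j ^ a) (b := fun j => A * y j ^ (-e))
    (h := fun k => tailQuantile ν (k * Real.log ρ + Real.log c₀))
    (ξ := fun k => Real.exp (-(c₀ * ρ ^ k))) hmono (fun j => (htail _ (hy2 j) (hyY j)).2)
    (fun j => (htail _ (hy2 j) (hyY j)).1) (K := K) (m := ⌈y K⌉₊) hK
    (fun k hk => (hmono hk).trans (Nat.le_ceil _)) (fun k => tailQuantile_nonneg hν _)
    (fun k => by rw [← quantile_exp_eq _ hc₀0 hρ0]; exact measure_Iio_quantile_le hν (Real.exp_pos _))
    (by linarith [hy2 0])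
  refine hmain.trans (ENNReal.ofReal_le_ofReal ?_)
  have hℓ : (0 : ℝ) ≤ Fintype.card (HalfEdge d) := Nat.cast_nonneg _
  have hS : ∑ k ∈ Finset.range K, (∏ j ∈ Finset.Ico 1 (k + 1), A * y j ^ a) *
      (A * y (k + 1) ^ (-e)) ≤ 2 * (A * Real.exp (-((e - a / (ρ - 1)) * (ρ - 1) * G))) := by
    refine le_trans (Finset.sum_le_sum fun k hk => ?_)
      (sum_pow_succ_le (by positivity) hr K)
    rw [Finset.mem_range] at hk
    rw [hyK (k + 1) hk, Finset.prod_congr rfl fun j hj => by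
      rw [hyK j (by have := Finset.mem_Ico.1 hj; omega)]]
    exact prod_growth_mul_tail_le hA (by linarith) hρ ha hae k
  have hS2 : ∑ k ∈ Finset.range K, (∏ j ∈ Finset.range k, (1 + y j)) * y k *
      Real.exp (-(c₀ * ρ ^ k)) ≤ 2 * Real.exp (-C) := by
    calc _ ≤ ∑ k ∈ Finset.range K, Real.exp (-C) * (2 * Real.exp (-((ρ - 1) * C))) ^ k := by
          refine Finset.sum_le_sum fun k hk => ?_
          rw [Finset.mem_range] at hk
          rw [hyK k hk.le, Finset.prod_congr rfl fun j hj => by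
            rw [hyK j (by have := Finset.mem_range.1 hj; omega)]]
          exact prod_growth_mul_failure_le (by linarith) hρ hC k
      _ ≤ Real.exp (-C) * 2 := by
          rw [← Finset.mul_sum]
          have := sum_pow_le_two (r := 2 * Real.exp (-((ρ - 1) * C))) (by positivity) hC2 K
          gcongr
      _ = _ := mul_comm _ _
  have hcount : ((Finset.univ.filter fun z => y 0 < (pairedDegree d z : ℝ)).card : ℝ) ≤
      Fintype.card (HalfEdge d) * (A * Real.exp (-(e * G))) := by
    have h1 := (htail _ (hy2 0) (hyY 0)).1
    have hcl : (0 : ℝ) < Fintype.card (HalfEdge d) := by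
      rw [card_halfEdge]
      have : 0 < pairedDegree d ⟨0, hn⟩ := by have := hdeg ⟨0, hn⟩; omega
      exact_mod_cast this.trans_le (Finset.single_le_sum (f := fun x => pairedDegree d x)
        (fun _ _ => Nat.zero_le _) (Finset.mem_univ _))
    have h2 : ((Finset.univ.filter fun z => y 0 < (pairedDegree d z : ℝ)).card : ℝ) ≤
        2 * ∑ z with y 0 < (pairedDegree d z : ℝ), (pairedDegree d z : ℝ) := by
      rw [Finset.card_eq_sum_ones, Nat.cast_sum, Finset.mul_sum]
      refine Finset.sum_le_sum fun z _ => ?_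
      have : (2 : ℝ) ≤ pairedDegree d z := by exact_mod_cast hdeg z
      push_cast
      linarith
    have h3 : y 0 ^ (-e) = Real.exp (-(e * G)) := by
      rw [hyK 0 (Nat.zero_le _), pow_zero, mul_one, ← Real.exp_mul]; ring_nf
    rw [h3, div_mul_eq_mul_div, div_le_iff₀ hcl] at h1
    linarith
  have hm : ((1 : ℝ) + ⌈y K⌉₊) ^ (2 * K) ≤ Real.exp (2 * K * (2 + G * ρ ^ K)) := by
    have h1 : (1 : ℝ) + ⌈y K⌉₊ ≤ Real.exp (2 + G * ρ ^ K) := by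
      have h2 := (Nat.ceil_lt_add_one (a := y K) (by linarith [hy2 K])).le
      rw [Real.exp_add, ← hyK K le_rfl]
      have h3 := Real.add_one_le_exp 2
      nlinarith [hy2 K]
    calc _ ≤ Real.exp (2 + G * ρ ^ K) ^ (2 * K) := by gcongr
      _ = _ := by rw [← Real.exp_nat_mul]; push_cast; rfl
  have hfirst : (((Finset.univ.filter fun z => y 0 < (pairedDegree d z : ℝ)).card : ℝ) +
      Fintype.card (HalfEdge d) * ∑ k ∈ Finset.range K,
        (∏ j ∈ Finset.Ico 1 (k + 1), A * y j ^ a) * (A * y (k + 1) ^ (-e))) / n ≤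
      A * (A * Real.exp (-(e * G))) +
        A * (2 * (A * Real.exp (-((e - a / (ρ - 1)) * (ρ - 1) * G)))) := by
    rw [div_le_iff₀ hn']
    calc _ ≤ (Fintype.card (HalfEdge d) : ℝ) * (A * Real.exp (-(e * G))) +
          Fintype.card (HalfEdge d) *
            (2 * (A * Real.exp (-((e - a / (ρ - 1)) * (ρ - 1) * G)))) := by gcongr
      _ ≤ A * n * (A * Real.exp (-(e * G))) +
          A * n * (2 * (A * Real.exp (-((e - a / (ρ - 1)) * (ρ - 1) * G)))) := by gcongr
      _ = _ := by ring
  gcongr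

/-! ### Choice of the parameters in the lower bound -/

section LowerLimit

variable {d : (n : ℕ) → Fin n → ℕ} {τ : ℝ} {ν : Measure ℝ}

theorem tendsto_exp_neg_mul {c : ℝ} (hc : 0 < c) :
    Tendsto (fun G : ℝ => Real.exp (-(c * G))) atTop (𝓝 0) :=
  Real.tendsto_exp_neg_atTop_nhds_zero.comp (tendsto_id.const_mul_atTop hc)

set_option maxHeartbeats 800000 in
theorem eventually_law_short_path_le [IsProbabilityMeasure ν] (hpow : PowerLawTail d τ)
    (hlim : HasLimitingDistributions d) (hν : ν (Set.Iio 0) = 0) (hdiv : NonExplosive ν)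
    {ε ξ : ℝ} (hε : 0 < ε) (hξ : 0 < ξ) :
    ∀ᶠ n : ℕ in atTop, law (d n) ν {ω | ¬ ((∀ p : ω.graph.Walk ω.u ω.v,
        (1 - ε) * typicalDist ν τ n ≤ walkWeight ω.weight p) ∧
        ∀ p : ω.graph.Walk ω.u ω.v, (1 - ε) * (2 * depth τ n) ≤ p.length)} ≤
      ENNReal.ofReal ξ := by
  have h2 : 2 < τ := hpow.1
  have h3 : τ < 3 := hpow.2.1
  set lam := |Real.log (τ - 2)| with hlam
  have hlam0 : 0 < lam := abs_log_pos h2 h3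
  set δ := min ε 1 / 4 with hδ
  have hδ0 : 0 < δ := by positivity
  have hδε : δ ≤ ε / 4 := by have := min_le_left ε 1; linarith
  have hδ1 : δ ≤ 1 / 4 := by have := min_le_right ε 1; linarith
  set l := lam * (1 + δ) with hl
  have hl0 : 0 < l := by positivity
  set ρ := Real.exp l with hρ
  have hlogρ : Real.log ρ = l := Real.log_exp l
  have hρ1 : 1 < ρ := Real.one_lt_exp_iff.2 hl0
  have hρ0 : 0 < ρ := Real.exp_pos l
  have hρτ : 1 < (τ - 2) * ρ := by
    have : (τ - 2) * ρ = Real.exp (lam * δ) := by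
      rw [hρ, hl, mul_add, mul_one, Real.exp_add, exp_abs_log h2 h3]
      have : τ - 2 ≠ 0 := by linarith
      field_simp
    rw [this]
    exact Real.one_lt_exp_iff.2 (by positivity)
  -- With this `η` one has `e * (ρ - 1) - a = (τ - 2) * ρ - 1 - η * ρ`, half of the positive gap `(τ
  -- - 2) * ρ - 1`. The condition `a / (ρ - 1) < e` thus expresses that `ρ` exceeds `1 / (τ - 2)`.
  set η := ((τ - 2) * ρ - 1) / (2 * ρ) with hη
  have hη0 : 0 < η := div_pos (by linarith) (by linarith)
  have hηρ : η * ρ = ((τ - 2) * ρ - 1) / 2 := by rw [hη]; field_simp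
  have hητ : η < τ - 2 := by
    have : η * ρ < (τ - 2) * ρ := by linarith
    exact lt_of_mul_lt_mul_right this hρ0.le
  set e := τ - 2 - η with he
  set a := 3 - τ + η with ha
  have ha0 : 0 ≤ a := by linarith
  have he0 : 0 < e := by linarith
  have hae : a / (ρ - 1) < e := by
    rw [div_lt_iff₀ (by linarith)]
    have : e * (ρ - 1) - a = (τ - 2) * ρ - 1 - η * ρ := by rw [he, ha]; ring
    linarith
  obtain ⟨A₀, hA₀, κ, hκ, htail⟩ := exists_tail_upper hpow hlim hη0 hητ
  obtain ⟨A₁, hA₁, hcard⟩ := exists_card_halfEdge_bounds hpow hlim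
  set A := max A₀ A₁ with hA
  have hA1 : 1 ≤ A := hA₀.trans (le_max_left _ _)
  set w := (e - a / (ρ - 1)) * (ρ - 1) with hw
  have hw0 : 0 < w := mul_pos (by linarith) (by linarith)
  have hGt : Tendsto (fun G => 2 * (A * (A * Real.exp (-(e * G))) +
      A * (2 * (A * Real.exp (-(w * G)))))) atTop (𝓝 0) := by
    have := ((((tendsto_exp_neg_mul he0).const_mul A).const_mul A).add
      ((((tendsto_exp_neg_mul hw0).const_mul A).const_mul 2).const_mul A)).const_mul 2
    simpa using this
  have hGt' : Tendsto (fun G => A * Real.exp (-(w * G))) atTop (𝓝 0) := by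
    simpa using (tendsto_exp_neg_mul hw0).const_mul A
  -- `G` makes exceptional degrees unlikely, and `C` below makes cheap exits unlikely; neither
  -- depends on `n`. The requirement `ρ ≤ C` only ensures that the shift `log c₀` is at least `l`.
  obtain ⟨G, hG1, hGξ, hGr⟩ := ((eventually_ge_atTop (1 : ℝ)).and
    ((hGt.eventually_le_const (show (0 : ℝ) < ξ / 3 by positivity)).and
      (hGt'.eventually_le_const (show (0 : ℝ) < 1 / 2 by norm_num)))).exists
  have hCt : Tendsto (fun C : ℝ => 2 * (2 * Real.exp (-C))) atTop (𝓝 0) := by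
    simpa using ((Real.tendsto_exp_neg_atTop_nhds_zero).const_mul 2).const_mul 2
  have hCt' : Tendsto (fun C => 2 * Real.exp (-((ρ - 1) * C))) atTop (𝓝 0) := by
    simpa using (tendsto_exp_neg_mul (show 0 < ρ - 1 by linarith)).const_mul 2
  obtain ⟨C, hCρ, hCξ, hC2⟩ := ((eventually_ge_atTop ρ).and
    ((hCt.eventually_le_const (show (0 : ℝ) < ξ / 3 by positivity)).and
      (hCt'.eventually_le_const (show (0 : ℝ) < 1 / 2 by norm_num)))).exists
  set c₀ := G / (ρ - 1) + G + C with hc₀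
  have hc₀ρ : ρ ≤ c₀ := by
    have : 0 < G / (ρ - 1) := div_pos (by linarith) (by linarith)
    linarith
  have hlogc : l ≤ Real.log c₀ := by rw [← hlogρ]; exact Real.log_le_log hρ0 hc₀ρ
  set I := primitive (tailQuantile ν) with hI
  have hanti := tailQuantile_antitone (ν := ν) hν
  have hImono : Monotone I := primitive_mono hanti (tailQuantile_nonneg hν)
  have hA₀A : A₀ ≤ A := le_max_left _ _
  have hA₁A : A₁ ≤ A := le_max_right _ _
  rw [hw] at hGr hGξ
  clear_value w e a η ρ δ A lam c₀
  filter_upwards [htail, hcard, eventually_gt_atTop 0,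
    eventually_growth_bounds (G := G) (l := l) (δ := δ) (κ := κ) (ξ := ξ / 3) (by linarith) hl0 hδ0
      (by linarith) hκ (by positivity),
    (tendsto_typicalDist hν hdiv h2 h3).eventually_ge_atTop (2 * (2 * I (Real.log c₀) / l) / ε),
    (tendsto_depth h2 h3).eventually_ge_atTop (2 / ε),
    tendsto_log_log_nat.eventually_ge_atTop 0] with n htail hcard hn hgrowth htyp hdep hL0
  obtain ⟨hdeg, hnl, hln⟩ := hcard
  obtain ⟨hx1, hGκ, h4K, hmeet⟩ := hgrowth
  have hn' : (0 : ℝ) < n := by exact_mod_cast hn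
  set L := Real.log (Real.log n) with hL
  -- Stopping at a fraction `1 - δ` of the depth keeps `ρ ^ K` below `(log n) ^ (1 - δ)`, so the
  -- balls have size `n ^ o(1)` and stay disjoint.
  set K := ⌊(1 - δ) * L / l⌋₊ with hK
  have hKle : (K : ℝ) ≤ (1 - δ) * L / l :=
    Nat.floor_le (div_nonneg (mul_nonneg (by linarith) hL0) hl0.le)
  have hKL : (K : ℝ) ≤ L / l := 
    hKle.trans (div_le_div_of_nonneg_right (mul_le_of_le_one_left hL0 (by linarith)) hl0.le)
  have hKge : (1 - δ) * L / l - 1 ≤ K := by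
    have := Nat.lt_floor_add_one ((1 - δ) * L / l)
    linarith
  have hρK : ρ ^ K ≤ Real.log n ^ (1 - δ) := by
    rw [hρ, ← Real.exp_nat_mul, Real.rpow_def_of_pos (by linarith)]
    refine Real.exp_le_exp.2 ?_
    rw [le_div_iff₀ hl0] at hKle
    linarith
  have hmain := law_short_path_le_of_growth (d := d n) (ν := ν) hν hn (A := A) (G := G) (ρ := ρ)
    (a := a) (e := e) (C := C) (Y := (n : ℝ) ^ κ) (K := K) hA1 hG1 hρ1 ha0 hae.le (by linarith) hdeg
    (hln.trans (by gcongr))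
    (by
      have : (4 * K : ℝ) ≤ Fintype.card (HalfEdge (d n)) := by
        refine le_trans ?_ hnl
        linarith
      exact_mod_cast this)
    (by
      rw [Real.rpow_def_of_pos hn']
      refine Real.exp_le_exp.2 (le_trans ?_ (hGκ.trans (le_of_eq (mul_comm _ _))))
      gcongr)
    (fun y hy hyY => by
      obtain ⟨t1, t2⟩ := htail y hy hyY
      rw [show -(τ - 2) + η = -e by rw [he]; ring] at t1
      rw [← ha] at t2
      have hy0 : 0 ≤ y := by linarith
      exact ⟨t1.trans (mul_le_mul_of_nonneg_right hA₀A (Real.rpow_nonneg hy0 _)),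
        t2.trans (mul_le_mul_of_nonneg_right hA₀A (Real.rpow_nonneg hy0 _))⟩)
    hGr hC2
  refine (measure_mono ?_).trans (hmain.trans (ENNReal.ofReal_le_ofReal ?_))
  · intro ω hω hcon
    refine hω ⟨fun p => le_trans ?_ (hcon.1 p), fun p => le_trans ?_
      (show ((2 * K : ℕ) : ℝ) ≤ _ by exact_mod_cast hcon.2 p)⟩
    · have hsum := primitive_sub_le hanti (c := Real.log c₀) hl0 K
      rw [hlogρ, ← hc₀]
      have hIL : (1 - δ) * I L ≤ I (Real.log c₀ + K * l) := by
        refine (mul_primitive_le hanti hL0 (by linarith) (by linarith)).trans (hImono ?_)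
        have : ((1 - δ) * L / l - 1) * l ≤ K * l := mul_le_mul_of_nonneg_right hKge hl0.le
        rw [sub_mul, div_mul_cancel₀ _ hl0.ne', one_mul] at this
        linarith
      have htle := typicalDist_le (ν := ν) hν h2 h3 hL0
      set T := typicalDist ν τ n
      have hT : T * lam ≤ 2 * I L := by
        have : 2 * (I L / lam) * lam = 2 * I L := by field_simp
        rw [← hlam] at htle
        have := mul_le_mul_of_nonneg_right htle hlam0.le
        linarith
      have hS : (1 - δ) * I L - I (Real.log c₀) ≤
          (∑ i ∈ Finset.range K, tailQuantile ν (i * l + Real.log c₀)) * l := by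
        rw [div_le_iff₀ hl0] at hsum
        linarith
      set S := ∑ i ∈ Finset.range K, tailQuantile ν (i * l + Real.log c₀)
      have hTe : 2 * (2 * I (Real.log c₀)) ≤ T * ε * l := by
        rw [div_le_iff₀ hε, mul_div_assoc', div_le_iff₀ hl0] at htyp
        linarith
      have hI0 : 0 ≤ I (Real.log c₀) := by
        have := hImono (hl0.le.trans hlogc)
        simpa [hI, primitive] using this
      have hT0 : 0 ≤ T := by
        have : 0 ≤ T * (ε * l) := by linarith
        exact nonneg_of_mul_nonneg_left this (by positivity)
      have hfin : (1 - ε) * T * l ≤ 2 * S * l := by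
        have h5 : (1 - δ) * (T * lam) ≤ (1 - δ) * (2 * I L) :=
          mul_le_mul_of_nonneg_left hT (by linarith)
        -- The larger mesh and the early stop together cost at most a factor `1 - ε / 2`, as `δ ≤ ε
        -- / 4`. The other half of `ε` pays for the shift by `log c₀`, which is bounded while the
        -- typical distance diverges.
        have h6 : (1 - ε / 2) * (1 + δ) ≤ 1 - δ := by linarith [mul_pos hε hδ0]
        have h7 : (1 - ε / 2) * (1 + δ) * (T * lam) ≤ (1 - δ) * (T * lam) :=
          mul_le_mul_of_nonneg_right h6 (by positivity)
        have h8 : (1 - ε / 2) * (1 + δ) * (T * lam) = (1 - ε / 2) * T * l := by rw [hl]; ring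
        linarith
      exact le_of_mul_le_mul_right hfin hl0
    · push_cast
      have hd : depth τ n * lam = L := by rw [depth, ← hlam, div_mul_cancel₀ _ hlam0.ne']
      have hd0 : 0 ≤ depth τ n := by rw [depth, ← hlam]; exact div_nonneg hL0 hlam0.le
      have h6 : (1 - ε / 2) * (1 + δ) ≤ 1 - δ := by linarith [mul_pos hε hδ0]
      have h9 : (1 - ε / 2) * depth τ n ≤ (1 - δ) * L / l := by
        rw [le_div_iff₀ hl0, ← hd, hl]
        have := mul_le_mul_of_nonneg_right h6 (show 0 ≤ depth τ n * lam by positivity)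
        linarith
      rw [div_le_iff₀ hε] at hdep
      linarith
  · have hlast : Real.exp (2 * K * (2 + G * ρ ^ K)) / n ≤ ξ / 3 := by
      refine le_trans ?_ hmeet
      gcongr
    linarith

end LowerLimit

/-! ### The upper bound along a doubly exponential sequence of degrees -/

theorem one_sub_pow_le_exp {x : ℝ} (hx : x ≤ 1) (j : ℕ) :
    (1 - x) ^ j ≤ Real.exp (-(x * j)) := by
  calc (1 - x) ^ j ≤ Real.exp (-x) ^ j := by
        have : 0 ≤ 1 - x := by linarith
        gcongr
        exact Real.one_sub_le_exp_neg x
    _ = _ := by rw [← Real.exp_nat_mul]; ring_nf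

theorem exp_neg_const_mul_exp_le {c z : ℝ} (hc : 0 < c) :
    Real.exp (-(c * Real.exp z)) ≤ Real.exp (-z) / c := by
  have h1 : c * Real.exp z ≤ Real.exp (c * Real.exp z) :=
    (by linarith : c * Real.exp z ≤ c * Real.exp z + 1).trans (Real.add_one_le_exp _)
  rw [Real.exp_neg, Real.exp_neg, ← one_div, ← one_div, div_div,
    div_le_div_iff₀ (Real.exp_pos _) (by positivity)]
  linarith

/-- With `g = G * ρ ^ i`, the expected numbers of successes `p * q * j` and `q * r` are at least of
order `exp (η * g)`; for the first this needs `s + 2 * η ≤ 1`. Failure is then at most a constant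
times `exp (-η * g)`, which is summable over the stages. -/
theorem stage_failure_le {A G ρ η s : ℝ} (hA : 1 ≤ A) (hG : 3 ≤ G) (hρ : 1 < ρ) (hη : 0 < η)
    (hs : 0 ≤ s) (hsη : s + 2 * η ≤ 1) (i : ℕ) :
    (1 - Real.exp (-(s * G * ρ ^ i)) / (2 * A ^ 2) * Real.exp (-(η * G * ρ ^ i))) ^
        ⌊Real.exp (G * ρ ^ i) / 4⌋₊ +
      (1 - Real.exp (-(η * G * ρ ^ i))) ^ ⌈Real.exp (2 * η * (G * ρ ^ i))⌉₊ ≤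
    32 * A ^ 2 * Real.exp (-(η * G)) * Real.exp (-(η * G * (ρ - 1))) ^ i := by
  have hρi : 1 ≤ ρ ^ i := one_le_pow₀ hρ.le
  set g := G * ρ ^ i with hg
  have hg3 : 3 ≤ g := by nlinarith
  have hA2 : 1 ≤ A ^ 2 := one_le_pow₀ hA
  have hE8 : 8 ≤ Real.exp g := by
    have h1 : (2 : ℝ) ^ 3 ≤ Real.exp 1 ^ 3 := by
      have := Real.add_one_le_exp 1
      gcongr
      linarith
    rw [← Real.exp_nat_mul] at h1
    have h2 : Real.exp 3 ≤ Real.exp g := Real.exp_le_exp.2 hg3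
    norm_num at h1
    linarith
  have hj : Real.exp g / 8 ≤ (⌊Real.exp g / 4⌋₊ : ℝ) := by
    have := Nat.lt_floor_add_one (Real.exp g / 4)
    linarith
  rw [show s * G * ρ ^ i = s * g by rw [hg]; ring, show η * G * ρ ^ i = η * g by rw [hg]; ring]
  have hle1 : ∀ x : ℝ, 0 ≤ x → Real.exp (-x) ≤ 1 := fun x hx => Real.exp_le_one_iff.2 (by linarith)
  have e1 := hle1 (s * g) (by positivity)
  have e2 := hle1 (η * g) (by positivity)
  have hpow : Real.exp (-(η * g)) ≤ Real.exp (-(η * G)) * Real.exp (-(η * G * (ρ - 1))) ^ i := by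
    rw [← Real.exp_nat_mul, ← Real.exp_add]
    refine Real.exp_le_exp.2 ?_
    have := mul_sub_one_le_pow hρ.le i
    have h4 : η * G * (1 + i * (ρ - 1)) ≤ η * G * ρ ^ i := by gcongr
    rw [hg]
    linarith
  have h1 : (1 - Real.exp (-(s * g)) / (2 * A ^ 2) * Real.exp (-(η * g))) ^
      ⌊Real.exp g / 4⌋₊ ≤ 16 * A ^ 2 * Real.exp (-(η * g)) := by
    have hx1 : Real.exp (-(s * g)) / (2 * A ^ 2) * Real.exp (-(η * g)) ≤ 1 := by
      have : Real.exp (-(s * g)) / (2 * A ^ 2) ≤ 1 := by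
        rw [div_le_one (by positivity)]; linarith
      exact mul_le_one₀ this (Real.exp_pos _).le e2
    refine (one_sub_pow_le_exp hx1 _).trans ?_
    have hprod : 1 / (16 * A ^ 2) * Real.exp (η * g) ≤
        Real.exp (-(s * g)) / (2 * A ^ 2) * Real.exp (-(η * g)) * ⌊Real.exp g / 4⌋₊ := by
      calc 1 / (16 * A ^ 2) * Real.exp (η * g) ≤
            1 / (16 * A ^ 2) * Real.exp (-(s * g) + -(η * g) + g) := by
            gcongr
            nlinarith
        _ = Real.exp (-(s * g)) / (2 * A ^ 2) * Real.exp (-(η * g)) * (Real.exp g / 8) := by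
            rw [Real.exp_add, Real.exp_add]
            field_simp
            ring
        _ ≤ _ := by gcongr
    refine (Real.exp_le_exp.2 (neg_le_neg hprod)).trans
      ((exp_neg_const_mul_exp_le (by positivity)).trans (le_of_eq ?_))
    field_simp
  have h2 : (1 - Real.exp (-(η * g))) ^ ⌈Real.exp (2 * η * g)⌉₊ ≤ Real.exp (-(η * g)) := by
    refine (one_sub_pow_le_exp e2 _).trans ?_
    have hprod : 1 * Real.exp (η * g) ≤ Real.exp (-(η * g)) * ⌈Real.exp (2 * η * g)⌉₊ := by
      calc 1 * Real.exp (η * g) = Real.exp (-(η * g)) * Real.exp (2 * η * g) := by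
            rw [← Real.exp_add]; ring_nf
        _ ≤ _ := by gcongr; exact Nat.le_ceil _
    refine (Real.exp_le_exp.2 (neg_le_neg hprod)).trans
      ((exp_neg_const_mul_exp_le one_pos).trans (le_of_eq (div_one _)))
  have hfin : (16 * A ^ 2 + 1) * Real.exp (-(η * g)) ≤ 32 * A ^ 2 * (Real.exp (-(η * G)) *
      Real.exp (-(η * G * (ρ - 1))) ^ i) := by
    gcongr
    linarith
  linarith

theorem law_no_cheap_path_le_of_growth {n : ℕ} {d : Fin n → ℕ} {ν : Measure ℝ}
    [IsProbabilityMeasure ν] (hν : ν (Set.Iio 0) = 0) (hn : 0 < n) {A G ρ η τ H M κ : ℝ} {K t₀ : ℕ}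
    {hub : Fin n} (hA : 1 ≤ A) (hG : 3 ≤ G) (hρ : 1 < ρ) (hη : 0 < η) (hτ : 2 < τ) (hM : 0 ≤ M)
    (hκ : 0 ≤ κ) (hs : (τ - 2 + η) * ρ + 2 * η ≤ 1)
    (hr : Real.exp (-(η * G * (ρ - 1))) ≤ 1 / 2)
    (hdeg : ∀ v, 2 ≤ pairedDegree d v) (hcard : (Fintype.card (HalfEdge d) : ℝ) ≤ A * n)
    (hhub : H ≤ pairedDegree d hub) (hK1 : Real.exp (G * ρ ^ K) ≤ H)
    (hK2 : H ≤ Real.exp (G * ρ ^ (K + 1)))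
    (hcount : ∀ x : ℝ, 1 ≤ x → x ≤ H → n * x ^ (-(τ - 1) - η) ≤
      A * ((Finset.univ.filter fun v => x ≤ (pairedDegree d v : ℝ)).card : ℝ))
    (hroom : 2 * A * (2 + (K + 1) * (H ^ (2 * η) + 1)) ≤ n * H ^ (-(τ - 1) - η))
    (hκ' : pairedDegree d hub + (t₀ + 1) * Real.exp G ≤
      κ * (Fintype.card (HalfEdge d) - 1 - (pairedDegree d hub + (t₀ + 1) * Real.exp G))) :
    law d ν {ω | ¬ ∃ p : ω.graph.Path ω.u ω.v,
        walkWeight ω.weight p.1 ≤ 2 * (t₀ * M + (∑ k ∈ Finset.range (K + 1),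
          tailQuantile ν (k * Real.log ρ + Real.log (η * G)) + M)) ∧
        p.1.length ≤ 2 * (t₀ + (K + 2))} ≤
      ENNReal.ofReal (2 * ((1 - Real.exp (-((τ - 1 + η) * G)) / (2 * A ^ 2)) ^ t₀ +
        t₀ * (ν.real (Set.Ioi M) + κ) +
        (64 * A ^ 2 * Real.exp (-(η * G)) + ν.real (Set.Ioi M))) +
        n * Real.exp (-(H ^ 2 / (4 * A * n)))) := by
  have hρ0 : 0 < ρ := by linarith
  have hn' : (0 : ℝ) < n := by exact_mod_cast hn
  have hA0 : 0 < A := by linarith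
  have hA2 : 1 ≤ A ^ 2 := one_le_pow₀ hA
  have hηG : 0 < η * G := by positivity
  have hE4 : 4 ≤ Real.exp G := by linarith [Real.add_one_le_exp G]
  have hEH : Real.exp G ≤ H := le_trans (Real.exp_le_exp.2
    (le_mul_of_one_le_right (by linarith) (one_le_pow₀ hρ.le))) hK1
  have hH0 : 0 < H := by linarith
  set ℓ : ℝ := (Fintype.card (HalfEdge d) : ℝ) with hℓ
  have hdℓ : ∀ v, (pairedDegree d v : ℝ) ≤ ℓ := fun v => by
    rw [hℓ, card_halfEdge]
    exact_mod_cast Finset.single_le_sum (f := fun x => pairedDegree d x)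
      (fun _ _ => Nat.zero_le _) (Finset.mem_univ v)
  have hℓ0 : 0 < ℓ := hH0.trans_le (hhub.trans (hdℓ hub))
  set V : ℝ → Finset (Fin n) := fun x => Finset.univ.filter fun z => x ≤ (pairedDegree d z : ℝ)
    with hV
  -- Cutting at `H` makes the last threshold equal to `H`, so that stage `K` ends at a vertex with
  -- enough half-edges to be joined to the hub.
  set Y : ℕ → ℝ := fun i => min (Real.exp (G * ρ ^ i)) H with hY
  have hYmono : Monotone Y := fun i j hij => min_le_min_right _ (Real.exp_le_exp.2 (by
    have := hρ.le
    have : 0 ≤ G := by linarith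
    gcongr))
  have hYle : ∀ i ≤ K, Y i = Real.exp (G * ρ ^ i) := fun i hi => min_eq_left (le_trans
    (Real.exp_le_exp.2 (by
      have := hρ.le
      have : 0 ≤ G := by linarith
      gcongr)) hK1)
  have hY4 : ∀ i, 4 ≤ Y i := fun i => hE4.trans (le_min (Real.exp_le_exp.2
    (le_mul_of_one_le_right (by linarith) (one_le_pow₀ hρ.le))) hEH)
  have hYN : Y (K + 1) = H := min_eq_right hK2
  have hY00 : Y 0 = Real.exp G := by rw [hYle 0 (Nat.zero_le _), pow_zero, mul_one]
  set r : ℕ → ℕ := fun k => ⌈Real.exp (2 * η * (G * ρ ^ k))⌉₊ with hrdef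
  set R := 2 + ∑ k ∈ Finset.range (K + 1), r k with hR
  have hRle : (R : ℝ) ≤ 2 + (K + 1) * (H ^ (2 * η) + 1) := by
    have hb : ∀ k ∈ Finset.range (K + 1), (r k : ℝ) ≤ H ^ (2 * η) + 1 := by
      intro k hk
      have hkK : k ≤ K := by have := Finset.mem_range.1 hk; omega
      refine (Nat.ceil_lt_add_one (Real.exp_pos _).le).le.trans ?_
      rw [mul_comm (2 * η), Real.exp_mul]
      gcongr
      rw [← hYle k hkK]
      exact min_le_right _ _
    have := Finset.sum_le_card_nsmul _ _ _ hb
    rw [Finset.card_range, nsmul_eq_mul] at this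
    rw [hR]
    push_cast at this ⊢
    linarith
  -- There are twice as many vertices above each threshold as the exploration may ever use up, so
  -- half of them always remain as targets. It suffices to know this at `H`, where the lower bound
  -- on their number is smallest.
  have hVlow : ∀ x, 1 ≤ x → x ≤ H → 2 * (R : ℝ) ≤ (V x).card ∧
      n * x ^ (-(τ - 1) - η) ≤ A * ((V x).card : ℝ) := by
    intro x hx hxH
    refine ⟨?_, hcount x hx hxH⟩
    have h1 : n * H ^ (-(τ - 1) - η) ≤ n * x ^ (-(τ - 1) - η) :=
      mul_le_mul_of_nonneg_left
        (Real.rpow_le_rpow_of_nonpos (by linarith) hxH (by linarith)) hn'.le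
    have h2 := hcount x hx hxH
    have h3 : A * (2 * (R : ℝ)) ≤ A * ((V x).card : ℝ) := by
      have := mul_le_mul_of_nonneg_left hRle hA0.le
      linarith
    exact le_of_mul_le_mul_left h3 hA0
  have hsdiff : ∀ x, 1 ≤ x → x ≤ H → ∀ B : Finset (Fin n), (B ∩ V x).card ≤ R →
      n * x ^ (-(τ - 1) - η) / (2 * A) * x ≤ ∑ z ∈ V x \ B, (pairedDegree d z : ℝ) := by
    intro x hx hxH B hB
    obtain ⟨h1, h2⟩ := hVlow x hx hxH
    have h3 : ((V x).card : ℝ) ≤ (V x \ B).card + (B ∩ V x).card := by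
      have := Finset.card_sdiff_add_card_inter (V x) B
      rw [Finset.inter_comm] at this
      exact_mod_cast this.ge
    have h4 : ((B ∩ V x).card : ℝ) ≤ R := by exact_mod_cast hB
    have h5 : (V x \ B).card • x ≤ ∑ z ∈ V x \ B, (pairedDegree d z : ℝ) :=
      Finset.card_nsmul_le_sum _ _ _ fun z hz =>
        (Finset.mem_filter.1 (Finset.mem_sdiff.1 hz).1).2
    rw [nsmul_eq_mul] at h5
    refine le_trans ?_ h5
    gcongr
    rw [div_le_iff₀ (by positivity)]
    nlinarith
  have hpcommon : ∀ x, 1 ≤ x → x ≤ H → ∀ t, x ≤ Real.exp t →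
      Real.exp (-((τ - 2 + η) * t)) / (2 * A ^ 2) * ℓ ≤
        n * x ^ (-(τ - 1) - η) / (2 * A) * x := by
    intro x hx hxH t hxt
    have hx0 : 0 < x := by linarith
    have h1 : x ^ (-(τ - 1) - η) * x = x ^ (-(τ - 2 + η)) := by
      rw [← Real.rpow_add_one hx0.ne']; ring_nf
    have h2 : Real.exp (-((τ - 2 + η) * t)) ≤ x ^ (-(τ - 2 + η)) := by
      rw [Real.rpow_def_of_pos hx0]
      refine Real.exp_le_exp.2 ?_
      have : Real.log x ≤ t := (Real.log_le_iff_le_exp hx0).2 hxt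
      nlinarith
    calc Real.exp (-((τ - 2 + η) * t)) / (2 * A ^ 2) * ℓ ≤
          x ^ (-(τ - 2 + η)) / (2 * A ^ 2) * (A * n) := by gcongr
      _ = n * (x ^ (-(τ - 1) - η) * x) / (2 * A) := by rw [h1]; field_simp
      _ = _ := by ring
  -- Here `q k` is the level of the quantile `c k`, and `p k` is the proportion of half-edges at
  -- degree at least `Y (k + 1)`, expressed through `ρ ^ k`. A quarter of the degree is available as
  -- `j k`, because a reveal may consume two half-edges and one was used on arrival.
  have hmain := law_no_cheap_path_le (d := d) (ν := ν) hν (hub := hub) hdeg hM (N := K + 1) (Y := Y)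
    (c := fun k => tailQuantile ν (k * Real.log ρ + Real.log (η * G)))
    (q := fun k => Real.exp (-(η * G * ρ ^ k)))
    (p := fun k => Real.exp (-((τ - 2 + η) * ρ * G * ρ ^ k)) / (2 * A ^ 2))
    (j := fun k => ⌊Real.exp (G * ρ ^ k) / 4⌋₊) (r := r) (R := R) (jhub := ⌊H / 2⌋₊) (t₀ := t₀)
    (p₀ := Real.exp (-((τ - 1 + η) * G)) / (2 * A ^ 2)) (κ := κ)
    (by linarith [hY4 0]) (fun i _ => tailQuantile_nonneg hν _) (fun i _ => hYmono (Nat.le_succ i))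
    (fun i hi => by
      have h1 := Nat.floor_le (show 0 ≤ Real.exp (G * ρ ^ i) / 4 by positivity)
      rw [← hYle i (by omega)] at h1 ⊢
      linarith [hY4 i])
    (fun i _ => (Real.exp_pos _).le)
    (fun i _ => by
      rw [← quantile_exp_eq _ hηG hρ0]
      refine le_measure_Iic_quantile (Real.exp_lt_one_iff.2 (neg_lt_zero.2 (by positivity))))
    (fun i _ => by positivity)
    (fun i _ => by
      have hτ2 : 0 < τ - 2 + η := by linarith
      rw [div_le_one (by positivity)]
      have : Real.exp (-((τ - 2 + η) * ρ * G * ρ ^ i)) ≤ 1 :=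
        Real.exp_le_one_iff.2 (neg_nonpos.2 (by positivity))
      linarith)
    (fun i _ B hB => by
      have h1 : 1 ≤ Y (i + 1) := by linarith [hY4 (i + 1)]
      have h2 : Y (i + 1) ≤ H := min_le_right _ _
      refine le_trans ?_ (hsdiff _ h1 h2 B hB)
      have := hpcommon _ h1 h2 (G * ρ ^ (i + 1)) (min_le_left _ _)
      rwa [show (τ - 2 + η) * (G * ρ ^ (i + 1)) = (τ - 2 + η) * ρ * G * ρ ^ i by ring] at this)
    le_rfl (by positivity)
    (by
      rw [div_le_one (by positivity)]
      have : Real.exp (-((τ - 1 + η) * G)) ≤ 1 :=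
        Real.exp_le_one_iff.2 (neg_nonpos.2 (mul_nonneg (by linarith) (by linarith)))
      linarith)
    hκ
    (by
      have h1 : 1 ≤ Y 0 := by linarith [hY4 0]
      have h2 : Y 0 ≤ H := min_le_right _ _
      rw [Finset.erase_eq]
      refine le_trans ?_ (hsdiff _ h1 h2 {hub} (le_trans (Finset.card_le_card
        Finset.inter_subset_left) (by rw [Finset.card_singleton]; omega)))
      have := hpcommon _ h1 h2 G hY00.le
      refine le_trans ?_ this
      gcongr
      linarith)
    (by rw [hY00]; exact hκ')
    (by
      have := Nat.floor_le (show 0 ≤ H / 2 by positivity)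
      rw [hYN]
      linarith)
  refine hmain.trans (ENNReal.ofReal_le_ofReal ?_)
  have hsum : ∑ k ∈ Finset.range (K + 1),
      ((1 - Real.exp (-((τ - 2 + η) * ρ * G * ρ ^ k)) / (2 * A ^ 2) *
        Real.exp (-(η * G * ρ ^ k))) ^ ⌊Real.exp (G * ρ ^ k) / 4⌋₊ +
        (1 - Real.exp (-(η * G * ρ ^ k))) ^ r k) ≤ 64 * A ^ 2 * Real.exp (-(η * G)) := by
    calc _ ≤ ∑ k ∈ Finset.range (K + 1),
          32 * A ^ 2 * Real.exp (-(η * G)) * Real.exp (-(η * G * (ρ - 1))) ^ k :=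
          Finset.sum_le_sum fun k _ => stage_failure_le hA hG hρ hη
            (mul_nonneg (by linarith) hρ0.le) hs k
      _ ≤ 32 * A ^ 2 * Real.exp (-(η * G)) * 2 := by
          rw [← Finset.mul_sum]
          have := sum_pow_le_two (Real.exp_pos _).le hr (K + 1)
          gcongr
      _ = _ := by ring
  have hlast : (1 - (pairedDegree d hub : ℝ) / ℓ) ^ ⌊H / 2⌋₊ ≤
      Real.exp (-(H ^ 2 / (4 * A * n))) := by
    -- About `H / 4` reveals, each hitting the hub with probability at least `H / (A * n)`; this is
    -- useful once `H ^ 2` exceeds `n` by a power.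
    refine (one_sub_pow_le_exp ((div_le_one hℓ0).2 (hdℓ hub)) _).trans
      (Real.exp_le_exp.2 (neg_le_neg ?_))
    have h1 : H / 4 ≤ (⌊H / 2⌋₊ : ℝ) := by
      have := Nat.lt_floor_add_one (H / 2)
      linarith
    calc H ^ 2 / (4 * A * n) = H / (A * n) * (H / 4) := by field_simp
      _ ≤ pairedDegree d hub / ℓ * ⌊H / 2⌋₊ := by gcongr
  gcongr

section UpperLimit

variable {d : (n : ℕ) → Fin n → ℕ} {τ : ℝ} {ν : Measure ℝ}

/-! ### The upper bound as the number of vertices tends to infinity -/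

theorem eventually_const_mul_le_exp (c : ℝ) {γ : ℝ} (hγ : 0 < γ) :
    ∀ᶠ x : ℝ in atTop, c * x ≤ Real.exp (γ * x) := by
  have h := (isLittleO_rpow_exp_pos_mul_atTop 1 hγ).const_mul_left c
  filter_upwards [h.bound one_pos] with x hx
  rw [Real.rpow_one, one_mul, Real.norm_of_nonneg (Real.exp_pos _).le] at hx
  exact (le_abs_self _).trans hx

theorem exists_measure_Ioi_le [IsProbabilityMeasure ν] {ξ : ℝ} (hξ : 0 < ξ) :
    ∃ M : ℝ, 0 ≤ M ∧ ν.real (Set.Ioi M) ≤ ξ := by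
  have h : Tendsto (fun M => 1 - cdf ν M) atTop (𝓝 0) := by
    simpa using (tendsto_cdf_atTop ν).const_sub 1
  obtain ⟨M, hM, hMξ⟩ := ((eventually_ge_atTop 0).and (h.eventually_le_const hξ)).exists
  refine ⟨M, hM, ?_⟩
  rwa [← Set.compl_Iic, probReal_compl_eq_one_sub measurableSet_Iic, ← cdf_eq_real]

/-- Two conditions on `β` meet here. `β > 1 / 2` makes vertices of degree `n ^ β` adjacent to the
hub. `β * (τ - 1 + 3 * η) < 1` leaves far more such vertices than the exploration of about `log log
n` stages can use up. -/
theorem eventually_room {A β η l G ξ : ℝ} (hβ : 1 / 2 < β) (hβη : β * (τ - 1 + 3 * η) < 1)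
    (hA : 1 ≤ A) (hl : 0 < l) (hη : 0 < η) (hξ : 0 < ξ) :
    ∀ᶠ n : ℕ in atTop, G ≤ β * Real.log n ∧ 1 ≤ Real.log n ∧
      (∀ K : ℕ, (K : ℝ) ≤ Real.log (Real.log n) / l →
        2 * A * (2 + (K + 1) * (((n : ℝ) ^ β) ^ (2 * η) + 1)) ≤
          n * ((n : ℝ) ^ β) ^ (-(τ - 1) - η)) ∧
      n * Real.exp (-(((n : ℝ) ^ β) ^ 2 / (4 * A * n))) ≤ ξ := by
  have hγ : 0 < 1 - β * (τ - 1 + 3 * η) := by linarith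
  have hγ' : 0 < 2 * β - 1 := by linarith
  filter_upwards [tendsto_log_nat.eventually_ge_atTop (G / β),
    tendsto_log_nat.eventually_ge_atTop 1,
    tendsto_log_nat.eventually (eventually_const_mul_le_exp (2 * A * (2 / l + 4)) hγ),
    tendsto_log_nat.eventually (eventually_const_mul_le_exp (4 * A * (1 + |Real.log ξ|)) hγ'),
    eventually_gt_atTop 0] with n h1 h2 h3 h4 hn
  have hn' : (0 : ℝ) < n := by exact_mod_cast hn
  have hpow : ∀ s : ℝ, Real.exp (s * Real.log n) = (n : ℝ) ^ s := fun s => by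
    rw [Real.rpow_def_of_pos hn', mul_comm]
  rw [hpow] at h3 h4
  rw [div_le_iff₀' (by linarith)] at h1
  refine ⟨h1, h2, fun K hK => ?_, ?_⟩
  · have hE : n * ((n : ℝ) ^ β) ^ (-(τ - 1) - η) =
        (n : ℝ) ^ (1 - β * (τ - 1 + 3 * η)) * ((n : ℝ) ^ β) ^ (2 * η) := by
      rw [← Real.rpow_mul hn'.le, ← Real.rpow_mul hn'.le, ← Real.rpow_add hn',
        ← Real.rpow_one_add' hn'.le]
      · congr 1; ring
      · intro h0
        have : β * η * 2 > 0 := by positivity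
        nlinarith
    have hH1 : 1 ≤ ((n : ℝ) ^ β) ^ (2 * η) := by
      have : (1 : ℝ) ≤ n := by exact_mod_cast hn
      exact Real.one_le_rpow (Real.one_le_rpow this (by linarith)) (by linarith)
    have hLx : Real.log (Real.log n) ≤ Real.log n := Real.log_le_self (by linarith)
    have hK' : 2 * A * (2 * K + 4) ≤ 2 * A * (2 / l + 4) * Real.log n := by
      have : (K : ℝ) ≤ Real.log n / l := hK.trans (by gcongr)
      calc 2 * A * (2 * K + 4) ≤ 2 * A * (2 * (Real.log n / l) + 4 * Real.log n) := by
            gcongr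
            linarith
        _ = _ := by ring
    rw [hE]
    set P := ((n : ℝ) ^ β) ^ (2 * η)
    calc 2 * A * (2 + (K + 1) * (P + 1)) ≤ 2 * A * (2 * P + (K + 1) * (P + P)) := by
          gcongr
          linarith
      _ = 2 * A * (2 * K + 4) * P := by ring
      _ ≤ _ := by
          gcongr
          exact hK'.trans h3
  · have hE : ((n : ℝ) ^ β) ^ 2 / (4 * A * n) = (n : ℝ) ^ (2 * β - 1) / (4 * A) := by
      rw [Real.rpow_sub_one hn'.ne', mul_comm 2 β, Real.rpow_mul hn'.le, Real.rpow_two]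
      field_simp
    rw [hE]
    have h5 : Real.log n - Real.log ξ ≤ (n : ℝ) ^ (2 * β - 1) / (4 * A) := by
      rw [le_div_iff₀ (by positivity)]
      have h6 : -Real.log ξ ≤ |Real.log ξ| * Real.log n :=
        (neg_le_abs _).trans (le_mul_of_one_le_right (abs_nonneg _) h2)
      calc (Real.log n - Real.log ξ) * (4 * A) ≤
            (Real.log n + |Real.log ξ| * Real.log n) * (4 * A) := by gcongr; linarith
        _ = 4 * A * (1 + |Real.log ξ|) * Real.log n := by ring
        _ ≤ _ := h4
    calc n * Real.exp (-((n : ℝ) ^ (2 * β - 1) / (4 * A))) ≤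
          n * Real.exp (-(Real.log n - Real.log ξ)) := by gcongr
      _ = ξ := by
          rw [neg_sub, Real.exp_sub, Real.exp_log hξ, Real.exp_log hn']
          field_simp

theorem sum_tailQuantile_le [IsProbabilityMeasure ν] (hν : ν (Set.Iio 0) = 0) {l b L : ℝ} {K : ℕ}
    (hl : 0 < l) (hb : 0 ≤ b) (hK : K * l ≤ L) :
    ∑ k ∈ Finset.range (K + 1), tailQuantile ν (k * l + b) ≤
      tailQuantile ν 0 + primitive (tailQuantile ν) L / l := by
  have hanti := tailQuantile_antitone (ν := ν) hν
  have h1 := sum_range_succ_le_primitive hanti hl K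
  have h2 : primitive (tailQuantile ν) (K * l) / l ≤ primitive (tailQuantile ν) L / l :=
    div_le_div_of_nonneg_right (primitive_mono hanti (tailQuantile_nonneg hν) hK) hl.le
  have h3 : ∑ k ∈ Finset.range (K + 1), tailQuantile ν (k * l + b) ≤
      ∑ k ∈ Finset.range (K + 1), tailQuantile ν (k * l) :=
    Finset.sum_le_sum fun k _ => hanti (by linarith)
  refine h3.trans ?_
  rw [Finset.sum_range_succ', Nat.cast_zero, zero_mul]
  linarith

set_option maxHeartbeats 1000000 in
theorem eventually_law_no_cheap_path_le [IsProbabilityMeasure ν] (hpow : PowerLawTail d τ)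
    (hlim : HasLimitingDistributions d) (hν : ν (Set.Iio 0) = 0) (hdiv : NonExplosive ν)
    {ε ξ : ℝ} (hε : 0 < ε) (hξ : 0 < ξ) :
    ∀ᶠ n : ℕ in atTop, law (d n) ν {ω | ¬ ∃ p : ω.graph.Path ω.u ω.v,
        walkWeight ω.weight p.1 ≤ (1 + ε) * typicalDist ν τ n ∧
        (p.1.length : ℝ) ≤ (1 + ε) * (2 * depth τ n)} ≤ ENNReal.ofReal ξ := by
  have h2 : 2 < τ := hpow.1
  have h3 : τ < 3 := hpow.2.1
  obtain ⟨lam, hlam⟩ : ∃ lam, lam = |Real.log (τ - 2)| := ⟨_, rfl⟩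
  have hlam0 : 0 < lam := hlam ▸ abs_log_pos h2 h3
  obtain ⟨δ, hδ0, hδε, hδ1⟩ : ∃ δ : ℝ, 0 < δ ∧ δ ≤ ε / 4 ∧ δ ≤ 1 / 4 :=
    ⟨min ε 1 / 4, by positivity, by have := min_le_left ε 1; linarith,
      by have := min_le_right ε 1; linarith⟩
  obtain ⟨l, hl⟩ : ∃ l, l = lam * (1 - δ) := ⟨_, rfl⟩
  have hl0 : 0 < l := hl ▸ mul_pos hlam0 (by linarith)
  obtain ⟨ρ, hρ⟩ : ∃ ρ, ρ = Real.exp l := ⟨_, rfl⟩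
  have hlogρ : Real.log ρ = l := by rw [hρ, Real.log_exp]
  have hρ1 : 1 < ρ := hρ ▸ Real.one_lt_exp_iff.2 hl0
  have hρτ : (τ - 2) * ρ < 1 := by
    have : (τ - 2) * ρ = Real.exp (-(lam * δ)) := by
      rw [hρ, hl, show lam * (1 - δ) = lam + -(lam * δ) by ring, Real.exp_add, hlam,
        exp_abs_log h2 h3]
      have : τ - 2 ≠ 0 := by linarith
      field_simp
    rw [this]
    exact Real.exp_lt_one_iff.2 (neg_lt_zero.2 (by positivity))
  -- The first condition is the growth condition of the stages, possible because `(τ - 2) * ρ < 1`.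
  -- The second leaves room for an exponent `β` above one half, because `τ < 3`.
  obtain ⟨η, hη0, hη1, hη2⟩ : ∃ η : ℝ, 0 < η ∧ (τ - 2 + η) * ρ + 2 * η ≤ 1 ∧ τ - 1 + 3 * η < 2 := by
    refine ⟨min ((1 - (τ - 2) * ρ) / (ρ + 2)) ((3 - τ) / 6),
      lt_min (div_pos (by linarith) (by linarith)) (by linarith), ?_, ?_⟩
    · have h := min_le_left ((1 - (τ - 2) * ρ) / (ρ + 2)) ((3 - τ) / 6)
      rw [le_div_iff₀ (by linarith)] at h
      linarith
    · have h := min_le_right ((1 - (τ - 2) * ρ) / (ρ + 2)) ((3 - τ) / 6)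
      linarith
  obtain ⟨α, hα, hcountα⟩ := exists_count_lower hpow
  obtain ⟨A₀, hA₀, hcount⟩ := hcountα η hη0
  obtain ⟨A₁, hA₁, hcard⟩ := exists_card_halfEdge_bounds hpow hlim
  obtain ⟨A, hA₀A, hA₁A⟩ : ∃ A, A₀ ≤ A ∧ A₁ ≤ A := ⟨_, le_max_left _ _, le_max_right _ _⟩
  have hA1 : 1 ≤ A := hA₀.trans hA₀A
  obtain ⟨β, hβ, hβ'⟩ : ∃ β, 1 / 2 < β ∧ β < min α (1 / (τ - 1 + 3 * η)) := by
    refine exists_between (lt_min hα ?_)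
    exact one_div_lt_one_div_of_lt (by linarith) hη2
  have hβα : β < α := hβ'.trans_le (min_le_left _ _)
  have hβη : β * (τ - 1 + 3 * η) < 1 := by
    have := hβ'.trans_le (min_le_right _ _)
    rwa [lt_div_iff₀ (by linarith)] at this
  have hβ1 : β ≤ 1 := (le_mul_of_one_le_right (by linarith) (by linarith)).trans hβη.le
  have hGt : Tendsto (fun G => 64 * A ^ 2 * Real.exp (-(η * G))) atTop (𝓝 0) := by
    simpa using (tendsto_exp_neg_mul hη0).const_mul (64 * A ^ 2)
  have hGt' := tendsto_exp_neg_mul (mul_pos hη0 (show 0 < ρ - 1 by linarith))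
  obtain ⟨G, hG3, hGη, hGξ, hGr⟩ := ((eventually_ge_atTop (3 : ℝ)).and
    ((eventually_ge_atTop (1 / η)).and
      ((hGt.eventually_le_const (show (0 : ℝ) < ξ / 16 by positivity)).and
        (hGt'.eventually_le_const (show (0 : ℝ) < 1 / 2 by norm_num))))).exists
  rw [show η * (ρ - 1) * G = η * G * (ρ - 1) by ring] at hGr
  rw [div_le_iff₀ hη0, mul_comm] at hGη
  obtain ⟨p₀, hp₀⟩ : ∃ p₀, p₀ = Real.exp (-((τ - 1 + η) * G)) / (2 * A ^ 2) := ⟨_, rfl⟩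
  have hp₀0 : 0 < p₀ := by rw [hp₀]; positivity
  have hp₀1 : p₀ ≤ 1 := by
    rw [hp₀, div_le_one (by positivity)]
    have h1 : Real.exp (-((τ - 1 + η) * G)) ≤ 1 :=
      Real.exp_le_one_iff.2 (neg_nonpos.2 (mul_nonneg (by linarith) (by linarith)))
    have h2 : 1 ≤ A ^ 2 := one_le_pow₀ hA1
    linarith
  -- The order of choices matters: `G` fixes the chance `p₀` of finding a good starting vertex, `p₀`
  -- fixes the number `t₀` of search steps, and only then are `M` and `κ` chosen small enough to be
  -- summed over these steps.
  obtain ⟨t₀, ht₀⟩ := ((tendsto_pow_atTop_nhds_zero_of_lt_one (r := 1 - p₀) (by linarith)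
    (by linarith)).eventually_le_const (show (0 : ℝ) < ξ / 16 by positivity)).exists
  have hξt : 0 < ξ / 16 / (t₀ + 1 : ℝ) := by positivity
  obtain ⟨M, hM0, hM⟩ := exists_measure_Ioi_le (ν := ν) hξt
  obtain ⟨κ, hκ0, hκξ, hκ1⟩ : ∃ κ : ℝ, 0 < κ ∧ κ ≤ ξ / 16 / (t₀ + 1 : ℝ) ∧ κ ≤ 1 :=
    ⟨min (ξ / 16 / (t₀ + 1 : ℝ)) 1, lt_min hξt one_pos, min_le_left _ _, min_le_right _ _⟩
  obtain ⟨I, hI⟩ : ∃ I, I = primitive (tailQuantile ν) := ⟨_, rfl⟩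
  obtain ⟨c₁, hc₁⟩ : ∃ c₁, c₁ = 2 * (t₀ * M + tailQuantile ν 0 + M) * l + 2 * I lam := ⟨_, rfl⟩
  filter_upwards [hcount, hcard, eventually_ge_atTop 2,
    eventually_room (τ := τ) (G := G) (ξ := ξ / 4) hβ hβη hA1 hl0 hη0
      (by positivity),
    eventually_pairedDegree_le hpow hlim (show 0 < κ / 8 by positivity),
    (tendsto_natCast_atTop_atTop (R := ℝ)).eventually_ge_atTop ((t₀ + 1) * Real.exp G / (κ / 8)),
    (tendsto_typicalDist hν hdiv h2 h3).eventually_ge_atTop (2 * c₁ / (ε * l)),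
    (tendsto_typicalDist hν hdiv h2 h3).eventually_ge_atTop 0,
    (tendsto_depth h2 h3).eventually_ge_atTop (2 * (t₀ + 2) / ε)]
    with n hcount hcard hn hroom hmax htG htyp hT0 hdep
  obtain ⟨hdeg, hnl, hln⟩ := hcard
  obtain ⟨hGx, hx1, hroom, hlast⟩ := hroom
  have hn2 : (2 : ℝ) ≤ n := by exact_mod_cast hn
  have hn' : (0 : ℝ) < n := by linarith
  obtain ⟨L, hL⟩ : ∃ L, L = Real.log (Real.log n) := ⟨_, rfl⟩
  have hquot : 1 ≤ β * Real.log n / G := (one_le_div (by linarith)).2 hGx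
  -- `K` is the last index with `exp (G * ρ ^ K)` at most `n ^ β`.
  obtain ⟨K, hK⟩ : ∃ K : ℕ, K = ⌊Real.log (β * Real.log n / G) / l⌋₊ := ⟨_, rfl⟩
  have hK1 : K * l ≤ Real.log (β * Real.log n / G) := by
    rw [← le_div_iff₀ hl0, hK]
    exact Nat.floor_le (div_nonneg (Real.log_nonneg hquot) hl0.le)
  have hK2 : Real.log (β * Real.log n / G) ≤ (K + 1 : ℕ) * l := by
    rw [← div_le_iff₀ hl0, hK]
    push_cast
    exact (Nat.lt_floor_add_one _).le
  have hKL : K * l ≤ L := by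
    refine hK1.trans ?_
    rw [hL]
    refine Real.log_le_log (by linarith) ?_
    rw [div_le_iff₀ (by linarith)]
    exact (mul_le_of_le_one_left (by linarith) hβ1).trans
      (le_mul_of_one_le_right (by linarith) (by linarith))
  have hpowK : ∀ k : ℕ, ρ ^ k = Real.exp (k * l) := fun k => by rw [hρ, ← Real.exp_nat_mul]
  have hH : (n : ℝ) ^ β = Real.exp (G * (β * Real.log n / G)) := by
    rw [Real.rpow_def_of_pos hn']
    congr 1
    have : G ≠ 0 := by linarith
    field_simp
  have hcountH : ∀ x : ℝ, 1 ≤ x → x ≤ (n : ℝ) ^ β → n * x ^ (-(τ - 1) - η) ≤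
      A * ((Finset.univ.filter fun v => x ≤ (pairedDegree (d n) v : ℝ)).card : ℝ) := by
    intro x hx hxH
    exact (hcount x hx (hxH.trans_lt (Real.rpow_lt_rpow_of_exponent_lt (by linarith) hβα))).trans
      (mul_le_mul_of_nonneg_right hA₀A (Nat.cast_nonneg _))
  -- The power law reaches beyond `n ^ β`, so its lower bound gives at least one vertex of this
  -- degree.
  obtain ⟨hub, hhub⟩ : ∃ hub, (n : ℝ) ^ β ≤ pairedDegree (d n) hub := by
    have h := hcountH _ (Real.one_le_rpow (by linarith) (by linarith)) le_rfl
    have h0 : 0 < n * ((n : ℝ) ^ β) ^ (-(τ - 1) - η) := by positivity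
    have h1 := pos_of_mul_pos_right (h0.trans_le h) (by linarith)
    obtain ⟨v, hv⟩ := Finset.card_pos.1 (Nat.cast_pos.1 h1)
    exact ⟨v, (Finset.mem_filter.1 hv).2⟩
  have hmain := law_no_cheap_path_le_of_growth (d := d n) (ν := ν) hν (by omega) (A := A) (G := G)
    (ρ := ρ) (η := η) (τ := τ) (H := (n : ℝ) ^ β) (M := M) (κ := κ) (K := K) (t₀ := t₀) (hub := hub)
    hA1 hG3 hρ1 hη0 h2 hM0 hκ0.le hη1 hGr hdeg
    (hln.trans (mul_le_mul_of_nonneg_right hA₁A hn'.le)) hhub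
    (by
      rw [hH, hpowK]
      refine Real.exp_le_exp.2 (mul_le_mul_of_nonneg_left ?_ (by linarith))
      exact (Real.le_log_iff_exp_le (by linarith)).1 hK1)
    (by
      rw [hH, hpowK]
      refine Real.exp_le_exp.2 (mul_le_mul_of_nonneg_left ?_ (by linarith))
      exact (Real.log_le_iff_le_exp (by linarith)).1 hK2)
    hcountH
    (hroom K (by rw [le_div_iff₀ hl0, ← hL]; exact hKL))
    -- The hub and the search vertices carry at most `κ * n / 4` half-edges, an eighth of `κ * n`
    -- each. Since `κ ≤ 1` and `n ≥ 2`, at least `n / 4` partners remain.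
    (by
      have h1 := hmax hub
      rw [div_le_iff₀ (by positivity)] at htG
      have h4 : (pairedDegree (d n) hub : ℝ) + (t₀ + 1) * Real.exp G ≤ κ * (n / 4) := by linarith
      refine h4.trans (mul_le_mul_of_nonneg_left ?_ hκ0.le)
      have h5 : κ * (n / 4) ≤ 1 * (n / 4) := by gcongr
      linarith)
  have hlaml : lam ≤ (1 + ε / 2) * l := by
    have h6 : 1 ≤ (1 + ε / 2) * (1 - δ) := by
      have : ε * δ ≤ ε * (1 / 4) := mul_le_mul_of_nonneg_left hδ1 hε.le
      linarith
    calc lam ≤ lam * ((1 + ε / 2) * (1 - δ)) := le_mul_of_one_le_right hlam0.le h6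
      _ = _ := by rw [hl]; ring
  refine (measure_mono ?_).trans (hmain.trans (ENNReal.ofReal_le_ofReal ?_))
  · rintro ω hω ⟨p, hpw, hpl⟩
    refine hω ⟨p, hpw.trans ?_, le_trans (show (p.1.length : ℝ) ≤ (2 * (t₀ + (K + 2)) : ℕ) by
      exact_mod_cast hpl) ?_⟩
    · rw [hlogρ]
      have hsum := sum_tailQuantile_le hν hl0 (Real.log_nonneg hGη) hKL
      have hle := le_typicalDist (ν := ν) hν h2 h3 n
      rw [← hI] at hsum hle
      rw [← hlam, ← hL] at hle
      generalize typicalDist ν τ n = T at *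
      generalize (∑ k ∈ Finset.range (K + 1), tailQuantile ν (k * l + Real.log (η * G))) = S at *
      have hT : 2 * (I L - I lam) ≤ T * lam := by
        have := mul_le_mul_of_nonneg_right hle hlam0.le
        rwa [mul_assoc, div_mul_cancel₀ _ hlam0.ne'] at this
      have hS : (S - tailQuantile ν 0) * l ≤ I L := by
        rw [← le_div_iff₀ hl0]
        linarith
      rw [div_le_iff₀ (by positivity), hc₁] at htyp
      have hTl : T * lam ≤ T * ((1 + ε / 2) * l) := mul_le_mul_of_nonneg_left hlaml hT0
      refine le_of_mul_le_mul_right ?_ hl0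
      linarith
    · rw [div_le_iff₀ hε] at hdep
      have hd : depth τ n * lam = L := by rw [depth, ← hlam, hL, div_mul_cancel₀ _ hlam0.ne']
      have hd0 : 0 ≤ depth τ n := by
        have : 0 < depth τ n * ε := lt_of_lt_of_le (by positivity) hdep
        exact (pos_of_mul_pos_left this hε.le).le
      have hKd : (K : ℝ) ≤ depth τ n * (1 + ε / 2) := by
        refine le_of_mul_le_mul_right ?_ hl0
        rw [mul_assoc]
        exact (hKL.trans hd.ge).trans (mul_le_mul_of_nonneg_left hlaml hd0)
      push_cast
      linarith
  · have h1 : (t₀ + 1) * ν.real (Set.Ioi M) ≤ ξ / 16 := by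
      rwa [le_div_iff₀' (by positivity)] at hM
    have h2 : (t₀ + 1) * κ ≤ ξ / 16 := by
      rwa [le_div_iff₀' (by positivity)] at hκξ
    rw [← hp₀]
    linarith

end UpperLimit

/-! ### The law of the model is a probability measure -/

section Law

variable {n : ℕ} {d : Fin n → ℕ}

/-- The extra half-edge repairs the parity; without it there might be no pairing, and the uniform
law would be zero rather than a probability measure. -/
theorem even_card_halfEdge (hn : 0 < n) (d : Fin n → ℕ) : Even (Fintype.card (HalfEdge d)) := by
  rw [card_halfEdge]
  unfold pairedDegree
  rw [Finset.sum_add_distrib]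
  by_cases h : Odd (totalDegree d)
  · have h1 : ∑ v : Fin n, (if Odd (totalDegree d) ∧ (v : ℕ) + 1 = n then 1 else 0) = 1 := by
      rw [Finset.sum_eq_single (⟨n - 1, by omega⟩ : Fin n)]
      · rw [if_pos ⟨h, by simp only []; omega⟩]
      · intro v _ hv
        rw [if_neg]
        rintro ⟨-, hv'⟩
        exact hv (Fin.ext (by simp only []; omega))
      · simp
    rw [h1]
    exact h.add_odd odd_one
  · simp only [h, false_and, if_false, Finset.sum_const_zero, add_zero]
    exact Nat.not_odd_iff_even.1 h

theorem nonempty_pairing (hn : 0 < n) (d : Fin n → ℕ) : Nonempty (Pairing d) := by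
  obtain ⟨m, hm⟩ := even_card_halfEdge hn d
  have e : HalfEdge d ≃ Fin m × Bool := Fintype.equivOfCardEq (by
    rw [hm, Fintype.card_prod, Fintype.card_fin, Fintype.card_bool]; ring)
  refine ⟨⟨fun h => e.symm ((e h).1, !(e h).2), fun h => ?_, fun h hh => ?_⟩⟩
  · simp
  · have h1 := congrArg e hh
    rw [Equiv.apply_symm_apply] at h1
    have h2 := congrArg Prod.snd h1
    simp at h2

theorem isProbabilityMeasure_law (hn : 0 < n) (d : Fin n → ℕ) (ν : Measure ℝ)
    [IsProbabilityMeasure ν] : IsProbabilityMeasure (law d ν) := by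
  have h1 := nonempty_pairing hn d
  have h2 : Nonempty (Selection d) := ⟨fun S => ⟨S.2.choose, S.2.choose_spec⟩⟩
  have h3 : Nonempty (Fin n × Fin n) := ⟨(⟨0, hn⟩, ⟨0, hn⟩)⟩
  have i1 : IsProbabilityMeasure (uniformOn (Set.univ : Set (Pairing d))) :=
    isProbabilityMeasure_uniformOn Set.finite_univ Set.univ_nonempty
  have i2 : IsProbabilityMeasure (uniformOn (Set.univ : Set (Selection d))) :=
    isProbabilityMeasure_uniformOn Set.finite_univ Set.univ_nonempty
  have i3 : IsProbabilityMeasure (uniformOn (Set.univ : Set (Fin n × Fin n))) :=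
    isProbabilityMeasure_uniformOn Set.finite_univ Set.univ_nonempty
  unfold law
  infer_instance

end Law

/-! ### Convergence in probability -/

section Limit

theorem tendsto_zero_of_eventually_le_ofReal {f : ℕ → ENNReal}
    (h : ∀ ξ : ℝ, 0 < ξ → ∀ᶠ n in atTop, f n ≤ ENNReal.ofReal ξ) : Tendsto f atTop (𝓝 0) := by
  refine ENNReal.tendsto_nhds_zero.2 fun ε hε => ?_
  obtain ⟨r, hr0, hrε⟩ := ENNReal.lt_iff_exists_nnreal_btwn.1 hε
  filter_upwards [h r (by exact_mod_cast hr0)] with n hn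
  rw [ENNReal.ofReal_coe_nnreal] at hn
  exact hn.trans hrε.le

theorem tendsto_law_one {d : (n : ℕ) → Fin n → ℕ} {ν : Measure ℝ} [IsProbabilityMeasure ν]
    {S : (n : ℕ) → Set (Sample (d n))}
    (h : ∀ ξ : ℝ, 0 < ξ → ∀ᶠ n in atTop, law (d n) ν (S n)ᶜ ≤ ENNReal.ofReal ξ) :
    Tendsto (fun n => law (d n) ν (S n)) atTop (𝓝 1) := by
  have h0 := tendsto_zero_of_eventually_le_ofReal h
  have h1 : Tendsto (fun n => 1 - law (d n) ν (S n)ᶜ) atTop (𝓝 1) := by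
    simpa using ENNReal.Tendsto.sub tendsto_const_nhds h0 (Or.inl ENNReal.one_ne_top)
  refine tendsto_of_tendsto_of_tendsto_of_le_of_le' h1 tendsto_const_nhds ?_ ?_
  · filter_upwards [eventually_gt_atTop 0] with n hn
    have := isProbabilityMeasure_law hn (d n) ν
    rw [tsub_le_iff_right, ← measure_univ (μ := law (d n) ν), ← Set.union_compl_self (S n)]
    exact measure_union_le _ _
  · filter_upwards [eventually_gt_atTop 0] with n hn
    have := isProbabilityMeasure_law hn (d n) ν
    exact prob_le_one

end Limit

/-! ### From bounds on walks to the weighted distance and the hopcount -/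

section Distances

variable {V : Type*} {G : SimpleGraph V} {w : Sym2 V → ℝ} {x y : V}

theorem abs_weightedDist_div_sub_one_le {a ε : ℝ} (ha : 0 < a)
    (hlow : ∀ p : G.Walk x y, (1 - ε) * a ≤ walkWeight w p)
    (hup : ∃ p : G.Path x y, walkWeight w p.1 ≤ (1 + ε) * a) :
    (weightedDist G w x y / (a : EReal) - 1).abs ≤ ENNReal.ofReal ε := by
  obtain ⟨p, hp⟩ := hup
  have h1 : (((1 - ε) * a : ℝ) : EReal) ≤ weightedDist G w x y :=
    le_iInf fun q => EReal.coe_le_coe_iff.2 (hlow q.1)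
  have h2 : weightedDist G w x y ≤ (((1 + ε) * a : ℝ) : EReal) :=
    (iInf_le _ p).trans (EReal.coe_le_coe_iff.2 hp)
  obtain ⟨z, hz⟩ : ∃ z : ℝ, (z : EReal) = weightedDist G w x y :=
    ⟨_, EReal.coe_toReal (ne_top_of_le_ne_top (EReal.coe_ne_top _) h2)
      (ne_bot_of_le_ne_bot (EReal.coe_ne_bot _) h1)⟩
  rw [← hz, EReal.coe_le_coe_iff] at h1 h2
  rw [← hz, ← EReal.coe_div, ← EReal.coe_one, ← EReal.coe_sub, EReal.abs_def]
  refine ENNReal.ofReal_le_ofReal (abs_le.2 ⟨?_, ?_⟩)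
  · rw [← le_div_iff₀ ha] at h1
    linarith
  · rw [← div_le_iff₀ ha] at h2
    linarith

/-- The bound holds for all walks, hence for optimal paths. If no path qualifies, the hopcount is
infinite and the bound still holds. -/
theorem le_hopcount_div {a b : ℝ} (hb : 0 < b)
    (h : ∀ p : G.Walk x y, a * b ≤ p.length) :
    (a : EReal) ≤ ((hopcount G w x y : ENNReal) : EReal) / (b : EReal) := by
  rw [EReal.le_div_iff_mul_le (EReal.coe_pos.2 hb) (EReal.coe_ne_top b), ← EReal.coe_mul]
  have hk : ((⌈a * b⌉₊ : ℕ) : ℕ∞) ≤ hopcount G w x y :=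
    le_iInf₂ fun p _ => Nat.cast_le.2 (Nat.ceil_le.2 (h p.1))
  have hk' : ((⌈a * b⌉₊ : ℕ) : ENNReal) ≤ (hopcount G w x y : ENNReal) := by
    exact_mod_cast ENat.toENNReal_le.2 hk
  calc ((a * b : ℝ) : EReal) ≤ ((⌈a * b⌉₊ : ℝ) : EReal) :=
        EReal.coe_le_coe_iff.2 (Nat.le_ceil _)
    _ = (((⌈a * b⌉₊ : ℕ) : ENNReal) : EReal) := by
        rw [← ENNReal.ofReal_natCast, EReal.coe_ennreal_ofReal, max_eq_left (Nat.cast_nonneg _)]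
    _ ≤ _ := EReal.coe_ennreal_le_coe_ennreal_iff.2 hk'

end Distances

end ErasedCM

end

theorem theorem2p4 (d : (n : ℕ) → Fin n → ℕ) (τ : ℝ)
    (hpow : ErasedCM.PowerLawTail d τ)
    (hlim : ErasedCM.HasLimitingDistributions d)
    (ν : Measure ℝ) [IsProbabilityMeasure ν] (hnonneg : ν (Set.Iio 0) = 0)
    (hν : ErasedCM.NonExplosive ν) :
    -- the weighted distance, divided by its typical value, tends to `1` in probability
    (∀ ε : ℝ, 0 < ε →
      Tendsto (fun n : ℕ => ErasedCM.law (d n) ν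
          {ω | ENNReal.ofReal ε < (ω.dL / (ErasedCM.typicalDist ν τ n : EReal) - 1).abs})
        atTop (𝓝 0)) ∧
    -- lower bound for the hopcount
    (∀ ε : ℝ, 0 < ε →
      Tendsto (fun n : ℕ => ErasedCM.law (d n) ν
          {ω | ((1 - ε : ℝ) : EReal) ≤
            ((ω.dH : ENNReal) : EReal) / ((2 * ErasedCM.depth τ n : ℝ) : EReal)})
        atTop (𝓝 1)) ∧
    -- an almost optimal path with few edges
    (∀ ε : ℝ, 0 < ε →
      Tendsto (fun n : ℕ => ErasedCM.law (d n) ν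
          {ω | ∃ p : ω.graph.Path ω.u ω.v,
            ErasedCM.walkWeight ω.weight p.1 ≤ (1 + ε) * ErasedCM.typicalDist ν τ n ∧
            (p.1.length : ℝ) ≤ (1 + ε) * (2 * ErasedCM.depth τ n)})
        atTop (𝓝 1)) := by
  have h2 : 2 < τ := hpow.1
  have h3 : τ < 3 := hpow.2.1
  refine ⟨fun ε hε => ErasedCM.tendsto_zero_of_eventually_le_ofReal fun ξ hξ => ?_,
    fun ε hε => ErasedCM.tendsto_law_one fun ξ hξ => ?_,
    fun ε hε => ErasedCM.tendsto_law_one fun ξ hξ =>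
      ErasedCM.eventually_law_no_cheap_path_le hpow hlim hnonneg hν hε hξ⟩
  · filter_upwards [ErasedCM.eventually_law_short_path_le hpow hlim hnonneg hν hε (half_pos hξ),
      ErasedCM.eventually_law_no_cheap_path_le hpow hlim hnonneg hν hε (half_pos hξ),
      -- Divergence of the typical distance is also what permits the division by it for large `n`.
      (ErasedCM.tendsto_typicalDist hnonneg hν h2 h3).eventually_gt_atTop 0] with n hlow hup ha
    rw [← add_halves ξ, ENNReal.ofReal_add (half_pos hξ).le (half_pos hξ).le]
    refine le_trans (measure_mono fun ω hω => ?_)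
      ((measure_union_le _ _).trans (add_le_add hlow hup))
    by_contra hcon
    rw [Set.mem_union, not_or] at hcon
    obtain ⟨h4, h5⟩ := hcon
    obtain ⟨p, hp, -⟩ := not_not.1 h5
    exact absurd (ErasedCM.abs_weightedDist_div_sub_one_le ha (not_not.1 h4).1 ⟨p, hp⟩)
      (not_le.2 hω)
  · filter_upwards [ErasedCM.eventually_law_short_path_le hpow hlim hnonneg hν hε hξ,
      (ErasedCM.tendsto_depth h2 h3).eventually_gt_atTop 0] with n hlow hd
    refine le_trans (measure_mono fun ω hω => ?_) hlow
    intro hcon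
    exact hω (ErasedCM.le_hopcount_div (mul_pos two_pos hd) hcon.2)
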